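/- Let $\|\cdot\|$ be the Euclidean norm on $\mathbb R^d$, $B_r=\{x\in\mathbb R^d:\|x\|\le r\}$ for $r\ge0$, $B_r^c=\mathbb R^d\setminus B_r$, $\mathcal S=\{x\in\mathbb R^d:\|x\|=1\}$. Let $\overline{\mathbb R^d}$ be the compactification of $\mathbb R^d$ obtained by adding a sphere at infinity (i.e. the closed unit ball, with $\mathbb R^d$ embedded radially as the open unit ball); measures on subsets of $\mathbb R^d$ are extended by giving no mass to the points at infinity. Vague convergence $m_n\stackrel v\to m$ on $\overline{\mathbb R^d}\setminus B_r$ means that $m$ is Radon (finite on compact subsets of $\overline{\mathbb R^d}\setminus B_r$) and $\int f\,dm_n\to\int f\,dm$ for every continuous compactly supported $f:\overline{\mathbb R^d}\setminus B_r\to\mathbb R$. Let $H$ be an $\mathbb R^d$-valued random variable, $\mu$ a non-null measure on $\mathbb R^d\setminus\{0\}$ and $a_n\to\infty$ a sequence such that $nP(a_n^{-1}H\in\cdot)\stackrel v\to\mu$ on $\overline{\mathbb R^d}\setminus\{0\}$. Then $P(\|H\|>\cdot)$ is regularly varying with index $-\alpha$ for a unique $\alpha>0$. Assume that $H$ has a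 symmetric law if $\alpha=1$, and that $E(H)=0$ if $\alpha>1$. Let $H_1,H_2,\dots$ be i.i.d. copies of $H$, and let $L_1,L_2,\dots$ be i.i.d. copies of a $[0,\infty)$-valued random variable $L$, the sequence $(L_j)$ being independent of $(H_j)$. Let $M_n>0$ with $M_n\to\infty$, and set $$X_{nj}=H_j\mathbf 1(\|H_j\|\le M_n)+\frac{H_j}{\|H_j\|}(M_n+L_j)\mathbf 1(\|H_j\|>M_n),\qquad S_n=\sum_{j=1}^nX_{nj}.$$ Assume that $nP(\|H\|>M_n)\to0$ (soft truncation), that $M_n/\sqrt{n^{1+\gamma}}\to\infty$ for some $\gamma>0$ if $\alpha=2$, and that $M_n/\sqrt{n\log M_n}\to\infty$ if $\alpha>2$. Define the measures $$\sigma(A)=\frac{\mu(\{x:\|x\|\ge1,\ x/\|x\|\in A\})}{\mu(B_1^c)},\quad \nu(A)=\frac{\mu(A\cap B_1)}{\mu(B_1^c)}+\sigma(A\cap\mathcal S),\quad \nu^{(k)}(A)=\int\cdots\int\mathbf 1\Big(\sum_{j=1}^kx_j\in A\Big)\nu(dx_1)\cdots\nu(dx_k).$$ **Theorem.** Let $k\ge1$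 be an integer and suppose that $P(L>x)=o\big(P(\|H\|>x)^{k-1}\big)$ as $x\to\infty$. Then, as $n\to\infty$, $$\frac{P(M_n^{-1}S_n\in\cdot)}{\{nP(\|H\|>M_n)\}^k}\stackrel v\longrightarrow\frac1{k!}\,\nu^{(k)}(\cdot)\qquad\text{on }\overline{\mathbb R^d}\setminus B_{k-1}.$$ Consequently, for every $r\in(k-1,k)$ with $\nu^{(k)}(\{x:\|x\|=r\})=0$, there is $C_r\in(0,\infty)$ such that $$P(\|S_n\|>rM_n)\sim C_r\{nP(\|H\|>M_n)\}^k\qquad(n\to\infty),$$ and this condition on $r$ holds for all but countably many $r\in(k-1,k)$. -/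

import Mathlib

open MeasureTheory ProbabilityTheory Filter Topology Asymptotics
open scoped ENNReal CompactlySupported

noncomputable section

namespace TruncatedTails

/-- `ℝ^d` with the Euclidean (`L²`) norm. -/
abbrev Vec (d : ℕ) : Type := EuclideanSpace ℝ (Fin d)

/-! ### The compactified space -/

/-- The compactification of `ℝ^d` by a sphere at infinity, realised as the closed unit ball:
the open unit ball is a copy of `ℝ^d` (see `toCompactified`), and the unit sphere consists of
the points at infinity. -/
abbrev Compactified (d : ℕ) : Type := ↥(Metric.closedBall (0 : Vec d) 1)

/-- The inclusion of `ℝ^d` into its compactification, `x ↦ x / √(1 + ‖x‖²)`. -/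
def toCompactified {d : ℕ} (x : Vec d) : Compactified d :=
  ⟨(Homeomorph.unitBall x : Vec d), Metric.ball_subset_closedBall (Homeomorph.unitBall x).2⟩

theorem isOpenEmbedding_toCompactified {d : ℕ} :
    IsOpenEmbedding (toCompactified : Vec d → Compactified d) := by
  have h1 : IsOpenEmbedding (fun x : Vec d => ((Homeomorph.unitBall x : Vec d))) :=
    Metric.isOpen_ball.isOpenEmbedding_subtypeVal.comp Homeomorph.unitBall.isOpenEmbedding
  have hc : Continuous (toCompactified : Vec d → Compactified d) := h1.continuous.subtype_mk _
  have hr : Set.range (toCompactified : Vec d → Compactified d) =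
      Subtype.val ⁻¹' Metric.ball (0 : Vec d) 1 := by
    ext y
    constructor
    · rintro ⟨x, rfl⟩
      exact (Homeomorph.unitBall x).2
    · intro hy
      refine ⟨Homeomorph.unitBall.symm ⟨y, hy⟩, ?_⟩
      apply Subtype.ext
      simp [toCompactified]
  refine ⟨IsEmbedding.of_comp hc continuous_subtype_val h1.isEmbedding, ?_⟩
  rw [hr]
  exact Metric.isOpen_ball.preimage continuous_subtype_val

/-- The compactified space with the closed ball of `ℝ^d` of radius `r` about the origin removed. -/
abbrev CompactifiedMinusBall (d : ℕ) (r : ℝ) : Type :=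
  {y : Compactified d // y ∉ toCompactified '' Metric.closedBall (0 : Vec d) r}

/-- A measure on `ℝ^d`, restricted to the complement of the closed ball of radius `r` and extended
to the compactified space minus that ball by giving no mass to the points at infinity. -/
def extendOutside {d : ℕ} (r : ℝ) (m : Measure (Vec d)) : Measure (CompactifiedMinusBall d r) :=
  (m.map toCompactified).comap Subtype.val

theorem extendOutside_apply {d : ℕ} (r : ℝ) (m : Measure (Vec d))
    (A : Set (CompactifiedMinusBall d r)) :
    extendOutside r m A =
      m {x | ∃ h : toCompactified x ∉ toCompactified '' Metric.closedBall (0 : Vec d) r,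
        (⟨toCompactified x, h⟩ : CompactifiedMinusBall d r) ∈ A} := by
  have hme := (isOpenEmbedding_toCompactified (d := d)).measurableEmbedding
  have hs : MeasurableSet
      {y : Compactified d | y ∉ toCompactified '' Metric.closedBall (0 : Vec d) r} :=
    (hme.measurableSet_image.2 Metric.isClosed_closedBall.measurableSet).compl
  have hv : MeasurableEmbedding (Subtype.val : CompactifiedMinusBall d r → Compactified d) :=
    MeasurableEmbedding.subtype_coe hs
  rw [extendOutside, hv.comap_apply, hme.map_apply]
  congr 1
  ext x
  simp

/-- Vague convergence of a sequence of measures to a Radon measure: convergence of the integrals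
of all compactly supported continuous functions. (On the spaces used here a Borel measure is Radon
iff it is finite on compact sets.) -/
def VagueTendsto {X : Type*} [TopologicalSpace X] [MeasurableSpace X]
    (m : ℕ → Measure X) (m' : Measure X) : Prop :=
  IsFiniteMeasureOnCompacts m' ∧
    ∀ f : C_c(X, ℝ), Tendsto (fun n => ∫ x, f x ∂(m n)) atTop (𝓝 (∫ x, f x ∂m'))

/-- Vague convergence, on the compactified space minus the closed ball of radius `r`, of measures
on `ℝ^d` that give no mass to infinity. -/
def VagueTendstoOutside {d : ℕ} (r : ℝ) (m : ℕ → Measure (Vec d)) (m' : Measure (Vec d)) : Prop :=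
  VagueTendsto (fun n => extendOutside r (m n)) (extendOutside r m')

/-! ### The limit measures -/

/-- The spectral measure of `μ`, as a measure on `ℝ^d` carried by the unit sphere. -/
def spectralMeasure {d : ℕ} (μ : Measure (Vec d)) : Measure (Vec d) :=
  (μ (Metric.closedBall 0 1)ᶜ)⁻¹ •
    (μ.restrict {x | 1 ≤ ‖x‖}).map (fun x => (‖x‖)⁻¹ • x)

/-- `ν(A) = μ(A ∩ B_1) / μ(B_1ᶜ) + σ(A ∩ S)`. -/
def nu {d : ℕ} (μ : Measure (Vec d)) : Measure (Vec d) :=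
  (μ (Metric.closedBall 0 1)ᶜ)⁻¹ • μ.restrict (Metric.closedBall 0 1) +
    (spectralMeasure μ).restrict (Metric.sphere 0 1)

/-- The `k`-fold convolution of `ν`: the image of the product measure `ν ⊗ ⋯ ⊗ ν` under
`(x_1, …, x_k) ↦ x_1 + ⋯ + x_k`. -/
def nuConv {d : ℕ} (μ : Measure (Vec d)) (k : ℕ) : Measure (Vec d) :=
  (Measure.pi (fun _ : Fin k => nu μ)).map (fun x => ∑ j, x j)

/-! ### The model -/

section Model

variable {Ω : Type*} [MeasurableSpace Ω] {d : ℕ}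

/-- The tail function `x ↦ P(‖H‖ > x)`. -/
def normTail (P : Measure Ω) (H : Ω → Vec d) (x : ℝ) : ℝ := P.real {ω | x < ‖H ω‖}

/-- `P(‖H‖ > ·)` is regularly varying with index `-α`, where `α > 0`. -/
def IsTailIndex (P : Measure Ω) (H : Ω → Vec d) (α : ℝ) : Prop :=
  0 < α ∧ ∀ t : ℝ, 0 < t →
    Tendsto (fun x => normTail P H (t * x) / normTail P H x) atTop (𝓝 (t ^ (-α)))

/-- The vector `h` truncated at level `M`, with radial excess `l` beyond `M`. -/
def truncate (M : ℝ) (h : Vec d) (l : ℝ) : Vec d :=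
  if ‖h‖ ≤ M then h else (M + l) • ((‖h‖)⁻¹ • h)

/-- The `n`-th row sum `S_n` of the truncated array, with level `M n` in row `n`. -/
def rowSum (M : ℕ → ℝ) (Hs : ℕ → Ω → Vec d) (Ls : ℕ → Ω → ℝ) (n : ℕ) (ω : Ω) : Vec d :=
  ∑ j ∈ Finset.range n, truncate (M n) (Hs j ω) (Ls j ω)

end Model

end TruncatedTails

end

/-!
`X_{nj} / M_n` differs from the radial retraction of `H_j / M_n` to the unit ball by at most
`L_j / M_n`, and only if `‖H_j‖ > M_n`. Hence `k - 1` jumps cannot carry `S_n / M_n` far beyond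
radius `k - 1`: apart from the contributions of the jumps below `ε M_n` and of the excesses `L_j`, a
test function `f` vanishing near the closed ball of that radius has `f (S_n / M_n) ≠ 0` only if at
least `k` of the jumps exceed `ε M_n`. More than `k` of them do so with probability of order
`(n P(‖H‖ > M_n)) ^ (k + 1)`. By a Chernoff bound for truncated vectors, whose means and variances
are controlled by the regular variation of `P(‖H‖ > ·)`, the jumps below `ε M_n` add up to more than
`η M_n` with probability `o((n P(‖H‖ > M_n)) ^ k)`, and the tail of `L` makes the excesses
negligible to the same order. Up to this order `E f (S_n / M_n)` is therefore `n.choose k` times the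
integral of `f (x_1 + ⋯ + x_k)` for the `k`-fold product of the law of the retraction of `H / M_n`.
This law, divided by `P(‖H‖ > M_n)`, converges vaguely to `ν`, the normalised image of `μ` under
the retraction.

Regular variation comes from `n P(‖H‖ > a_n x) → μ {‖y‖ > x}`: passing to the subsequence
`⌊t n⌋` and comparing the two normings (convergence of types) shows that the limit is a power
of `x`.
-/

noncomputable section

namespace TruncatedTails

/-! ### Integrals on the compactified space -/

section Retraction

variable {E : Type*} [NormedAddCommGroup E] [NormedSpace ℝ E]

/-- The radial retraction of a normed space onto its closed unit ball. -/
def ballRetract (x : E) : E := (max 1 ‖x‖)⁻¹ • x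

lemma continuous_ballRetract : Continuous (ballRetract : E → E) := by
  unfold ballRetract
  exact Continuous.smul (Continuous.inv₀ (f := fun x : E => max 1 ‖x‖) (by fun_prop)
    fun x => by positivity) continuous_id

lemma norm_ballRetract (x : E) : ‖ballRetract x‖ = min ‖x‖ 1 := by
  rw [ballRetract, norm_smul, norm_inv, Real.norm_of_nonneg (by positivity)]
  rcases le_total ‖x‖ 1 with h | h
  · simp [h]
  · rw [max_eq_right h, min_eq_right h, inv_mul_cancel₀ (by positivity)]

lemma norm_ballRetract_le_one (x : E) : ‖ballRetract x‖ ≤ 1 :=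
  (norm_ballRetract x).trans_le (min_le_right _ _)

lemma ballRetract_of_norm_le_one {x : E} (hx : ‖x‖ ≤ 1) : ballRetract x = x := by
  rw [ballRetract, max_eq_left hx, inv_one, one_smul]

lemma ballRetract_of_one_le_norm {x : E} (hx : 1 ≤ ‖x‖) : ballRetract x = ‖x‖⁻¹ • x := by
  rw [ballRetract, max_eq_right hx]

end Retraction

section Compactification

variable {d : ℕ}

lemma strictMono_div_sqrt_one_add_sq : StrictMono fun s : ℝ => s / √(1 + s ^ 2) := by
  simp only [← Real.sin_arctan]
  exact fun s t hst => Real.strictMonoOn_sin (Set.Ioo_subset_Icc_self (Real.arctan_mem_Ioo s))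
    (Set.Ioo_subset_Icc_self (Real.arctan_mem_Ioo t)) (Real.arctan_strictMono hst)

lemma div_sqrt_one_add_sq_lt_one (s : ℝ) : s / √(1 + s ^ 2) < 1 := by
  rw [div_lt_one (by positivity)]
  exact Real.lt_sqrt_of_sq_lt (by linarith)

lemma coe_toCompactified (x : Vec d) :
    (toCompactified x : Vec d) = (√(1 + ‖x‖ ^ 2))⁻¹ • x := by
  simp [toCompactified, Homeomorph.unitBall_apply_coe, OpenPartialHomeomorph.univUnitBall_apply]

lemma norm_coe_toCompactified (x : Vec d) :
    ‖(toCompactified x : Vec d)‖ = ‖x‖ / √(1 + ‖x‖ ^ 2) := by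
  rw [coe_toCompactified, norm_smul, norm_inv, Real.norm_of_nonneg (by positivity)]
  ring

lemma exists_toCompactified_eq {y : Compactified d} (hy : ‖(y : Vec d)‖ < 1) :
    ∃ x : Vec d, toCompactified x = y :=
  ⟨Homeomorph.unitBall.symm ⟨y, by simpa using hy⟩, by apply Subtype.ext; simp [toCompactified]⟩

lemma toCompactified_mem_image_closedBall {r : ℝ} {x : Vec d} :
    toCompactified x ∈ toCompactified '' Metric.closedBall (0 : Vec d) r ↔ ‖x‖ ≤ r := by
  rw [isOpenEmbedding_toCompactified.injective.mem_set_image, mem_closedBall_zero_iff]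

lemma isOpen_compl_image_closedBall (r : ℝ) :
    IsOpen {y : Compactified d | y ∉ toCompactified '' Metric.closedBall (0 : Vec d) r} :=
  ((isCompact_closedBall (0 : Vec d) r).image
    isOpenEmbedding_toCompactified.continuous).isClosed.isOpen_compl

lemma integral_extendOutside (r : ℝ) (m : Measure (Vec d)) (g : Compactified d → ℝ)
    (hg : ∀ x : Vec d, ‖x‖ ≤ r → g (toCompactified x) = 0) :
    ∫ y : CompactifiedMinusBall d r, g y ∂(extendOutside r m) =
      ∫ x, g (toCompactified x) ∂m := by
  rw [extendOutside, ← isOpenEmbedding_toCompactified.measurableEmbedding.integral_map]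
  refine (integral_subtype_comap (isOpen_compl_image_closedBall r).measurableSet g).trans ?_
  refine setIntegral_eq_integral_of_forall_compl_eq_zero fun y hy => ?_
  obtain ⟨x, hx, rfl⟩ := not_not.1 hy
  exact hg x (mem_closedBall_zero_iff.1 hx)

lemma exists_pos_forall_notMem_of_isCompact {r : ℝ} (hr : 0 ≤ r)
    {K : Set (CompactifiedMinusBall d r)} (hK : IsCompact K) :
    ∃ δ : ℝ, 0 < δ ∧ ∀ x : Vec d, ‖x‖ ≤ r + δ → toCompactified x ∉ Subtype.val '' K := by
  have hopen : IsOpen (toCompactified ⁻¹' (Subtype.val '' K : Set (Compactified d)))ᶜ :=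
    ((hK.image continuous_subtype_val).isClosed.preimage
      isOpenEmbedding_toCompactified.continuous).isOpen_compl
  have hsub : Metric.closedBall (0 : Vec d) r ⊆
      (toCompactified ⁻¹' (Subtype.val '' K : Set (Compactified d)))ᶜ := by
    rintro x hx ⟨y, -, hy⟩
    exact y.2 ⟨x, hx, hy.symm⟩
  obtain ⟨δ, hδ, h⟩ :=
    (isCompact_closedBall (0 : Vec d) r).exists_cthickening_subset_open hopen hsub
  rw [cthickening_closedBall hδ.le hr] at h
  exact ⟨δ, hδ, fun x hx => h (by simpa [add_comm] using hx)⟩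

lemma exists_continuous_extension {r : ℝ} (f : C_c(CompactifiedMinusBall d r, ℝ)) :
    ∃ G : Compactified d → ℝ, Continuous G ∧ (∀ y : CompactifiedMinusBall d r, G y = f y) ∧
      ∀ y ∉ Subtype.val '' tsupport f, G y = 0 := by
  refine ⟨Function.extend Subtype.val f 0, f.hasCompactSupport.continuous_extend_zero
    (isOpen_compl_image_closedBall r) f.continuous,
    fun y => Subtype.val_injective.extend_apply _ _ _, fun y hy => ?_⟩
  by_cases hy' : ∃ z : CompactifiedMinusBall d r, z.1 = y
  · obtain ⟨z, rfl⟩ := hy'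
    rw [Subtype.val_injective.extend_apply]
    exact image_eq_zero_of_notMem_tsupport fun hz => hy ⟨z, hz, rfl⟩
  · exact Function.extend_apply' _ _ _ hy'

lemma exists_continuous_integral_extendOutside_eq {r : ℝ} (hr : 0 ≤ r)
    (f : C_c(CompactifiedMinusBall d r, ℝ)) :
    ∃ g : Vec d → ℝ, Continuous g ∧ (∃ C, ∀ x, |g x| ≤ C) ∧
      (∃ δ : ℝ, 0 < δ ∧ ∀ x, ‖x‖ ≤ r + δ → g x = 0) ∧
      ∀ m : Measure (Vec d), ∫ y, f y ∂(extendOutside r m) = ∫ x, g x ∂m := by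
  obtain ⟨δ, hδ, hsupp⟩ := exists_pos_forall_notMem_of_isCompact hr f.hasCompactSupport
  obtain ⟨G, hG, hGf, hG0⟩ := exists_continuous_extension f
  obtain ⟨C, hC⟩ := isCompact_univ.exists_bound_of_continuousOn hG.continuousOn
  refine ⟨fun x => G (toCompactified x), hG.comp isOpenEmbedding_toCompactified.continuous,
    ⟨C, fun x => hC _ trivial⟩, ⟨δ, hδ, fun x hx => hG0 _ (hsupp x hx)⟩, fun m => ?_⟩
  rw [← integral_extendOutside r m G fun x hx => hG0 _ (hsupp x (by linarith))]
  simp_rw [hGf]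

lemma isFiniteMeasureOnCompacts_extendOutside {r : ℝ} (hr : 0 ≤ r) {m : Measure (Vec d)}
    (h : ∀ δ : ℝ, 0 < δ → m {x | r + δ < ‖x‖} < ∞) :
    IsFiniteMeasureOnCompacts (extendOutside r m) := by
  refine ⟨fun K hK => ?_⟩
  obtain ⟨δ, hδ, hKδ⟩ := exists_pos_forall_notMem_of_isCompact hr hK
  rw [extendOutside_apply]
  refine lt_of_le_of_lt (measure_mono ?_) (h δ hδ)
  rintro x ⟨hx, hxK⟩
  by_contra hlt
  exact hKδ x (not_lt.1 hlt) ⟨_, hxK, rfl⟩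

lemma isCompact_setOf_le_norm_coe {r s : ℝ} (hrs : r / √(1 + r ^ 2) < s) :
    IsCompact {y : CompactifiedMinusBall d r | s ≤ ‖(y.1 : Vec d)‖} := by
  have himage : (Subtype.val '' {y : CompactifiedMinusBall d r | s ≤ ‖(y.1 : Vec d)‖} :
      Set (Compactified d)) = {y : Compactified d | s ≤ ‖(y : Vec d)‖} := by
    refine Set.Subset.antisymm (Set.image_subset_iff.2 fun _ hy => hy) fun y hy =>
      ⟨⟨y, ?_⟩, hy, rfl⟩
    rintro ⟨x, hx, rfl⟩
    have hle := strictMono_div_sqrt_one_add_sq.monotone (mem_closedBall_zero_iff.1 hx)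
    rw [Set.mem_ofPred_eq, norm_coe_toCompactified] at hy
    exact (hy.trans hle).not_gt hrs
  rw [Topology.IsEmbedding.subtypeVal.isCompact_iff, himage]
  exact (isClosed_le continuous_const (by fun_prop)).isCompact

lemma measure_setOf_le_norm_lt_top {r : ℝ} {m : Measure (Vec d)}
    (h : IsFiniteMeasureOnCompacts (extendOutside r m)) {δ : ℝ} (hδ : r < δ) :
    m {x | δ ≤ ‖x‖} < ∞ := by
  have hfin := (isCompact_setOf_le_norm_coe (d := d)
    (strictMono_div_sqrt_one_add_sq hδ)).measure_lt_top (μ := extendOutside r m)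
  rw [extendOutside_apply] at hfin
  refine lt_of_le_of_lt (measure_mono fun x hx => ?_) hfin
  refine ⟨?_, ?_⟩
  · rw [toCompactified_mem_image_closedBall, not_le]
    exact hδ.trans_le hx
  · rw [Set.mem_ofPred_eq, norm_coe_toCompactified]
    exact strictMono_div_sqrt_one_add_sq.monotone hx

lemma tendsto_integral_of_vagueTendstoOutside {r : ℝ} {m : ℕ → Measure (Vec d)}
    {m' : Measure (Vec d)} (h : VagueTendstoOutside r m m') {G : Compactified d → ℝ}
    (hG : Continuous G) {δ : ℝ} (hδ : r < δ) (hG0 : ∀ x, ‖x‖ ≤ δ → G (toCompactified x) = 0) :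
    Tendsto (fun n => ∫ x, G (toCompactified x) ∂(m n)) atTop
      (𝓝 (∫ x, G (toCompactified x) ∂m')) := by
  have hsupp : HasCompactSupport fun y : CompactifiedMinusBall d r => G y := by
    refine HasCompactSupport.of_support_subset_isCompact
      (isCompact_setOf_le_norm_coe (strictMono_div_sqrt_one_add_sq hδ)) fun y hy => ?_
    by_contra hlt
    rw [Set.mem_ofPred_eq, not_le] at hlt
    obtain ⟨x, hx⟩ := exists_toCompactified_eq (hlt.trans (div_sqrt_one_add_sq_lt_one δ))
    rw [← hx, norm_coe_toCompactified] at hlt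
    refine hy ?_
    simp only
    exact hx ▸ hG0 x (strictMono_div_sqrt_one_add_sq.lt_iff_lt.1 hlt).le
  have hint (m : Measure (Vec d)) :
      ∫ y : CompactifiedMinusBall d r, G y ∂(extendOutside r m) = ∫ x, G (toCompactified x) ∂m :=
    integral_extendOutside r m G fun x hx => hG0 x (hx.trans hδ.le)
  have hlim := h.2 ⟨⟨fun y => G y, by fun_prop⟩, hsupp⟩
  simp only [hint, CompactlySupportedContinuousMap.coe_mk, ContinuousMap.coe_mk] at hlim
  exact hlim

/-- The continuous extension of `x ↦ ballRetract (s • x)` to the compactified space. -/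
def ballRetractExt (s : ℝ) (y : Compactified d) : Vec d :=
  (max (√(1 - ‖(y : Vec d)‖ ^ 2)) (s * ‖(y : Vec d)‖))⁻¹ • (s • (y : Vec d))

lemma continuous_ballRetractExt {s : ℝ} (hs : 0 < s) :
    Continuous (ballRetractExt s : Compactified d → Vec d) := by
  unfold ballRetractExt
  refine Continuous.smul (Continuous.inv₀ (f := fun y : Compactified d =>
    max (√(1 - ‖(y : Vec d)‖ ^ 2)) (s * ‖(y : Vec d)‖)) (by fun_prop) fun y => ne_of_gt ?_)
    (continuous_subtype_val.const_smul s)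
  rcases eq_or_ne (‖(y : Vec d)‖) 0 with h | h
  · simp [h]
  · exact lt_max_of_lt_right (by positivity)

lemma ballRetractExt_toCompactified {s : ℝ} (hs : 0 ≤ s) (x : Vec d) :
    ballRetractExt s (toCompactified x) = ballRetract (s • x) := by
  have hsqrt : √(1 - (‖x‖ / √(1 + ‖x‖ ^ 2)) ^ 2) = (√(1 + ‖x‖ ^ 2))⁻¹ := by
    rw [← Real.sqrt_inv, div_pow, Real.sq_sqrt (by positivity)]
    congr 1
    field_simp
    ring
  have hmax : max (√(1 + ‖x‖ ^ 2))⁻¹ (s * (‖x‖ / √(1 + ‖x‖ ^ 2))) =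
      (√(1 + ‖x‖ ^ 2))⁻¹ * max 1 (s * ‖x‖) := by
    rw [mul_max_of_nonneg _ _ (by positivity)]
    ring_nf
  rw [ballRetractExt, norm_coe_toCompactified, hsqrt, hmax, coe_toCompactified, ballRetract,
    norm_smul, Real.norm_of_nonneg hs, smul_smul, smul_smul, smul_smul]
  congr 1
  field_simp

lemma tendsto_integral_ballRetract {r : ℝ} {m : ℕ → Measure (Vec d)} {μ : Measure (Vec d)}
    (h : VagueTendstoOutside r m μ) {s : ℝ} (hs : 0 < s) {g : Vec d → ℝ} (hg : Continuous g)
    {δ : ℝ} (hδ : s * r < δ) (hg0 : ∀ x, ‖x‖ ≤ δ → g x = 0) :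
    Tendsto (fun n => ∫ x, g (ballRetract (s • x)) ∂(m n)) atTop
      (𝓝 (∫ x, g (ballRetract (s • x)) ∂μ)) := by
  have hlim := tendsto_integral_of_vagueTendstoOutside h (G := fun y => g (ballRetractExt s y))
    (hg.comp (continuous_ballRetractExt hs)) (δ := δ / s) ((lt_div_iff₀' hs).2 hδ) fun x hx => by
      rw [ballRetractExt_toCompactified hs.le]
      refine hg0 _ ((norm_ballRetract _).trans_le ((min_le_left _ _).trans ?_))
      rwa [norm_smul, Real.norm_of_nonneg hs.le, mul_comm, ← le_div_iff₀ hs]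
  simpa only [ballRetractExt_toCompactified hs.le] using hlim

end Compactification

/-! ### Regular variation from the convergence of scaled tails -/

section PowerLaw

variable {G : ℝ → ℝ}

lemma map_eq_mul_map_one_of_monotone (L : ℝ →+ ℝ) (hL : Monotone L) (u : ℝ) : L u = u * L 1 := by
  have hcont : Continuous L :=
    MeasureTheory.Measure.AddMonoidHom.continuous_of_measurable L hL.measurable
  simpa using (L.toRealLinearMap hcont).map_smul u 1

lemma scaling_factor_le (hzero : Tendsto G atTop (𝓝 0)) {x₀ : ℝ} (hx₀ : 0 < x₀) (hG₀ : 0 < G x₀)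
    {c c' : ℝ} (hc : 0 < c) (heq : ∀ x, 0 < x → G (c * x) = G (c' * x)) : c' ≤ c := by
  by_contra! hlt
  have hρ : 1 < c' / c := by rwa [one_lt_div hc]
  have hstep (n : ℕ) : G ((c' / c) ^ n * x₀) = G x₀ := by
    induction n with
    | zero => simp
    | succ n ih =>
      have := heq ((c' / c) ^ n * x₀ / c) (by positivity)
      rw [mul_div_cancel₀ _ hc.ne', ih] at this
      rw [this]
      congr 1
      ring
  have hlim := hzero.comp ((tendsto_pow_atTop_atTop_of_one_lt hρ).atTop_mul_const hx₀)
  simp only [Function.comp_def, hstep, tendsto_const_nhds_iff] at hlim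
  exact hG₀.ne' hlim

lemma exists_exp_scaling (hanti : AntitoneOn G (Set.Ioi 0)) (hzero : Tendsto G atTop (𝓝 0))
    {x₀ : ℝ} (hx₀ : 0 < x₀) (hG₀ : 0 < G x₀)
    (hscale : ∀ t, 0 < t → ∃ c : ℝ, 0 < c ∧ ∀ x, 0 < x → G (c * x) = G x / t) :
    ∃ β : ℝ, 0 < β ∧ ∀ u x, 0 < x → G (Real.exp (u * β) * x) = G x / Real.exp u := by
  choose c hc0 hc using fun u : ℝ => hscale (Real.exp u) (Real.exp_pos u)
  have hadd (u v) : c (u + v) = c u * c v := by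
    have heq (x) (hx : 0 < x) : G (c (u + v) * x) = G (c u * c v * x) := by
      rw [hc _ x hx, mul_assoc, hc u _ (mul_pos (hc0 v) hx), hc v x hx, Real.exp_add, div_div,
        mul_comm (Real.exp u)]
    exact le_antisymm
      (scaling_factor_le hzero hx₀ hG₀ (mul_pos (hc0 u) (hc0 v)) fun x hx => (heq x hx).symm)
      (scaling_factor_le hzero hx₀ hG₀ (hc0 _) heq)
  have hone_lt (u) (hu : 0 < u) : 1 < c u := by
    by_contra! hle
    have hG : G x₀ ≤ G (c u * x₀) := hanti (mul_pos (hc0 u) hx₀) hx₀ (by nlinarith)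
    rw [hc u x₀ hx₀] at hG
    exact hG.not_gt (div_lt_self hG₀ (by simpa using hu))
  let L : ℝ →+ ℝ := AddMonoidHom.mk' (fun u => Real.log (c u)) fun u v => by
    rw [hadd, Real.log_mul (hc0 u).ne' (hc0 v).ne']
  have hmono : Monotone L := fun u v huv => by
    rcases huv.eq_or_lt with rfl | hlt
    · rfl
    · rw [← sub_add_cancel v u, map_add]
      exact le_add_of_nonneg_left (Real.log_nonneg (hone_lt _ (sub_pos.2 hlt)).le)
  refine ⟨L 1, Real.log_pos (hone_lt 1 one_pos), fun u x hx => ?_⟩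
  rw [← map_eq_mul_map_one_of_monotone L hmono u, ← hc u x hx]
  exact congrArg (fun s => G (s * x)) (Real.exp_log (hc0 u))

lemma exists_eq_mul_rpow_of_scaling (hanti : AntitoneOn G (Set.Ioi 0))
    (hzero : Tendsto G atTop (𝓝 0)) (hpos : ∃ x, 0 < x ∧ 0 < G x)
    (hscale : ∀ t, 0 < t → ∃ c : ℝ, 0 < c ∧ ∀ x, 0 < x → G (c * x) = G x / t) :
    ∃ α κ : ℝ, 0 < α ∧ 0 < κ ∧ ∀ x, 0 < x → G x = κ * x ^ (-α) := by
  obtain ⟨x₀, hx₀, hG₀⟩ := hpos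
  obtain ⟨β, hβ, hexp⟩ := exists_exp_scaling hanti hzero hx₀ hG₀ hscale
  have hpow (x) (hx : 0 < x) : G x = G 1 * x ^ (-β⁻¹) := by
    have h := hexp (Real.log x / β) 1 one_pos
    rw [div_mul_cancel₀ _ hβ.ne', Real.exp_log hx, mul_one] at h
    rw [h, Real.rpow_def_of_pos hx, div_eq_mul_inv, ← Real.exp_neg]
    congr 2
    field_simp
  refine ⟨β⁻¹, G 1, by positivity, ?_, hpow⟩
  rw [hpow x₀ hx₀] at hG₀
  exact pos_of_mul_pos_left hG₀ (by positivity)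

end PowerLaw

/-- `w i * F (a i * x) → G x` along `l` at the continuity points of the tail function `G`, which is
right-continuous, vanishes at infinity and does not vanish identically. -/
structure ScaledTailLimit {ι : Type*} (l : Filter ι) (F : ℝ → ℝ) (w a : ι → ℝ) (G : ℝ → ℝ) :
    Prop where
  anti : Antitone F
  weight_nonneg : ∀ i, 0 ≤ w i
  scale : Tendsto a l atTop
  limit_right : ∀ x, 0 < x → ∀ c, c < G x → ∃ y, x < y ∧ c < G y
  limit_zero : Tendsto G atTop (𝓝 0)
  limit_pos : ∃ x, 0 < x ∧ 0 < G x
  upper : ∀ x' x, 0 < x' → x' < x → ∀ c, G x' < c → ∀ᶠ i in l, w i * F (a i * x) < c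
  lower : ∀ x, 0 < x → ∀ c, c < G x → ∀ᶠ i in l, c < w i * F (a i * x)

namespace ScaledTailLimit

section ConvergenceOfTypes

variable {ι ι' : Type*} {l : Filter ι} {l' : Filter ι'} {F G G' : ℝ → ℝ} {w a b : ι → ℝ}

lemma comp (h : ScaledTailLimit l F w a G) {m : ι' → ι} (hm : Tendsto m l' l) :
    ScaledTailLimit l' F (w ∘ m) (a ∘ m) G where
  anti := h.anti
  weight_nonneg i := h.weight_nonneg (m i)
  scale := h.scale.comp hm
  limit_right := h.limit_right
  limit_zero := h.limit_zero
  limit_pos := h.limit_pos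
  upper x' x hx' hx c hc := hm.eventually (h.upper x' x hx' hx c hc)
  lower x hx c hc := hm.eventually (h.lower x hx c hc)

lemma mul_weight (h : ScaledTailLimit l F w a G) {v : ι → ℝ} (hv : ∀ i, 0 ≤ v i) {t : ℝ}
    (ht : 0 < t) (hvt : Tendsto v l (𝓝 t)) :
    ScaledTailLimit l F (fun i => v i * w i) a (fun x => t * G x) where
  anti := h.anti
  weight_nonneg i := mul_nonneg (hv i) (h.weight_nonneg i)
  scale := h.scale
  limit_right x hx c hc := by
    obtain ⟨y, hxy, hy⟩ := h.limit_right x hx (c / t) (by rwa [div_lt_iff₀' ht])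
    exact ⟨y, hxy, by rwa [div_lt_iff₀' ht] at hy⟩
  limit_zero := by simpa using h.limit_zero.const_mul t
  limit_pos := h.limit_pos.imp fun x hx => ⟨hx.1, mul_pos ht hx.2⟩
  upper x' x hx' hx c hc := by
    obtain ⟨e, he, hec⟩ := exists_between ((lt_div_iff₀' ht).2 hc)
    filter_upwards [h.upper x' x hx' hx e he,
      (hvt.mul_const e).eventually_lt_const ((lt_div_iff₀' ht).1 hec)] with i hi hve
    rw [mul_assoc]
    exact (mul_le_mul_of_nonneg_left hi.le (hv i)).trans_lt hve
  lower x hx c hc := by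
    obtain ⟨e, hce, he⟩ := exists_between ((div_lt_iff₀' ht).2 hc)
    filter_upwards [h.lower x hx e he,
      (hvt.mul_const e).eventually_const_lt ((div_lt_iff₀' ht).1 hce)] with i hi hve
    rw [mul_assoc]
    exact hve.trans_le (mul_le_mul_of_nonneg_left hi.le (hv i))

lemma congr_weight (h : ScaledTailLimit l F w a G) {w' : ι → ℝ} (hw' : ∀ i, 0 ≤ w' i)
    (hww' : w' =ᶠ[l] w) : ScaledTailLimit l F w' a G where
  anti := h.anti
  weight_nonneg := hw'
  scale := h.scale
  limit_right := h.limit_right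
  limit_zero := h.limit_zero
  limit_pos := h.limit_pos
  upper x' x hx' hx c hc := by
    filter_upwards [h.upper x' x hx' hx c hc, hww'] with i hi hw
    rwa [hw]
  lower x hx c hc := by
    filter_upwards [h.lower x hx c hc, hww'] with i hi hw
    rwa [hw]

lemma of_weight_div (h : ScaledTailLimit l F w a G) (hw : ∀ᶠ i in l, 0 < w i) {w' : ι → ℝ}
    (hw' : ∀ i, 0 ≤ w' i) {t : ℝ} (ht : 0 < t) (hww' : Tendsto (fun i => w' i / w i) l (𝓝 t)) :
    ScaledTailLimit l F w' a (fun x => t * G x) :=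
  (h.mul_weight (fun i => div_nonneg (hw' i) (h.weight_nonneg i)) ht hww').congr_weight hw' <|
    hw.mono fun _ hi => (div_mul_cancel₀ _ hi.ne').symm

lemma limit_le_of_frequently (h : ScaledTailLimit l F w a G) (h' : ScaledTailLimit l F w b G')
    {x y ρ : ℝ} (hx : 0 < x) (hy : 0 < y) (hyx : y < ρ * x)
    (hρ : ∃ᶠ i in l, ρ ≤ b i / a i) : G' x ≤ G y := by
  by_contra! hlt
  obtain ⟨c, hyc, hcx⟩ := exists_between hlt
  obtain ⟨i, hρi, hy', hx', ha⟩ := (hρ.and_eventually ((h.upper y (ρ * x) hy hyx c hyc).and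
    ((h'.lower x hx c hcx).and (h.scale.eventually_gt_atTop 0)))).exists
  rw [le_div_iff₀ ha] at hρi
  have hF : F (b i * x) ≤ F (a i * (ρ * x)) := h.anti (by nlinarith)
  have := mul_le_mul_of_nonneg_left hF (h.weight_nonneg i)
  linarith

lemma exists_eventually_div_lt (h : ScaledTailLimit l F w a G) (h' : ScaledTailLimit l F w b G') :
    ∃ A : ℝ, 0 < A ∧ ∀ᶠ i in l, b i / a i < A := by
  obtain ⟨x₀, hx₀, hG₀⟩ := h'.limit_pos
  obtain ⟨y, hGy, hy⟩ :=
    ((h.limit_zero.eventually_lt_const hG₀).and (eventually_gt_atTop 0)).exists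
  refine ⟨2 * y / x₀, by positivity, ?_⟩
  by_contra hfreq
  simp only [not_eventually, not_lt] at hfreq
  refine hGy.not_ge (h.limit_le_of_frequently h' hx₀ hy ?_ hfreq)
  rw [div_mul_cancel₀ _ hx₀.ne']
  linarith

lemma limit_le_of_mapClusterPt (h : ScaledTailLimit l F w a G) (h' : ScaledTailLimit l F w b G')
    {c : ℝ} (hc : 0 < c) (hcl : MapClusterPt c l fun i => b i / a i) {x : ℝ} (hx : 0 < x) :
    G' x ≤ G (c * x) := by
  by_contra! hlt
  obtain ⟨x', hxx', hx'⟩ := h'.limit_right x hx _ hlt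
  have hρ : c * x / x' < c := by
    rw [div_lt_iff₀ (hx.trans hxx')]
    exact mul_lt_mul_of_pos_left hxx' hc
  obtain ⟨ρ, hρ, hρc⟩ := exists_between hρ
  exact hx'.not_ge (h.limit_le_of_frequently h' (hx.trans hxx') (mul_pos hc hx)
    ((div_lt_iff₀ (hx.trans hxx')).1 hρ)
    ((hcl.frequently (lt_mem_nhds hρc)).mono fun _ => le_of_lt))

lemma tendsto_weight_mul {α κ : ℝ} (h : ScaledTailLimit l F w a G)
    (hG : ∀ x, 0 < x → G x = κ * x ^ (-α)) {u : ι → ℝ} {x : ℝ} (hx : 0 < x)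
    (hu : Tendsto u l (𝓝 x)) :
    Tendsto (fun i => w i * F (a i * u i)) l (𝓝 (κ * x ^ (-α))) := by
  have hcont : Tendsto (fun y : ℝ => κ * y ^ (-α)) (𝓝 x) (𝓝 (κ * x ^ (-α))) :=
    ((Real.continuousAt_rpow_const x (-α) (Or.inl hx.ne')).const_mul κ).tendsto
  have ha := h.scale.eventually_gt_atTop 0
  refine tendsto_order.2 ⟨fun c hc => ?_, fun c hc => ?_⟩
  · obtain ⟨y, hcy, hxy⟩ := (((hcont.mono_left nhdsWithin_le_nhds).eventually_const_lt hc).and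
      (self_mem_nhdsWithin : Set.Ioi x ∈ 𝓝[>] x)).exists
    have hy : 0 < y := hx.trans hxy
    filter_upwards [h.lower y hy c (by rwa [hG y hy]), hu.eventually_lt_const hxy, ha]
      with i hi hui hai
    exact hi.trans_le (mul_le_mul_of_nonneg_left (h.anti (by gcongr)) (h.weight_nonneg i))
  · have hpos : ∀ᶠ y in 𝓝[<] x, 0 < y := nhdsWithin_le_nhds (lt_mem_nhds hx)
    obtain ⟨y, hyc, hy, hyx⟩ := (((hcont.mono_left nhdsWithin_le_nhds).eventually_lt_const hc).and
      (hpos.and (self_mem_nhdsWithin : Set.Iio x ∈ 𝓝[<] x))).exists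
    obtain ⟨z, hyz, hzx⟩ := exists_between (show y < x from hyx)
    filter_upwards [h.upper y z hy hyz c (by rwa [hG y hy]), hu.eventually_const_lt hzx, ha]
      with i hi hui hai
    exact (mul_le_mul_of_nonneg_left (h.anti (by gcongr)) (h.weight_nonneg i)).trans_lt hi

variable [l.NeBot]

lemma antitoneOn_limit (h : ScaledTailLimit l F w a G) : AntitoneOn G (Set.Ioi 0) := by
  intro x' hx' x hx hle
  rcases hle.eq_or_lt with rfl | hlt
  · rfl
  by_contra! hG
  obtain ⟨c, hc', hc⟩ := exists_between hG
  obtain ⟨i, hi, hi'⟩ := ((h.lower x hx c hc).and (h.upper x' x hx' hlt c hc')).exists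
  exact hi.not_gt hi'

lemma pos (h : ScaledTailLimit l F w a G) (x : ℝ) : 0 < F x := by
  obtain ⟨x₀, hx₀, hG₀⟩ := h.limit_pos
  obtain ⟨i, hi, hxi⟩ := ((h.lower x₀ hx₀ 0 hG₀).and
    ((h.scale.atTop_mul_const hx₀).eventually_ge_atTop x)).exists
  exact (pos_of_mul_pos_right hi (h.weight_nonneg i)).trans_le (h.anti hxi)

/-- Convergence of types. -/
lemma exists_limit_mul_eq (h : ScaledTailLimit l F w a G) (h' : ScaledTailLimit l F w b G') :
    ∃ c : ℝ, 0 < c ∧ ∀ x, 0 < x → G (c * x) = G' x := by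
  obtain ⟨A, -, hbA⟩ := h.exists_eventually_div_lt h'
  obtain ⟨B, hB, haB⟩ := h'.exists_eventually_div_lt h
  have hmem : ∀ᶠ i in l, b i / a i ∈ Set.Icc B⁻¹ A := by
    filter_upwards [hbA, haB, h.scale.eventually_gt_atTop 0, h'.scale.eventually_gt_atTop 0]
      with i hi hi' ha hb
    refine ⟨?_, hi.le⟩
    rw [← inv_div]
    exact inv_anti₀ (by positivity) hi'.le
  obtain ⟨c, hc, hcl⟩ := isCompact_Icc.exists_mapClusterPt_of_frequently hmem.frequently
  have hc0 : 0 < c := (inv_pos.2 hB).trans_le hc.1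
  have hcl' : MapClusterPt c⁻¹ l fun i => a i / b i := by
    simpa only [Function.comp_def, inv_div] using
      hcl.continuousAt_comp (continuousAt_inv₀ hc0.ne')
  refine ⟨c, hc0, fun x hx => le_antisymm ?_ (h.limit_le_of_mapClusterPt h' hc0 hcl hx)⟩
  have hle := h'.limit_le_of_mapClusterPt h (inv_pos.2 hc0) hcl' (mul_pos hc0 hx)
  rwa [inv_mul_cancel_left₀ hc0.ne'] at hle

end ConvergenceOfTypes

section NaturalWeights

variable {F G : ℝ → ℝ} {a : ℕ → ℝ}

lemma floor_mul (h : ScaledTailLimit atTop F (fun n : ℕ => (n : ℝ)) a G) {t : ℝ} (ht : 0 < t) :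
    ScaledTailLimit atTop F (fun n : ℕ => (n : ℝ)) (fun n : ℕ => a ⌊(n : ℝ) * t⌋₊)
      (fun x => t⁻¹ * G x) := by
  have hfloor : Tendsto (fun n : ℕ => ⌊(n : ℝ) * t⌋₊) atTop atTop :=
    tendsto_nat_floor_atTop.comp (tendsto_natCast_atTop_atTop.atTop_mul_const ht)
  refine (h.comp hfloor).of_weight_div ?_ (fun n => n.cast_nonneg) (inv_pos.2 ht) ?_
  · filter_upwards [hfloor.eventually_gt_atTop 0] with n hn
    exact Nat.cast_pos.2 hn
  · refine (((tendsto_nat_floor_mul_div_atTop (R := ℝ) ht.le).comp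
      tendsto_natCast_atTop_atTop).inv₀ ht.ne').congr fun n => ?_
    simp [mul_comm t]

lemma exists_rpow (h : ScaledTailLimit atTop F (fun n : ℕ => (n : ℝ)) a G) :
    ∃ α κ : ℝ, 0 < α ∧ 0 < κ ∧ ∀ x, 0 < x → G x = κ * x ^ (-α) := by
  refine exists_eq_mul_rpow_of_scaling h.antitoneOn_limit h.limit_zero h.limit_pos fun t ht => ?_
  simpa only [inv_mul_eq_div] using h.exists_limit_mul_eq (h.floor_mul ht)

section Inverse

variable {ι : Type*} {l : Filter ι} {M : ι → ℝ} {α κ : ℝ}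

lemma tendsto_inv_tail (h : ScaledTailLimit atTop F (fun n : ℕ => (n : ℝ)) a G)
    (hF : Tendsto F atTop (𝓝 0)) (hM : Tendsto M l atTop) :
    Tendsto (fun i => (F (M i))⁻¹) l atTop :=
  tendsto_inv_nhdsGT_zero.comp
    (tendsto_nhdsWithin_iff.2 ⟨hF.comp hM, Eventually.of_forall fun _ => h.pos _⟩)

lemma tendsto_inv_tail_div_floor (h : ScaledTailLimit atTop F (fun n : ℕ => (n : ℝ)) a G)
    (hF : Tendsto F atTop (𝓝 0)) (hM : Tendsto M l atTop) :
    Tendsto (fun i => (F (M i))⁻¹ / ⌊(F (M i))⁻¹⌋₊) l (𝓝 1) := by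
  simpa [Function.comp_def, div_eq_mul_inv, mul_comm] using
    ((tendsto_nat_floor_div_atTop (R := ℝ)).comp (h.tendsto_inv_tail hF hM)).inv₀ one_ne_zero

/-- The index `⌊1 / F(M)⌋` inverts `n ↦ a n`, up to a constant, at the level `M`. -/
lemma floor_inv_tail (h : ScaledTailLimit atTop F (fun n : ℕ => (n : ℝ)) a G)
    (hF : Tendsto F atTop (𝓝 0)) (hM : Tendsto M l atTop) :
    ScaledTailLimit l F (fun i => (F (M i))⁻¹) (fun i => a ⌊(F (M i))⁻¹⌋₊) G := by
  have hfloor := tendsto_nat_floor_atTop.comp (h.tendsto_inv_tail hF hM)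
  have hlim := (h.comp hfloor).of_weight_div (t := 1)
    ((hfloor.eventually_gt_atTop 0).mono fun _ => Nat.cast_pos.2)
    (fun i => inv_nonneg.2 (h.pos (M i)).le) one_pos (h.tendsto_inv_tail_div_floor hF hM)
  simpa only [one_mul, Function.comp_def] using hlim

lemma tendsto_div_scale (h : ScaledTailLimit atTop F (fun n : ℕ => (n : ℝ)) a G)
    (hF : Tendsto F atTop (𝓝 0)) (hα : 0 < α) (hκ : 0 < κ)
    (hG : ∀ x, 0 < x → G x = κ * x ^ (-α)) (hM : Tendsto M l atTop) :
    Tendsto (fun i => M i / a ⌊(F (M i))⁻¹⌋₊) l (𝓝 (κ ^ α⁻¹)) := by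
  have hfl := h.floor_inv_tail hF hM
  have hone : κ * (κ ^ α⁻¹) ^ (-α) = 1 := by
    rw [← Real.rpow_mul hκ.le, mul_neg, inv_mul_cancel₀ hα.ne', Real.rpow_neg_one,
      mul_inv_cancel₀ hκ.ne']
  have hpos : 0 < κ ^ α⁻¹ := by positivity
  have hstrict {x y : ℝ} (hx : 0 < x) (hxy : x < y) : κ * y ^ (-α) < κ * x ^ (-α) :=
    mul_lt_mul_of_pos_left (Real.rpow_lt_rpow_of_neg hx hxy (by linarith)) hκ
  have hconst {x : ℝ} (hx : 0 < x) := hfl.tendsto_weight_mul hG hx tendsto_const_nhds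
  have hapos := hfl.scale.eventually_gt_atTop 0
  refine tendsto_order.2 ⟨fun b hb => ?_, fun b hb => ?_⟩
  · rcases le_or_gt b 0 with hb0 | hb0
    · filter_upwards [hapos, hM.eventually_gt_atTop 0] with i ha hMi
      exact hb0.trans_lt (by positivity)
    · filter_upwards [hapos, (hconst hb0).eventually_const_lt (hone ▸ hstrict hb0 hb)] with i ha hi
      rw [lt_inv_mul_iff₀ (h.pos _), mul_one] at hi
      rw [lt_div_iff₀' ha]
      exact h.anti.reflect_lt hi
  · filter_upwards [hapos, (hconst (hpos.trans hb)).eventually_lt_const (hone ▸ hstrict hpos hb)]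
      with i ha hi
    rw [inv_mul_lt_iff₀ (h.pos _), mul_one] at hi
    rw [div_lt_iff₀' ha]
    exact h.anti.reflect_lt hi

lemma tendsto_ratio (h : ScaledTailLimit atTop F (fun n : ℕ => (n : ℝ)) a G)
    (hF : Tendsto F atTop (𝓝 0)) (hα : 0 < α) (hκ : 0 < κ)
    (hG : ∀ x, 0 < x → G x = κ * x ^ (-α)) (hM : Tendsto M l atTop) {t : ℝ} (ht : 0 < t) :
    Tendsto (fun i => F (t * M i) / F (M i)) l (𝓝 (t ^ (-α))) := by
  have hfl := h.floor_inv_tail hF hM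
  have hb : 0 < κ ^ α⁻¹ := by positivity
  have hvalue : κ * (t * κ ^ α⁻¹) ^ (-α) = t ^ (-α) := by
    rw [Real.mul_rpow ht.le hb.le, ← Real.rpow_mul hκ.le, mul_neg, inv_mul_cancel₀ hα.ne',
      Real.rpow_neg_one]
    field_simp
  have hlim := hfl.tendsto_weight_mul hG (mul_pos ht hb)
    ((h.tendsto_div_scale hF hα hκ hG hM).const_mul t)
  rw [hvalue] at hlim
  refine hlim.congr' ?_
  filter_upwards [hfl.scale.eventually_gt_atTop 0] with i hi
  rw [inv_mul_eq_div, mul_left_comm, mul_div_cancel₀ _ hi.ne']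

end Inverse

end NaturalWeights

end ScaledTailLimit

section TailFunction

lemma iUnion_setOf_add_one_div_lt {α : Type*} (f : α → ℝ) (x : ℝ) :
    ⋃ n : ℕ, {y | x + 1 / ((n : ℝ) + 1) < f y} = {y | x < f y} := by
  ext y
  simp only [Set.mem_iUnion, Set.mem_ofPred_eq]
  refine ⟨fun ⟨n, hn⟩ => (lt_add_of_pos_right _ Nat.one_div_pos_of_nat).trans hn, fun h => ?_⟩
  obtain ⟨n, hn⟩ := exists_nat_one_div_lt (sub_pos.2 h)
  exact ⟨n, by linarith⟩

variable {α : Type*} [MeasurableSpace α] {m : Measure α} {f : α → ℝ}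

lemma tendsto_measureReal_setOf_lt (hf : Measurable f) {x₀ : ℝ} (h : m {y | x₀ < f y} ≠ ∞) :
    Tendsto (fun x => m.real {y | x < f y}) atTop (𝓝 0) := by
  have hlim : Tendsto (fun x : ℝ => m {y | x < f y}) atTop (𝓝 (m (⋂ x : ℝ, {y | x < f y}))) :=
    tendsto_measure_iInter_atTop
      (fun x => (measurableSet_lt measurable_const hf).nullMeasurableSet)
      (fun _ _ hxy _ hz => hxy.trans_lt hz) ⟨x₀, h⟩
  have hempty : ⋂ x : ℝ, {y | x < f y} = ∅ := by
    rw [Set.iInter_eq_empty_iff]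
    exact fun y => ⟨f y, lt_irrefl (f y)⟩
  rw [hempty, measure_empty] at hlim
  exact (ENNReal.tendsto_toReal ENNReal.zero_ne_top).comp hlim

lemma exists_lt_measureReal_setOf_lt {x : ℝ} (h : m {y | x < f y} ≠ ∞) {c : ℝ}
    (hc : c < m.real {y | x < f y}) : ∃ z, x < z ∧ c < m.real {y | z < f y} := by
  have hmono : Monotone fun n : ℕ => {y | x + 1 / ((n : ℝ) + 1) < f y} := fun n k hnk y hy => by
    have := Nat.one_div_le_one_div (α := ℝ) hnk
    simp only [Set.mem_ofPred_eq] at hy ⊢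
    linarith
  have hlim := tendsto_measure_iUnion_atTop (μ := m) hmono
  rw [iUnion_setOf_add_one_div_lt] at hlim
  obtain ⟨n, hn⟩ := (((ENNReal.tendsto_toReal h).comp hlim).eventually_const_lt hc).exists
  exact ⟨_, lt_add_of_pos_right x Nat.one_div_pos_of_nat, hn⟩

/-- The piecewise linear function that is `0` up to `p` and `1` from `q` on. -/
def ramp (p q u : ℝ) : ℝ := max 0 (min 1 ((u - p) / (q - p)))

variable {p q : ℝ}

lemma continuous_ramp (p q : ℝ) : Continuous (ramp p q) := by
  unfold ramp
  fun_prop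

lemma ramp_nonneg (p q u : ℝ) : 0 ≤ ramp p q u := le_max_left _ _

lemma ramp_le_one (p q u : ℝ) : ramp p q u ≤ 1 := max_le zero_le_one (min_le_left _ _)

lemma ramp_eq_zero (hpq : p < q) {u : ℝ} (hu : u ≤ p) : ramp p q u = 0 :=
  max_eq_left ((min_le_right _ _).trans
    (div_nonpos_of_nonpos_of_nonneg (sub_nonpos.2 hu) (sub_pos.2 hpq).le))

lemma ramp_eq_one (hpq : p < q) {u : ℝ} (hu : q ≤ u) : ramp p q u = 1 := by
  have h : 1 ≤ (u - p) / (q - p) := (one_le_div (sub_pos.2 hpq)).2 (by linarith)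
  rw [ramp, min_eq_left h, max_eq_right zero_le_one]

lemma ramp_min_inv_mul {x' x : ℝ} (hx : 0 < x) (hx' : x' < x) (u : ℝ) :
    ramp (x' / x) 1 (min (x⁻¹ * u) 1) = ramp x' x u := by
  rcases le_total u x with hu | hu
  · rw [min_eq_left ((inv_mul_le_one₀ hx).2 hu), ramp, ramp]
    congr 2
    field_simp
  · rw [min_eq_right ((one_le_inv_mul₀ hx).2 hu), ramp_eq_one ((div_lt_one hx).2 hx') le_rfl,
      ramp_eq_one hx' hu]

lemma ramp_le_indicator {α : Type*} (hpq : p < q) (f : α → ℝ) (y : α) :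
    ramp p q (f y) ≤ Set.indicator {y | p < f y} 1 y := by
  by_cases h : p < f y
  · simpa [h] using ramp_le_one p q (f y)
  · simp [h, ramp_eq_zero hpq (not_lt.1 h)]

lemma indicator_le_ramp {α : Type*} (hpq : p < q) (f : α → ℝ) (y : α) :
    Set.indicator {y | q < f y} 1 y ≤ ramp p q (f y) := by
  by_cases h : q < f y
  · simp [h, ramp_eq_one hpq h.le]
  · simpa [h] using ramp_nonneg p q (f y)

lemma integrable_indicator_setOf_lt (hf : Measurable f) (h : m {y | p < f y} ≠ ∞) :
    Integrable (Set.indicator {y | p < f y} (1 : α → ℝ)) m :=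
  (integrable_indicator_iff (measurableSet_lt measurable_const hf)).2 (integrableOn_const h)

lemma integrable_ramp (hf : Measurable f) (hpq : p < q) (h : m {y | p < f y} ≠ ∞) :
    Integrable (fun y => ramp p q (f y)) m := by
  refine (integrable_indicator_setOf_lt hf h).mono'
    ((continuous_ramp p q).measurable.comp hf).aestronglyMeasurable (.of_forall fun y => ?_)
  rw [Real.norm_of_nonneg (ramp_nonneg _ _ _)]
  exact ramp_le_indicator hpq f y

lemma integral_ramp_le (hf : Measurable f) (hpq : p < q) (h : m {y | p < f y} ≠ ∞) :
    ∫ y, ramp p q (f y) ∂m ≤ m.real {y | p < f y} := by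
  rw [← integral_indicator_one (measurableSet_lt measurable_const hf)]
  exact integral_mono (integrable_ramp hf hpq h) (integrable_indicator_setOf_lt hf h)
    (ramp_le_indicator hpq f)

lemma le_integral_ramp (hf : Measurable f) (hpq : p < q) (h : m {y | p < f y} ≠ ∞) :
    m.real {y | q < f y} ≤ ∫ y, ramp p q (f y) ∂m := by
  rw [← integral_indicator_one (measurableSet_lt measurable_const hf)]
  exact integral_mono (integrable_indicator_setOf_lt hf
    (measure_ne_top_of_subset (fun _ hy => hpq.trans hy) h)) (integrable_ramp hf hpq h)
    (indicator_le_ramp hpq f)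

end TailFunction

section NormTail

variable {Ω : Type*} [MeasurableSpace Ω] {P : Measure Ω} {d : ℕ} {H : Ω → Vec d}

lemma antitone_normTail [IsFiniteMeasure P] : Antitone (normTail P H) := fun _ _ hxy =>
  measureReal_mono fun _ hω => hxy.trans_lt hω

lemma tendsto_normTail [IsFiniteMeasure P] (hH : Measurable H) :
    Tendsto (normTail P H) atTop (𝓝 0) :=
  tendsto_measureReal_setOf_lt hH.norm (x₀ := 0) (measure_ne_top _ _)

lemma measureReal_lt_norm_smul_inv {c x : ℝ} (hc : 0 < c) :
    P.real {ω | x < ‖c⁻¹ • H ω‖} = normTail P H (c * x) := by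
  simp only [norm_smul, norm_inv, Real.norm_of_nonneg hc.le, lt_inv_mul_iff₀ hc, normTail]

end NormTail

section ScaleChange

variable {E : Type*} [NormedAddCommGroup E] [NormedSpace ℝ E]

lemma norm_ballRetract_smul_sub_le {ρ : ℝ} (hρ : 0 ≤ ρ) (x : E) :
    ‖ballRetract (ρ • x) - ballRetract x‖ ≤ |ρ - 1| := by
  have hmin (t : ℝ) : (max 1 t)⁻¹ * t = min t 1 := by
    rcases le_total t 1 with h | h
    · simp [h]
    · rw [max_eq_right h, min_eq_right h, inv_mul_cancel₀ (by positivity)]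
  have hnorm : ‖ballRetract (ρ • x) - ballRetract x‖ = |min (ρ * ‖x‖) 1 - min ‖x‖ 1| := by
    rw [ballRetract, ballRetract, smul_smul, ← sub_smul, norm_smul, Real.norm_eq_abs,
      ← abs_norm x, ← abs_mul, abs_norm, norm_smul, Real.norm_of_nonneg hρ, sub_mul, mul_assoc,
      hmin, hmin]
  rw [hnorm]
  rcases le_total ‖x‖ 1 with hx | hx
  · calc |min (ρ * ‖x‖) 1 - min ‖x‖ 1| ≤ |ρ * ‖x‖ - ‖x‖| := by
          simpa using abs_min_sub_min_le_max (ρ * ‖x‖) 1 ‖x‖ 1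
      _ = |ρ - 1| * ‖x‖ := by rw [← abs_norm x, ← abs_mul, abs_norm, sub_mul, one_mul]
      _ ≤ |ρ - 1| := mul_le_of_le_one_right (abs_nonneg _) hx
  · rw [min_eq_right hx, abs_sub_comm, abs_of_nonneg (sub_nonneg.2 (min_le_right _ _))]
    rcases le_total (ρ * ‖x‖) 1 with h | h
    · rw [min_eq_left h, abs_sub_comm]
      exact (le_abs_self _).trans' (by nlinarith)
    · simp [min_eq_right h]

variable [ProperSpace E] {g : E → ℝ} {δ e : ℝ}

lemma eventually_abs_comp_ballRetract_smul_sub_le (hg : Continuous g) (hδ : 0 < δ)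
    (hg0 : ∀ x, ‖x‖ ≤ δ → g x = 0) (he : 0 < e) :
    ∀ᶠ ρ in 𝓝 (1 : ℝ), ∀ x, |g (ballRetract (ρ • x)) - g (ballRetract x)| ≤
      e * Set.indicator {x | δ / 2 < ‖x‖} 1 x := by
  obtain ⟨η, hη, hunif⟩ := Metric.uniformContinuousOn_iff.1
    ((isCompact_closedBall (0 : E) 1).uniformContinuousOn_of_continuous hg.continuousOn) e he
  filter_upwards [Metric.ball_mem_nhds 1 hη, Icc_mem_nhds zero_lt_one one_lt_two] with ρ hρη hρ x
  by_cases hx : δ / 2 < ‖x‖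
  · rw [Set.indicator_of_mem (s := {x : E | δ / 2 < ‖x‖}) hx, Pi.one_apply, mul_one]
    refine (hunif _ ?_ _ ?_ ((dist_eq_norm _ _).trans_lt
      ((norm_ballRetract_smul_sub_le hρ.1 x).trans_lt hρη))).le <;>
    exact mem_closedBall_zero_iff.2 (norm_ballRetract_le_one _)
  · rw [not_lt] at hx
    have hzero (y : E) (hy : ‖y‖ ≤ δ) : g (ballRetract y) = 0 :=
      hg0 _ ((norm_ballRetract y).trans_le ((min_le_left _ _).trans hy))
    rw [Set.indicator_of_notMem (s := {x : E | δ / 2 < ‖x‖}) hx.not_gt, mul_zero,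
      hzero x (by linarith), hzero (ρ • x) ?_, sub_zero, abs_zero]
    rw [norm_smul, Real.norm_of_nonneg hρ.1]
    nlinarith [hρ.2, norm_nonneg x]

variable [MeasurableSpace E] [BorelSpace E] {Ω : Type*}
  [MeasurableSpace Ω] {P : Measure Ω} [IsFiniteMeasure P]

lemma integrable_comp_ballRetract (hg : Continuous g) {Y : Ω → E} (hY : Measurable Y) :
    Integrable (fun ω => g (ballRetract (Y ω))) P := by
  obtain ⟨C, hC⟩ := (isCompact_closedBall (0 : E) 1).exists_bound_of_continuousOn hg.continuousOn
  exact .of_bound ((hg.comp continuous_ballRetract).measurable.comp hY).aestronglyMeasurable C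
    (.of_forall fun ω => hC _ (mem_closedBall_zero_iff.2 (norm_ballRetract_le_one _)))

lemma eventually_abs_integral_ballRetract_smul_sub_le (hg : Continuous g) (hδ : 0 < δ)
    (hg0 : ∀ x, ‖x‖ ≤ δ → g x = 0) (he : 0 < e) :
    ∀ᶠ ρ in 𝓝 (1 : ℝ), ∀ Y : Ω → E, Measurable Y →
      |∫ ω, g (ballRetract (ρ • Y ω)) ∂P - ∫ ω, g (ballRetract (Y ω)) ∂P| ≤
        e * P.real {ω | δ / 2 < ‖Y ω‖} := by
  filter_upwards [eventually_abs_comp_ballRetract_smul_sub_le hg hδ hg0 he] with ρ hρ Y hY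
  have hset : MeasurableSet {ω | δ / 2 < ‖Y ω‖} := measurableSet_lt measurable_const hY.norm
  rw [← integral_sub (integrable_comp_ballRetract hg (by fun_prop))
    (integrable_comp_ballRetract hg hY), ← integral_indicator_one hset, ← integral_const_mul,
    ← Real.norm_eq_abs]
  exact norm_integral_le_of_norm_le
    ((integrable_indicator_setOf_lt hY.norm (measure_ne_top _ _)).const_mul e)
    (.of_forall fun ω => hρ (Y ω))

end ScaleChange

section Limit

variable {Ω : Type*} [MeasurableSpace Ω] {P : Measure Ω} {d : ℕ} {H : Ω → Vec d}
  {μ : Measure (Vec d)} {a : ℕ → ℝ}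

lemma measure_setOf_lt_norm_ne_top {m : Measure (Vec d)} {r : ℝ}
    (h : IsFiniteMeasureOnCompacts (extendOutside r m)) {x : ℝ} (hx : r < x) :
    m {y | x < ‖y‖} ≠ ∞ :=
  measure_ne_top_of_subset (fun y (hy : x < ‖y‖) => hy.le) (measure_setOf_le_norm_lt_top h hx).ne

lemma exists_measureReal_setOf_lt_norm_pos (hμ0 : μ {0} = 0) (hμ : μ ≠ 0)
    (hfin : ∀ x, 0 < x → μ {y | x < ‖y‖} ≠ ∞) : ∃ x, 0 < x ∧ 0 < μ.real {y | x < ‖y‖} := by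
  by_contra! hzero
  have hnull : μ {y : Vec d | 0 < ‖y‖} = 0 := by
    rw [← iUnion_setOf_add_one_div_lt]
    refine measure_iUnion_null fun n => ?_
    have hn : 0 < 0 + 1 / ((n : ℝ) + 1) := by positivity
    exact (measureReal_eq_zero_iff (hfin _ hn)).1 ((hzero _ hn).antisymm measureReal_nonneg)
  refine hμ (Measure.measure_univ_eq_zero.1 (measure_mono_null (fun y _ => ?_)
    (measure_union_null hμ0 hnull)))
  simpa using eq_or_ne y 0

lemma tendsto_mul_integral_ballRetract (hH : Measurable H)
    (hHμ : VagueTendstoOutside 0 (fun n => (n : ℝ≥0∞) • P.map fun ω => (a n)⁻¹ • H ω) μ)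
    {s : ℝ} (hs : 0 < s) {g : Vec d → ℝ} (hg : Continuous g) {δ : ℝ} (hδ : 0 < δ)
    (hg0 : ∀ x, ‖x‖ ≤ δ → g x = 0) :
    Tendsto (fun n : ℕ => n * ∫ ω, g (ballRetract (s • (a n)⁻¹ • H ω)) ∂P) atTop
      (𝓝 (∫ x, g (ballRetract (s • x)) ∂μ)) := by
  refine (tendsto_integral_ballRetract hHμ hs hg (by rwa [mul_zero]) hg0).congr fun n => ?_
  have hcont : Continuous fun x : Vec d => g (ballRetract (s • x)) :=
    hg.comp (continuous_ballRetract.comp (continuous_const_smul s))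
  rw [integral_smul_measure, integral_map (by fun_prop) hcont.aestronglyMeasurable,
    ENNReal.toReal_natCast, smul_eq_mul]

lemma tendsto_integral_ramp_norm {r p q : ℝ} {m : ℕ → Measure (Vec d)}
    (h : VagueTendstoOutside r m μ) (hr : 0 ≤ r) (hp : r < p) (hpq : p < q) :
    Tendsto (fun n => ∫ x, ramp p q ‖x‖ ∂(m n)) atTop (𝓝 (∫ x, ramp p q ‖x‖ ∂μ)) := by
  have hq : 0 < q := (hr.trans_lt hp).trans hpq
  have hramp (y : Vec d) : ramp (p / q) 1 ‖ballRetract (q⁻¹ • y)‖ = ramp p q ‖y‖ := by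
    rw [norm_ballRetract, norm_smul, norm_inv, Real.norm_of_nonneg hq.le,
      ramp_min_inv_mul hq hpq]
  simpa only [hramp] using tendsto_integral_ballRetract (g := fun y => ramp (p / q) 1 ‖y‖) h
    (inv_pos.2 hq) ((continuous_ramp (p / q) 1).comp continuous_norm) (δ := p / q)
    (by rw [div_eq_inv_mul]; gcongr) fun _ => ramp_eq_zero ((div_lt_one hq).2 hpq)

lemma tendsto_mul_integral_ramp (hH : Measurable H)
    (hHμ : VagueTendstoOutside 0 (fun n => (n : ℝ≥0∞) • P.map fun ω => (a n)⁻¹ • H ω) μ)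
    {p q : ℝ} (hp : 0 < p) (hpq : p < q) :
    Tendsto (fun n : ℕ => n * ∫ ω, ramp p q ‖(a n)⁻¹ • H ω‖ ∂P) atTop
      (𝓝 (∫ y, ramp p q ‖y‖ ∂μ)) := by
  refine (tendsto_integral_ramp_norm hHμ le_rfl hp hpq).congr fun n => ?_
  have hcont : Continuous fun x : Vec d => ramp p q ‖x‖ :=
    (continuous_ramp p q).comp continuous_norm
  rw [integral_smul_measure, integral_map (by fun_prop) hcont.aestronglyMeasurable,
    ENNReal.toReal_natCast, smul_eq_mul]

variable [IsFiniteMeasure P]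

lemma scaledTailLimit (hH : Measurable H) (hμ0 : μ {0} = 0) (hμ : μ ≠ 0)
    (ha : Tendsto a atTop atTop)
    (hHμ : VagueTendstoOutside 0 (fun n => (n : ℝ≥0∞) • P.map fun ω => (a n)⁻¹ • H ω) μ) :
    ScaledTailLimit atTop (normTail P H) (fun n : ℕ => (n : ℝ)) a
      (fun x => μ.real {y | x < ‖y‖}) := by
  have hfin (x : ℝ) (hx : 0 < x) : μ {y | x < ‖y‖} ≠ ∞ := measure_setOf_lt_norm_ne_top hHμ.1 hx
  have hY (n : ℕ) : Measurable fun ω => ‖(a n)⁻¹ • H ω‖ := by fun_prop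
  refine ⟨antitone_normTail, fun n => n.cast_nonneg, ha,
    fun x hx c hc => exists_lt_measureReal_setOf_lt (hfin x hx) hc,
    tendsto_measureReal_setOf_lt measurable_norm (hfin 1 one_pos),
    exists_measureReal_setOf_lt_norm_pos hμ0 hμ hfin, fun x' x hx' hx c hc => ?_,
    fun x hx c hc => ?_⟩
  · filter_upwards [(tendsto_mul_integral_ramp hH hHμ hx' hx).eventually_lt_const
      ((integral_ramp_le measurable_norm hx (hfin x' hx')).trans_lt hc),
      ha.eventually_gt_atTop 0] with n hn han
    rw [← measureReal_lt_norm_smul_inv han]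
    exact (mul_le_mul_of_nonneg_left (le_integral_ramp (hY n) hx (measure_ne_top _ _))
      n.cast_nonneg).trans_lt hn
  · obtain ⟨z, hxz, hz⟩ := exists_lt_measureReal_setOf_lt (hfin x hx) hc
    filter_upwards [(tendsto_mul_integral_ramp hH hHμ hx hxz).eventually_const_lt
      (hz.trans_le (le_integral_ramp measurable_norm hxz (hfin x hx))),
      ha.eventually_gt_atTop 0] with n hn han
    rw [← measureReal_lt_norm_smul_inv han]
    exact hn.trans_le (mul_le_mul_of_nonneg_left
      (integral_ramp_le (hY n) hxz (measure_ne_top _ _)) n.cast_nonneg)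

variable {ι : Type*} {l : Filter ι} {M : ι → ℝ} {α κ : ℝ} {G : ℝ → ℝ} {g : Vec d → ℝ} {δ : ℝ}

lemma isTailIndex_of_scaledTailLimit (hH : Measurable H)
    (hS : ScaledTailLimit atTop (normTail P H) (fun n : ℕ => (n : ℝ)) a G)
    (hα : 0 < α) (hκ : 0 < κ) (hG : ∀ x, 0 < x → G x = κ * x ^ (-α)) : IsTailIndex P H α :=
  ⟨hα, fun _ ht => hS.tendsto_ratio (tendsto_normTail hH) hα hκ hG tendsto_id ht⟩

lemma tendsto_integral_ballRetract_sub_div (hH : Measurable H) (hα : IsTailIndex P H α)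
    (hpos : ∀ x, 0 < normTail P H x) (hM : Tendsto M l atTop) {b : ι → ℝ}
    (hb : Tendsto (fun i => M i / b i) l (𝓝 1)) (hg : Continuous g) (hδ : 0 < δ)
    (hg0 : ∀ x, ‖x‖ ≤ δ → g x = 0) :
    Tendsto (fun i => (∫ ω, g (ballRetract ((b i)⁻¹ • H ω)) ∂P -
      ∫ ω, g (ballRetract ((M i)⁻¹ • H ω)) ∂P) / normTail P H (M i)) l (𝓝 0) := by
  set K := (δ / 2) ^ (-α)
  have hK : 0 < K := by positivity
  refine Metric.tendsto_nhds.2 fun e he => ?_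
  filter_upwards [hM.eventually_gt_atTop 0,
    hb.eventually (eventually_abs_integral_ballRetract_smul_sub_le (P := P) hg hδ hg0
      (div_pos he (mul_pos two_pos hK))),
    ((hα.2 _ (half_pos hδ)).comp hM).eventually_lt_const (lt_two_mul_self hK)] with i hMi hi htail
  have hle := hi (fun ω => (M i)⁻¹ • H ω) (by fun_prop)
  have hscale : M i / b i * (M i)⁻¹ = (b i)⁻¹ := by field_simp
  simp only [smul_smul, hscale, measureReal_lt_norm_smul_inv hMi] at hle
  simp only [Function.comp_apply] at htail
  rw [dist_zero_right, Real.norm_eq_abs, abs_div, abs_of_pos (hpos _)]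
  have hposM := hpos (M i)
  calc _ ≤ e / (2 * K) * normTail P H (M i * (δ / 2)) / normTail P H (M i) := by gcongr
    _ = e / (2 * K) * (normTail P H (δ / 2 * M i) / normTail P H (M i)) := by
      rw [mul_div_assoc, mul_comm (M i)]
    _ < e / (2 * K) * (2 * K) := by gcongr
    _ = e := by field_simp

/-- Up to the factor `κ ^ α⁻¹`, the level `M i` is the scale `a n` with `n = ⌊1 / P(‖H‖ > M i)⌋`,
along which the convergence is the assumed one. -/
lemma tendsto_integral_ballRetract_div_normTail_of_rpow (hH : Measurable H)
    (hHμ : VagueTendstoOutside 0 (fun n => (n : ℝ≥0∞) • P.map fun ω => (a n)⁻¹ • H ω) μ)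
    (hS : ScaledTailLimit atTop (normTail P H) (fun n : ℕ => (n : ℝ)) a G)
    (hα : 0 < α) (hκ : 0 < κ) (hG : ∀ x, 0 < x → G x = κ * x ^ (-α)) (hM : Tendsto M l atTop)
    (hg : Continuous g) (hδ : 0 < δ) (hg0 : ∀ x, ‖x‖ ≤ δ → g x = 0) :
    Tendsto (fun i => (∫ ω, g (ballRetract ((M i)⁻¹ • H ω)) ∂P) / normTail P H (M i)) l
      (𝓝 (∫ x, g (ballRetract ((κ ^ α⁻¹)⁻¹ • x)) ∂μ)) := by
  set c := κ ^ α⁻¹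
  have hc : 0 < c := by positivity
  have hF := tendsto_normTail (P := P) hH
  set n : ι → ℕ := fun i => ⌊(normTail P H (M i))⁻¹⌋₊
  have hn : Tendsto n l atTop := tendsto_nat_floor_atTop.comp (hS.tendsto_inv_tail hF hM)
  have hweight : Tendsto (fun i => (normTail P H (M i))⁻¹ / n i) l (𝓝 1) :=
    hS.tendsto_inv_tail_div_floor hF hM
  have hscale : Tendsto (fun i => M i / (c * a (n i))) l (𝓝 1) := by
    simpa only [n, c, div_div, div_self hc.ne', mul_comm] using
      (hS.tendsto_div_scale hF hα hκ hG hM).div_const (κ ^ α⁻¹)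
  have hlim := hweight.mul ((tendsto_mul_integral_ballRetract hH hHμ (inv_pos.2 hc) hg hδ
    hg0).comp hn)
  have hsub := tendsto_integral_ballRetract_sub_div hH
    (isTailIndex_of_scaledTailLimit hH hS hα hκ hG) hS.pos hM hscale hg hδ hg0
  rw [one_mul] at hlim
  refine ((hlim.sub hsub).congr' ?_).trans_eq (by rw [sub_zero])
  filter_upwards [hn.eventually_gt_atTop 0] with i hi
  have hi' : (n i : ℝ) ≠ 0 := Nat.cast_ne_zero.2 hi.ne'
  simp only [Function.comp_apply, smul_smul, mul_inv]
  field_simp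
  ring

lemma tendsto_integral_ballRetract_div_normTail (hH : Measurable H)
    (hHμ : VagueTendstoOutside 0 (fun n => (n : ℝ≥0∞) • P.map fun ω => (a n)⁻¹ • H ω) μ)
    (hS : ScaledTailLimit atTop (normTail P H) (fun n : ℕ => (n : ℝ)) a G)
    (hα : 0 < α) (hκ : 0 < κ) (hG : ∀ x, 0 < x → G x = κ * x ^ (-α)) (hM : Tendsto M l atTop)
    (hg : Continuous g) (hδ : 0 < δ) (hg0 : ∀ x, ‖x‖ ≤ δ → g x = 0) :
    Tendsto (fun i => (∫ ω, g (ballRetract ((M i)⁻¹ • H ω)) ∂P) / normTail P H (M i)) l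
      (𝓝 (κ⁻¹ * ∫ x, g (ballRetract x) ∂μ)) := by
  have hlim := tendsto_integral_ballRetract_div_normTail_of_rpow hH hHμ hS hα hκ hG hM hg hδ hg0
  have hlim' := tendsto_integral_ballRetract_div_normTail_of_rpow hH hHμ hS hα hκ hG hS.scale hg hδ
    hg0
  -- Along `M = a` the limit is known, which identifies it.
  have hnum := tendsto_mul_integral_ballRetract hH hHμ one_pos hg hδ hg0
  have hden := hS.tendsto_weight_mul hG one_pos tendsto_const_nhds
  rw [Real.one_rpow, mul_one] at hden
  have hquot := (hnum.div hden hκ.ne').congr' <| by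
    filter_upwards [eventually_gt_atTop 0] with n hn
    simp only [Pi.div_apply, one_smul, mul_one]
    exact mul_div_mul_left _ _ (Nat.cast_ne_zero.2 hn.ne')
  simp only [one_smul] at hquot
  rw [← div_eq_inv_mul, ← tendsto_nhds_unique hlim' hquot]
  exact hlim

end Limit

/-! ### Truncated moments of regularly varying tails -/

section Dyadic

variable {V u : ℝ → ℝ} {x₀ : ℝ}

lemma dyadic_induction {p : ℝ → Prop} (hx₀ : 0 < x₀)
    (base : ∀ x, x₀ ≤ x → x ≤ 2 * x₀ → p x) (step : ∀ x, x₀ ≤ x → p x → p (2 * x))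
    (x : ℝ) (hx : x₀ ≤ x) : p x := by
  have hpow (n : ℕ) (x) (hx : x₀ ≤ x) (hxn : x ≤ 2 ^ (n + 1) * x₀) : p x := by
    induction n generalizing x with
    | zero => exact base x hx (by simpa using hxn)
    | succ n ih =>
      rcases le_total x (2 * x₀) with h | h
      · exact base x hx h
      · rw [← mul_div_cancel₀ x two_ne_zero]
        rw [pow_succ] at hxn
        exact step _ (by linarith) (ih _ (by linarith) (by linarith))
  obtain ⟨n, hn⟩ := pow_unbounded_of_one_lt (x / x₀) one_lt_two
  rw [div_lt_iff₀ hx₀] at hn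
  refine hpow n x hx (hn.le.trans ?_)
  gcongr
  exacts [one_le_two, n.le_succ]

lemma le_mul_of_dyadic_growth (hx₀ : 0 < x₀) {ρ D B : ℝ} (hρ : 1 < ρ) (hD : 0 ≤ D)
    (hu : ∀ x, x₀ ≤ x → 0 ≤ u x) (hgrowth : ∀ x, x₀ ≤ x → ρ * u x ≤ u (2 * x))
    (hV : ∀ x, x₀ ≤ x → V (2 * x) ≤ V x + D * u x)
    (hbase : ∀ x, x₀ ≤ x → x ≤ 2 * x₀ → V x ≤ B * u x) (x : ℝ) (hx : x₀ ≤ x) :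
    V x ≤ max B (D / (ρ - 1)) * u x := by
  have hρ' : 0 < ρ - 1 := sub_pos.2 hρ
  set C := max B (D / (ρ - 1))
  have hDC : D ≤ C * (ρ - 1) := (div_le_iff₀ hρ').1 (le_max_right _ _)
  have : 0 ≤ C := (div_nonneg hD hρ'.le).trans (le_max_right _ _)
  refine dyadic_induction (p := fun x => V x ≤ C * u x) hx₀
    (fun x hx hx' => (hbase x hx hx').trans ?_) (fun x hx h => ?_) x hx
  · exact mul_le_mul_of_nonneg_right (le_max_left _ _) (hu x hx)
  · calc V (2 * x) ≤ C * u x + D * u x := (hV x hx).trans (by gcongr)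
      _ ≤ C * u x + C * (ρ - 1) * u x := by have := hu x hx; gcongr
      _ = C * (ρ * u x) := by ring
      _ ≤ C * u (2 * x) := by have := hgrowth x hx; gcongr

lemma le_of_dyadic_decay (hx₀ : 0 < x₀) {ζ D B : ℝ} (hζ : 0 < ζ) (hD : 0 ≤ D)
    (hV : ∀ x, x₀ ≤ x → V (2 * x) ≤ V x + D * x ^ (-ζ))
    (hbase : ∀ x, x₀ ≤ x → x ≤ 2 * x₀ → V x ≤ B) (x : ℝ) (hx : x₀ ≤ x) :
    V x ≤ B + D / (1 - 2 ^ (-ζ)) * x₀ ^ (-ζ) := by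
  have hρ : 0 < 1 - (2 : ℝ) ^ (-ζ) :=
    sub_pos.2 (Real.rpow_lt_one_of_one_lt_of_neg one_lt_two (neg_neg_of_pos hζ))
  set C := D / (1 - (2 : ℝ) ^ (-ζ))
  have hC : 0 ≤ C := div_nonneg hD hρ.le
  have hCD : C * (1 - 2 ^ (-ζ)) = D := div_mul_cancel₀ _ hρ.ne'
  -- `V x + C * x ^ (-ζ)` does not increase when `x` is doubled.
  suffices h : V x + C * x ^ (-ζ) ≤ B + C * x₀ ^ (-ζ) from
    (le_add_of_nonneg_right (mul_nonneg hC (Real.rpow_nonneg (hx₀.le.trans hx) _))).trans h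
  refine dyadic_induction (p := fun x => V x + C * x ^ (-ζ) ≤ B + C * x₀ ^ (-ζ)) hx₀
    (fun x hx hx' => ?_) (fun x hx h => ?_) x hx
  · exact add_le_add (hbase x hx hx')
      (mul_le_mul_of_nonneg_left (Real.rpow_le_rpow_of_nonpos hx₀ hx (by linarith)) hC)
  · refine le_trans ?_ h
    rw [Real.mul_rpow two_pos.le (hx₀.le.trans hx)]
    have := hV x hx
    rw [← hCD] at this
    linarith

lemma le_mul_of_dyadic_decay_of_tendsto (hx₀ : 0 < x₀) {ρ D : ℝ} (hρ : ρ < 1) (hD : 0 ≤ D)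
    (hu : ∀ x, x₀ ≤ x → 0 ≤ u x) (hdecay : ∀ x, x₀ ≤ x → u (2 * x) ≤ ρ * u x)
    (hV : ∀ x, x₀ ≤ x → V x ≤ D * u x + V (2 * x)) (hzero : Tendsto V atTop (𝓝 0)) (x : ℝ)
    (hx : x₀ ≤ x) : V x ≤ D / (1 - ρ) * u x := by
  have hρ' : 0 < 1 - ρ := sub_pos.2 hρ
  set C := D / (1 - ρ)
  have hC : 0 ≤ C := div_nonneg hD hρ'.le
  have hCD : C * (1 - ρ) = D := div_mul_cancel₀ _ hρ'.ne'
  have hiter (n : ℕ) (x) (hx : x₀ ≤ x) : V x ≤ C * u x + V (2 ^ n * x) := by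
    induction n generalizing x with
    | zero => simpa using mul_nonneg hC (hu x hx)
    | succ n ih =>
      have hstep := hV x hx
      rw [← hCD] at hstep
      have hnext := ih (2 * x) (by linarith)
      have hu2 := mul_le_mul_of_nonneg_left (hdecay x hx) hC
      rw [pow_succ, mul_assoc]
      linarith
  have hlim : Tendsto (fun n : ℕ => C * u x + V (2 ^ n * x)) atTop (𝓝 (C * u x + 0)) :=
    (hzero.comp ((tendsto_pow_atTop_atTop_of_one_lt one_lt_two).atTop_mul_const
      (hx₀.trans_le hx))).const_add _
  rw [add_zero] at hlim
  exact ge_of_tendsto' hlim fun n => hiter n x hx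

end Dyadic

section RegularVariation

variable {F : ℝ → ℝ} {α β ρ : ℝ}

lemma exists_pos_forall_of_eventually_atTop {p : ℝ → Prop} (h : ∀ᶠ x in atTop, p x) :
    ∃ x₀ : ℝ, 0 < x₀ ∧ ∀ x, x₀ ≤ x → p x := by
  obtain ⟨x₀, hx₀⟩ := eventually_atTop.1 (h.and (eventually_gt_atTop 0))
  exact ⟨x₀, (hx₀ x₀ le_rfl).2, fun x hx => (hx₀ x hx).1⟩

lemma tendsto_rpow_mul_ratio (hpos : ∀ x, 0 < F x)
    (hF : Tendsto (fun x => F (2 * x) / F x) atTop (𝓝 ((2 : ℝ) ^ (-α)))) (β : ℝ) :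
    Tendsto (fun x => ((2 * x) ^ β * F (2 * x)) / (x ^ β * F x)) atTop
      (𝓝 ((2 : ℝ) ^ (β - α))) := by
  rw [sub_eq_add_neg, Real.rpow_add two_pos]
  refine (hF.const_mul ((2 : ℝ) ^ β)).congr' ?_
  filter_upwards [eventually_gt_atTop 0] with x hx
  rw [Real.mul_rpow two_pos.le hx.le]
  have := hpos x
  have : 0 < x ^ β := by positivity
  field_simp

lemma eventually_mul_le_of_lt (hpos : ∀ x, 0 < F x)
    (hF : Tendsto (fun x => F (2 * x) / F x) atTop (𝓝 ((2 : ℝ) ^ (-α))))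
    (hρ : ρ < (2 : ℝ) ^ (β - α)) :
    ∀ᶠ x in atTop, ρ * (x ^ β * F x) ≤ (2 * x) ^ β * F (2 * x) := by
  filter_upwards [(tendsto_rpow_mul_ratio hpos hF β).eventually_const_lt hρ,
    eventually_gt_atTop 0] with x h hx
  have := hpos x
  exact ((lt_div_iff₀ (by positivity)).1 h).le

lemma eventually_le_mul_of_lt (hpos : ∀ x, 0 < F x)
    (hF : Tendsto (fun x => F (2 * x) / F x) atTop (𝓝 ((2 : ℝ) ^ (-α))))
    (hρ : (2 : ℝ) ^ (β - α) < ρ) :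
    ∀ᶠ x in atTop, (2 * x) ^ β * F (2 * x) ≤ ρ * (x ^ β * F x) := by
  filter_upwards [(tendsto_rpow_mul_ratio hpos hF β).eventually_lt_const hρ,
    eventually_gt_atTop 0] with x h hx
  have := hpos x
  exact ((div_lt_iff₀ (by positivity)).1 h).le

lemma exists_eventually_rpow_mul_le (hanti : Antitone F) (hpos : ∀ x, 0 < F x)
    (hF : Tendsto (fun x => F (2 * x) / F x) atTop (𝓝 ((2 : ℝ) ^ (-α)))) (hβ0 : 0 ≤ β)
    (hβ : β < α) : ∃ C, 0 < C ∧ ∀ᶠ x in atTop, x ^ β * F x ≤ C := by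
  have hlt : (2 : ℝ) ^ (β - α) < 1 := Real.rpow_lt_one_of_one_lt_of_neg one_lt_two (by linarith)
  obtain ⟨x₀, hx₀, h⟩ :=
    exists_pos_forall_of_eventually_atTop (eventually_le_mul_of_lt hpos hF hlt)
  refine ⟨(2 * x₀) ^ β * F x₀, by have := hpos x₀; positivity,
    (eventually_ge_atTop x₀).mono (dyadic_induction hx₀ (fun x hx hx' => ?_) fun x hx hle => ?_)⟩
  · have := hanti hx
    have := (hpos x).le
    have : 0 ≤ x := hx₀.le.trans hx
    gcongr
  · exact (one_mul (x ^ β * F x) ▸ h x hx).trans hle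

lemma exists_eventually_le_rpow_mul (hanti : Antitone F) (hpos : ∀ x, 0 < F x)
    (hF : Tendsto (fun x => F (2 * x) / F x) atTop (𝓝 ((2 : ℝ) ^ (-α)))) (hβ0 : 0 ≤ β)
    (hβ : α < β) : ∃ c, 0 < c ∧ ∀ᶠ x in atTop, c ≤ x ^ β * F x := by
  have hlt : 1 < (2 : ℝ) ^ (β - α) := Real.one_lt_rpow one_lt_two (by linarith)
  obtain ⟨x₀, hx₀, h⟩ :=
    exists_pos_forall_of_eventually_atTop (eventually_mul_le_of_lt hpos hF hlt)
  refine ⟨x₀ ^ β * F (2 * x₀), by have := hpos (2 * x₀); positivity,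
    (eventually_ge_atTop x₀).mono (dyadic_induction hx₀ (fun x hx hx' => ?_) fun x hx hle => ?_)⟩
  · have := hanti hx'
    have := (hpos (2 * x₀)).le
    have : 0 ≤ x := hx₀.le.trans hx
    gcongr
  · exact hle.trans (one_mul (x ^ β * F x) ▸ h x hx)

lemma eventually_rpow_neg_le (hanti : Antitone F) (hpos : ∀ x, 0 < F x)
    (hF : Tendsto (fun x => F (2 * x) / F x) atTop (𝓝 ((2 : ℝ) ^ (-α)))) (hα : 0 < α)
    (hβ : α < β) : ∀ᶠ x in atTop, x ^ (-β) ≤ F x := by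
  obtain ⟨γ, hαγ, hγβ⟩ := exists_between hβ
  obtain ⟨c, hc, h⟩ := exists_eventually_le_rpow_mul hanti hpos hF (hα.trans hαγ).le hαγ
  filter_upwards [h, (tendsto_rpow_atTop (sub_pos.2 hγβ)).eventually_ge_atTop c⁻¹,
    eventually_gt_atTop 0] with x hcF hx hx0
  have hxγ : 0 < x ^ γ := by positivity
  calc x ^ (-β) = (x ^ (β - γ))⁻¹ / x ^ γ := by
        rw [← Real.rpow_neg hx0.le, ← Real.rpow_sub hx0]
        congr 1
        ring
    _ ≤ c / x ^ γ := by
        gcongr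
        exact inv_le_of_inv_le₀ hc hx
    _ ≤ F x := (div_le_iff₀' hxγ).2 hcF

end RegularVariation

section Moments

variable {Ω : Type*} [MeasurableSpace Ω] {P : Measure Ω} {d : ℕ} {H : Ω → Vec d} {α : ℝ} {p : ℕ}

/-- The moment of order `p` of `‖H‖`, truncated at level `x`. -/
def truncMoment (P : Measure Ω) (H : Ω → Vec d) (p : ℕ) (x : ℝ) : ℝ :=
  ∫ ω in {ω | ‖H ω‖ ≤ x}, ‖H ω‖ ^ p ∂P

/-- The first absolute moment of `H` beyond the level `x`. -/
def tailMoment (P : Measure Ω) (H : Ω → Vec d) (x : ℝ) : ℝ := ∫ ω in {ω | x < ‖H ω‖}, ‖H ω‖ ∂P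

lemma measurableSet_norm_le (hH : Measurable H) (x : ℝ) : MeasurableSet {ω | ‖H ω‖ ≤ x} :=
  measurableSet_le hH.norm measurable_const

lemma measurableSet_lt_norm (hH : Measurable H) (x : ℝ) : MeasurableSet {ω | x < ‖H ω‖} :=
  measurableSet_lt measurable_const hH.norm

lemma truncMoment_nonneg (p : ℕ) (x : ℝ) : 0 ≤ truncMoment P H p x :=
  integral_nonneg fun _ => by positivity

lemma tendsto_tailMoment (hH : Measurable H) (hint : Integrable H P) :
    Tendsto (tailMoment P H) atTop (𝓝 0) := by
  have hlim := tendsto_setIntegral_of_antitone (μ := P) (f := fun ω => ‖H ω‖)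
    (fun x => measurableSet_lt_norm hH x) (fun x y hxy ω hω => hxy.trans_lt hω)
    ⟨0, hint.norm.integrableOn⟩
  have hempty : ⋂ x : ℝ, {ω | x < ‖H ω‖} = ∅ :=
    Set.iInter_eq_empty_iff.2 fun ω => ⟨‖H ω‖, lt_irrefl ‖H ω‖⟩
  rwa [hempty, setIntegral_empty] at hlim

section FiniteMeasure

variable [IsFiniteMeasure P]

lemma integrableOn_norm_pow (hH : Measurable H) (p : ℕ) (x : ℝ) :
    IntegrableOn (fun ω => ‖H ω‖ ^ p) {ω | ‖H ω‖ ≤ x} P :=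
  .of_bound (measure_lt_top _ _) (hH.norm.pow_const p).aestronglyMeasurable (x ^ p) <|
    (ae_restrict_mem (measurableSet_norm_le hH x)).mono fun ω (hω : ‖H ω‖ ≤ x) => by
      rw [norm_pow, norm_norm]
      gcongr

lemma truncMoment_mono (hH : Measurable H) (p : ℕ) : Monotone (truncMoment P H p) :=
  fun _ y hxy => setIntegral_mono_set (integrableOn_norm_pow hH p y)
    (.of_forall fun _ => by positivity)
    (LE.le.eventuallyLE fun _ (hω : _ ≤ _) => hω.trans hxy)

lemma setIntegral_norm_pow_le (p : ℕ) {x y : ℝ} :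
    ∫ ω in {ω | x < ‖H ω‖ ∧ ‖H ω‖ ≤ y}, ‖H ω‖ ^ p ∂P ≤ |y| ^ p * normTail P H x := by
  refine (Real.le_norm_self _).trans ((norm_setIntegral_le_of_norm_le_const (μ := P)
    (C := |y| ^ p) (measure_lt_top _ _) fun ω hω => ?_).trans ?_)
  · rw [norm_pow, norm_norm]
    exact pow_le_pow_left₀ (norm_nonneg _) (hω.2.trans (le_abs_self y)) p
  · exact mul_le_mul_of_nonneg_left (measureReal_mono fun ω hω => hω.1) (by positivity)

lemma truncMoment_two_mul_le (hH : Measurable H) (p : ℕ) {x : ℝ} (hx : 0 ≤ x) :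
    truncMoment P H p (2 * x) ≤ truncMoment P H p x + 2 ^ p * (x ^ p * normTail P H x) := by
  have hunion : {ω | ‖H ω‖ ≤ 2 * x} =
      {ω | ‖H ω‖ ≤ x} ∪ {ω | x < ‖H ω‖ ∧ ‖H ω‖ ≤ 2 * x} := by
    ext ω
    simp only [Set.mem_union, Set.mem_ofPred_eq]
    grind
  have hdisj : Disjoint {ω | ‖H ω‖ ≤ x} {ω | x < ‖H ω‖ ∧ ‖H ω‖ ≤ 2 * x} :=
    Set.disjoint_left.2 fun ω hω hω' => hω'.1.not_ge hω
  have hint := integrableOn_norm_pow (P := P) hH p (2 * x)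
  have hle := setIntegral_norm_pow_le (P := P) (H := H) p (x := x) (y := 2 * x)
  rw [hunion] at hint
  rw [abs_of_nonneg (mul_nonneg two_pos.le hx), mul_pow, mul_assoc] at hle
  rw [truncMoment, hunion, setIntegral_union hdisj
    ((measurableSet_lt_norm hH x).inter (measurableSet_norm_le hH _)) hint.left_of_union
    hint.right_of_union]
  exact add_le_add_right hle _

lemma tailMoment_le (hH : Measurable H) (hint : Integrable H P) {x : ℝ} (hx : 0 ≤ x) :
    tailMoment P H x ≤ 2 * (x * normTail P H x) + tailMoment P H (2 * x) := by
  have hunion : {ω | x < ‖H ω‖} = {ω | x < ‖H ω‖ ∧ ‖H ω‖ ≤ 2 * x} ∪ {ω | 2 * x < ‖H ω‖} := by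
    ext ω
    simp only [Set.mem_union, Set.mem_ofPred_eq]
    grind
  have hdisj : Disjoint {ω | x < ‖H ω‖ ∧ ‖H ω‖ ≤ 2 * x} {ω | 2 * x < ‖H ω‖} :=
    Set.disjoint_left.2 fun ω hω hω' => hω.2.not_gt hω'
  have hle := setIntegral_norm_pow_le (P := P) (H := H) 1 (x := x) (y := 2 * x)
  simp only [pow_one, abs_of_nonneg (mul_nonneg two_pos.le hx), mul_assoc] at hle
  rw [tailMoment, hunion, setIntegral_union hdisj (measurableSet_lt_norm hH _)
    hint.norm.integrableOn hint.norm.integrableOn]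
  exact add_le_add_left hle _

lemma exists_tailMoment_le (hH : Measurable H) (hint : Integrable H P)
    (hpos : ∀ x, 0 < normTail P H x) (hα : IsTailIndex P H α) (hα1 : 1 < α) :
    ∃ C, 0 ≤ C ∧ ∀ᶠ x in atTop, tailMoment P H x ≤ C * (x * normTail P H x) := by
  obtain ⟨ρ, hαρ, hρ⟩ := exists_between
    (Real.rpow_lt_one_of_one_lt_of_neg one_lt_two (sub_neg.2 hα1) : (2 : ℝ) ^ (1 - α) < 1)
  obtain ⟨x₀, hx₀, h⟩ := exists_pos_forall_of_eventually_atTop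
    (eventually_le_mul_of_lt hpos (hα.2 2 two_pos) hαρ)
  simp only [Real.rpow_one] at h
  refine ⟨2 / (1 - ρ), div_nonneg two_pos.le (sub_pos.2 hρ).le, (eventually_ge_atTop x₀).mono <|
    le_mul_of_dyadic_decay_of_tendsto hx₀ hρ two_pos.le
      (fun x hx => mul_nonneg (hx₀.le.trans hx) (hpos x).le) h
      (fun x hx => tailMoment_le hH hint (hx₀.le.trans hx)) (tendsto_tailMoment hH hint)⟩

end FiniteMeasure

variable [IsProbabilityMeasure P]

lemma truncMoment_le_pow (hH : Measurable H) (p : ℕ) {x : ℝ} (hx : 0 ≤ x) :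
    truncMoment P H p x ≤ x ^ p := by
  calc truncMoment P H p x ≤ ∫ _ in {ω | ‖H ω‖ ≤ x}, x ^ p ∂P :=
        setIntegral_mono_on (integrableOn_norm_pow hH p x) (integrable_const _)
          (measurableSet_norm_le hH x) fun ω hω => pow_le_pow_left₀ (norm_nonneg _) hω p
    _ = P.real {ω | ‖H ω‖ ≤ x} * x ^ p := by rw [setIntegral_const, smul_eq_mul]
    _ ≤ x ^ p := mul_le_of_le_one_left (by positivity) measureReal_le_one

lemma exists_truncMoment_le (hH : Measurable H) (hpos : ∀ x, 0 < normTail P H x)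
    (hα : IsTailIndex P H α) (hp : α < p) :
    ∃ C, 0 ≤ C ∧ ∀ᶠ x in atTop, truncMoment P H p x ≤ C * (x ^ p * normTail P H x) := by
  obtain ⟨ρ, hρ, hαρ⟩ := exists_between
    (Real.one_lt_rpow one_lt_two (sub_pos.2 hp) : 1 < (2 : ℝ) ^ ((p : ℝ) - α))
  obtain ⟨x₀, hx₀, h⟩ := exists_pos_forall_of_eventually_atTop
    (eventually_mul_le_of_lt hpos (hα.2 2 two_pos) hαρ)
  simp only [Real.rpow_natCast] at h
  refine ⟨max (normTail P H (2 * x₀))⁻¹ (2 ^ p / (ρ - 1)),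
    (inv_pos.2 (hpos _)).le.trans (le_max_left _ _), (eventually_ge_atTop x₀).mono <|
    le_mul_of_dyadic_growth hx₀ hρ (by positivity) (fun x hx => ?_) h
      (fun x hx => truncMoment_two_mul_le hH p (hx₀.le.trans hx)) fun x hx hx' => ?_⟩
  · exact mul_nonneg (pow_nonneg (hx₀.le.trans hx) _) (hpos x).le
  · have hx0 := hx₀.le.trans hx
    have hpos₀ := hpos (2 * x₀)
    refine (truncMoment_le_pow hH p hx0).trans ?_
    rw [inv_mul_eq_div, le_div_iff₀ hpos₀]
    exact mul_le_mul_of_nonneg_left (antitone_normTail hx') (by positivity)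

lemma exists_truncMoment_two_le_rpow (hH : Measurable H) (hpos : ∀ x, 0 < normTail P H x)
    (hα : IsTailIndex P H 2) {ζ : ℝ} (hζ : 0 < ζ) (hζ2 : ζ < 2) :
    ∃ C, 0 ≤ C ∧ ∀ᶠ x in atTop, truncMoment P H 2 x ≤ C * x ^ ζ := by
  obtain ⟨D, hD, hFD⟩ := exists_eventually_rpow_mul_le antitone_normTail hpos (hα.2 2 two_pos)
    (β := 2 - ζ) (by linarith) (by linarith)
  obtain ⟨x₀, hx₀, h⟩ := exists_pos_forall_of_eventually_atTop hFD
  have hsq {x : ℝ} (hx : 0 < x) : x ^ 2 = x ^ (2 - ζ) * x ^ ζ := by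
    rw [← Real.rpow_add hx, sub_add_cancel, Real.rpow_two]
  refine ⟨max ((2 * x₀) ^ (2 - ζ)) (4 * D / (2 ^ ζ - 1)),
    (by positivity : (0 : ℝ) ≤ (2 * x₀) ^ (2 - ζ)).trans (le_max_left _ _),
    (eventually_ge_atTop x₀).mono <| le_mul_of_dyadic_growth hx₀ (Real.one_lt_rpow one_lt_two hζ)
      (by positivity) (fun x hx => Real.rpow_nonneg (hx₀.le.trans hx) _)
      (fun x hx => (Real.mul_rpow two_pos.le (hx₀.le.trans hx)).ge) (fun x hx => ?_)
      fun x hx hx' => ?_⟩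
  · have hx0 := hx₀.trans_le hx
    calc _ ≤ truncMoment P H 2 x + 2 ^ 2 * (x ^ 2 * normTail P H x) :=
          truncMoment_two_mul_le hH 2 hx0.le
      _ = truncMoment P H 2 x + 4 * (x ^ (2 - ζ) * normTail P H x) * x ^ ζ := by
          rw [hsq hx0]
          ring
      _ ≤ truncMoment P H 2 x + 4 * D * x ^ ζ := by
          gcongr
          exact h x hx
  · have hx0 := hx₀.trans_le hx
    refine (truncMoment_le_pow hH 2 hx0.le).trans ?_
    rw [hsq hx0]
    have : 0 ≤ 2 - ζ := by linarith
    gcongr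

lemma exists_truncMoment_two_le (hH : Measurable H) (hpos : ∀ x, 0 < normTail P H x)
    (hα : IsTailIndex P H α) (hα2 : 2 < α) :
    ∃ C, 0 ≤ C ∧ ∀ x, truncMoment P H 2 x ≤ C := by
  obtain ⟨β, hβ, hβα⟩ := exists_between hα2
  obtain ⟨D, hD, hFD⟩ := exists_eventually_rpow_mul_le antitone_normTail hpos (hα.2 2 two_pos)
    (by linarith) hβα
  obtain ⟨x₀, hx₀, h⟩ := exists_pos_forall_of_eventually_atTop hFD
  have hbound := le_of_dyadic_decay (V := truncMoment P H 2) (ζ := β - 2) (D := 4 * D)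
    (B := (2 * x₀) ^ 2) hx₀ (sub_pos.2 hβ) (by positivity) (fun x hx => ?_) fun x hx hx' =>
      (truncMoment_le_pow hH 2 (hx₀.le.trans hx)).trans (pow_le_pow_left₀ (hx₀.le.trans hx) hx' 2)
  · have hle (x : ℝ) := (truncMoment_mono (P := P) hH 2 (le_max_left x x₀)).trans
      (hbound _ (le_max_right x x₀))
    exact ⟨_, (truncMoment_nonneg 2 0).trans (hle 0), hle⟩
  · have hx0 := hx₀.trans_le hx
    have hsq : x ^ 2 = x ^ β * x ^ (-(β - 2)) := by
      rw [← Real.rpow_add hx0, neg_sub, add_sub_cancel, Real.rpow_two]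
    calc _ ≤ truncMoment P H 2 x + 2 ^ 2 * (x ^ 2 * normTail P H x) :=
          truncMoment_two_mul_le hH 2 hx0.le
      _ = truncMoment P H 2 x + 4 * (x ^ β * normTail P H x) * x ^ (-(β - 2)) := by
          rw [hsq]
          ring
      _ ≤ truncMoment P H 2 x + 4 * D * x ^ (-(β - 2)) := by
          gcongr
          exact h x hx

end Moments

/-! ### Exponential bounds for the small jumps -/

section Exponential

lemma exp_le_one_add_add_sq_add_indicator {u B : ℝ} (hu : u ≤ B) :
    Real.exp u ≤ 1 + u + u ^ 2 + Set.indicator (Set.Ioi 1) (fun _ => Real.exp B) u := by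
  rcases lt_or_ge 1 u with h | h
  · rw [Set.indicator_of_mem (Set.mem_Ioi.2 h)]
    have := Real.exp_le_exp.2 hu
    nlinarith [sq_nonneg u]
  · rw [Set.indicator_of_notMem (Set.notMem_Ioi.2 h), add_zero]
    rcases le_total (-1) u with h' | h'
    · linarith [(abs_le.1 (Real.abs_exp_sub_one_sub_id_le (abs_le.2 ⟨h', h⟩))).2]
    · have : Real.exp u ≤ 1 := Real.exp_le_one_iff.2 (by linarith)
      nlinarith

variable {Ω : Type*} [MeasurableSpace Ω] {P : Measure Ω} [IsProbabilityMeasure P]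

lemma integrable_exp_mul_of_abs_le {Z : Ω → ℝ} (hZ : Measurable Z) {B : ℝ}
    (hB : ∀ ω, |Z ω| ≤ B) (t : ℝ) : Integrable (fun ω => Real.exp (t * Z ω)) P := by
  refine .of_bound (by fun_prop) (Real.exp (|t| * B)) (.of_forall fun ω => ?_)
  rw [Real.norm_of_nonneg (Real.exp_pos _).le, Real.exp_le_exp]
  calc t * Z ω ≤ |t| * |Z ω| := (le_abs_self _).trans_eq (abs_mul _ _)
    _ ≤ |t| * B := by gcongr; exact hB ω

lemma mgf_le_exp_of_abs_le {Z : Ω → ℝ} (hZ : Measurable Z) {B t : ℝ} (ht : 0 ≤ t)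
    (hB : ∀ ω, |Z ω| ≤ B) :
    mgf Z P t ≤ Real.exp (t * (∫ ω, Z ω ∂P) + t ^ 2 * (∫ ω, Z ω ^ 2 ∂P) +
      Real.exp (t * B) * P.real {ω | 1 < t * Z ω}) := by
  have hset : MeasurableSet {ω | 1 < t * Z ω} := measurableSet_lt measurable_const (by fun_prop)
  have hZint : Integrable (fun ω => t * Z ω) P :=
    (Integrable.of_bound hZ.aestronglyMeasurable B (.of_forall hB)).const_mul t
  have hZsq : Integrable (fun ω => t ^ 2 * Z ω ^ 2) P := by
    refine (Integrable.of_bound (by fun_prop) (B ^ 2) (.of_forall fun ω => ?_)).const_mul _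
    rw [norm_pow]
    exact pow_le_pow_left₀ (norm_nonneg _) (hB ω) 2
  have hind : Integrable (Set.indicator {ω | 1 < t * Z ω} fun _ => Real.exp (t * B)) P :=
    (integrable_const _).indicator hset
  have hlin : Integrable (fun ω => 1 + t * Z ω) P := (integrable_const _).add hZint
  have hquad : Integrable (fun ω => 1 + t * Z ω + t ^ 2 * Z ω ^ 2) P := hlin.add hZsq
  have hle : mgf Z P t ≤ ∫ ω, (1 + t * Z ω + t ^ 2 * Z ω ^ 2 +
      Set.indicator {ω | 1 < t * Z ω} (fun _ => Real.exp (t * B)) ω) ∂P := by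
    refine integral_mono (integrable_exp_mul_of_abs_le hZ hB t) (hquad.add hind) fun ω => ?_
    rw [← mul_pow]
    exact exp_le_one_add_add_sq_add_indicator
      (mul_le_mul_of_nonneg_left ((le_abs_self _).trans (hB ω)) ht)
  rw [integral_add hquad hind, integral_add hlin hZsq, integral_add (integrable_const _) hZint,
    integral_const_mul, integral_const_mul, integral_indicator_const _ hset] at hle
  simp only [integral_const, probReal_univ, smul_eq_mul, one_mul] at hle
  refine hle.trans (le_trans (le_of_eq ?_) (Real.add_one_le_exp _))
  ring

lemma measureReal_le_sum_le_exp {ι : Type*} {Z : ι → Ω → ℝ} (hZ : ∀ j, Measurable (Z j))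
    (hind : iIndepFun Z P) (s : Finset ι) {B t v : ℝ} (ht : 0 ≤ t) (hB : ∀ j ω, |Z j ω| ≤ B)
    (hv : ∀ j, mgf (Z j) P t ≤ Real.exp v) (x : ℝ) :
    P.real {ω | x ≤ ∑ j ∈ s, Z j ω} ≤ Real.exp (-t * x + s.card * v) := by
  have hsum (ω) : |(∑ j ∈ s, Z j) ω| ≤ s.card * B := by
    rw [Finset.sum_apply, ← nsmul_eq_mul]
    exact (Finset.abs_sum_le_sum_abs _ _).trans (Finset.sum_le_card_nsmul _ _ _ fun j _ => hB j ω)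
  calc P.real {ω | x ≤ ∑ j ∈ s, Z j ω} = P.real {ω | x ≤ (∑ j ∈ s, Z j) ω} := by
        simp only [Finset.sum_apply]
    _ ≤ Real.exp (-t * x) * mgf (∑ j ∈ s, Z j) P t :=
        measure_ge_le_exp_mul_mgf x ht (integrable_exp_mul_of_abs_le (by fun_prop) hsum t)
    _ = Real.exp (-t * x) * ∏ j ∈ s, mgf (Z j) P t := by rw [hind.mgf_sum hZ]
    _ ≤ Real.exp (-t * x) * ∏ _j ∈ s, Real.exp v := by
        gcongr with j
        exacts [fun _ _ => mgf_nonneg, hv j]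
    _ = _ := by rw [Finset.prod_const, ← Real.exp_nat_mul, ← Real.exp_add]

end Exponential

section SmallPart

variable {E : Type*} [NormedAddCommGroup E]

/-- The vector `h` if its norm is at most `B`, and `0` otherwise. -/
def smallPart (B : ℝ) (h : E) : E := Set.indicator {h | ‖h‖ ≤ B} id h

lemma measurable_smallPart [MeasurableSpace E] [OpensMeasurableSpace E] (B : ℝ) :
    Measurable (smallPart B : E → E) :=
  measurable_id.indicator (measurableSet_le measurable_norm measurable_const)

lemma smallPart_of_le {B : ℝ} {h : E} (hh : ‖h‖ ≤ B) : smallPart B h = h :=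
  Set.indicator_of_mem (s := {h | ‖h‖ ≤ B}) hh _

lemma smallPart_of_lt {B : ℝ} {h : E} (hh : B < ‖h‖) : smallPart B h = 0 :=
  Set.indicator_of_notMem (s := {h | ‖h‖ ≤ B}) hh.not_ge _

lemma norm_smallPart_le {B : ℝ} (hB : 0 ≤ B) (h : E) : ‖smallPart B h‖ ≤ B := by
  rcases le_or_gt ‖h‖ B with hh | hh
  · rwa [smallPart_of_le hh]
  · rwa [smallPart_of_lt hh, norm_zero]

lemma norm_smallPart_le_self (B : ℝ) (h : E) : ‖smallPart B h‖ ≤ ‖h‖ :=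
  norm_indicator_le_norm_self (s := {h : E | ‖h‖ ≤ B}) id h

lemma smallPart_neg (B : ℝ) (h : E) : smallPart B (-h) = -smallPart B h := by
  rcases le_or_gt ‖h‖ B with hh | hh
  · rw [smallPart_of_le hh, smallPart_of_le (by rwa [norm_neg])]
  · rw [smallPart_of_lt hh, smallPart_of_lt (by rwa [norm_neg]), neg_zero]

lemma integrable_smallPart [MeasurableSpace E] [OpensMeasurableSpace E]
    [SecondCountableTopology E] {Ω : Type*} [MeasurableSpace Ω] {P : Measure Ω}
    [IsFiniteMeasure P] {H : Ω → E} (hH : Measurable H) {B : ℝ} (hB : 0 ≤ B) :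
    Integrable (fun ω => smallPart B (H ω)) P :=
  .of_bound ((measurable_smallPart B).comp hH).aestronglyMeasurable B
    (.of_forall fun _ => norm_smallPart_le hB _)

end SmallPart

section SmallJumps

variable {Ω : Type*} [MeasurableSpace Ω] {P : Measure Ω} {d : ℕ} {H : Ω → Vec d}
  {Hs : ℕ → Ω → Vec d} {B t : ℝ}

lemma integral_norm_smallPart_pow (hH : Measurable H) {p : ℕ} (hp : p ≠ 0) (B : ℝ) :
    ∫ ω, ‖smallPart B (H ω)‖ ^ p ∂P = truncMoment P H p B := by
  rw [truncMoment, ← integral_indicator (measurableSet_norm_le hH B)]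
  congr 1 with ω
  rcases le_or_gt ‖H ω‖ B with h | h
  · rw [smallPart_of_le h, Set.indicator_of_mem (s := {ω | ‖H ω‖ ≤ B}) h]
  · rw [smallPart_of_lt h, Set.indicator_of_notMem (s := {ω | ‖H ω‖ ≤ B}) h.not_ge, norm_zero,
      zero_pow hp]

lemma exists_div_le_abs_apply {x : ℝ} {v : Vec d} (hd : 0 < d) (hv : x < ‖v‖) :
    ∃ i, x / d ≤ |v i| := by
  by_contra! hcon
  have : Nonempty (Fin d) := ⟨⟨0, hd⟩⟩
  have hsum : ‖v‖ ≤ ∑ i, |v i| := by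
    calc ‖v‖ = ‖∑ i, EuclideanSpace.single i (v i)‖ := by
          congr 1
          ext j
          simp
      _ ≤ ∑ i, ‖EuclideanSpace.single i (v i)‖ := norm_sum_le _ _
      _ = ∑ i, |v i| := by simp
  have hlt : ∑ i, |v i| < ∑ _i : Fin d, x / d :=
    Finset.sum_lt_sum_of_nonempty Finset.univ_nonempty fun i _ => hcon i
  rw [Finset.sum_const, Finset.card_univ, Fintype.card_fin, nsmul_eq_mul,
    mul_div_cancel₀ _ (Nat.cast_ne_zero.2 hd.ne')] at hlt
  linarith

/-- An upper bound for the logarithm of the moment generating function at `t` of the image of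
`smallPart B H` under a linear functional of norm at most one. -/
def logMgfBound (P : Measure Ω) (H : Ω → Vec d) (B t : ℝ) : ℝ :=
  t * ‖∫ ω, smallPart B (H ω) ∂P‖ + t ^ 2 * truncMoment P H 2 B +
    Real.exp (t * B) * P.real {ω | t⁻¹ < ‖smallPart B (H ω)‖}

variable [IsProbabilityMeasure P]

lemma integrable_norm_smallPart_sq (hH : Measurable H) (hB : 0 ≤ B) :
    Integrable (fun ω => ‖smallPart B (H ω)‖ ^ 2) P := by
  have hmeas : Measurable fun ω => smallPart B (H ω) := (measurable_smallPart B).comp hH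
  refine .of_bound (hmeas.norm.pow_const 2).aestronglyMeasurable (B ^ 2) (.of_forall fun ω => ?_)
  rw [norm_pow, norm_norm]
  exact pow_le_pow_left₀ (norm_nonneg _) (norm_smallPart_le hB _) 2

lemma mgf_clm_smallPart_le (hH : Measurable H) (hB : 0 ≤ B) (ht : 0 < t)
    {φ : Vec d →L[ℝ] ℝ} (hφ : ‖φ‖ ≤ 1) :
    mgf (fun ω => φ (smallPart B (H ω))) P t ≤ Real.exp (logMgfBound P H B t) := by
  have hmeas : Measurable fun ω => smallPart B (H ω) := (measurable_smallPart B).comp hH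
  have hle (v : Vec d) : |φ v| ≤ ‖v‖ := φ.le_of_opNorm_le_of_le hφ le_rfl |>.trans_eq (one_mul _)
  refine (mgf_le_exp_of_abs_le (by fun_prop) ht.le (B := B)
    fun ω => (hle _).trans (norm_smallPart_le hB _)).trans (Real.exp_le_exp.2 ?_)
  refine add_le_add (add_le_add ?_ ?_) ?_
  · rw [φ.integral_comp_comm (integrable_smallPart hH hB)]
    exact mul_le_mul_of_nonneg_left ((le_abs_self _).trans (hle _)) ht.le
  · rw [← integral_norm_smallPart_pow hH two_ne_zero]
    refine mul_le_mul_of_nonneg_left (integral_mono_of_nonneg (.of_forall fun ω => sq_nonneg _)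
      (integrable_norm_smallPart_sq hH hB) (.of_forall fun ω => ?_)) (sq_nonneg t)
    exact sq_le_sq.2 ((hle _).trans (le_abs_self _))
  · refine mul_le_mul_of_nonneg_left (measureReal_mono fun ω hω => ?_) (Real.exp_pos _).le
    rw [Set.mem_ofPred_eq, inv_lt_iff_one_lt_mul₀' ht]
    exact lt_of_lt_of_le hω (mul_le_mul_of_nonneg_left ((le_abs_self _).trans (hle _)) ht.le)

lemma measureReal_le_sum_clm_smallPart_le (hH : Measurable H) (hHs : ∀ j, Measurable (Hs j))
    (hHid : ∀ j, IdentDistrib (Hs j) H P P) (hHind : iIndepFun Hs P) (hB : 0 ≤ B) (ht : 0 < t)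
    {φ : Vec d →L[ℝ] ℝ} (hφ : ‖φ‖ ≤ 1) (n : ℕ) (x : ℝ) :
    P.real {ω | x ≤ ∑ j ∈ Finset.range n, φ (smallPart B (Hs j ω))} ≤
      Real.exp (-t * x + n * logMgfBound P H B t) := by
  have hmeas : Measurable fun h : Vec d => φ (smallPart B h) :=
    φ.continuous.measurable.comp (measurable_smallPart B)
  have hbound := measureReal_le_sum_le_exp (P := P) (fun j => hmeas.comp (hHs j))
    (hHind.comp (fun _ h => φ (smallPart B h)) fun _ => hmeas) (Finset.range n) ht.le (B := B)
    (v := logMgfBound P H B t) (fun j ω => ?_) (fun j => ?_) x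
  · rwa [Finset.card_range] at hbound
  · exact (φ.le_of_opNorm_le_of_le hφ (norm_smallPart_le hB _)).trans_eq (one_mul B)
  · rw [mgf_congr_identDistrib ((hHid j).comp hmeas)]
    exact mgf_clm_smallPart_le hH hB ht hφ

lemma measureReal_lt_norm_sum_smallPart_le (hd : 0 < d) (hH : Measurable H)
    (hHs : ∀ j, Measurable (Hs j)) (hHid : ∀ j, IdentDistrib (Hs j) H P P)
    (hHind : iIndepFun Hs P) (hB : 0 ≤ B) (ht : 0 < t) (n : ℕ) (x : ℝ) :
    P.real {ω | x < ‖∑ j ∈ Finset.range n, smallPart B (Hs j ω)‖} ≤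
      2 * d * Real.exp (-t * (x / d) + n * logMgfBound P H B t) := by
  let S (φ : Vec d →L[ℝ] ℝ) : Set Ω :=
    {ω | x / d ≤ ∑ j ∈ Finset.range n, φ (smallPart B (Hs j ω))}
  let π (i : Fin d) : Vec d →L[ℝ] ℝ := EuclideanSpace.proj i
  have hπ (i) : ‖π i‖ ≤ 1 := (π i).opNorm_le_bound zero_le_one fun v => by
    rw [one_mul]
    exact PiLp.norm_apply_le v i
  have hbound {φ : Vec d →L[ℝ] ℝ} (hφ : ‖φ‖ ≤ 1) :=
    measureReal_le_sum_clm_smallPart_le hH hHs hHid hHind hB ht hφ n (x / d)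
  have hsub : {ω | x < ‖∑ j ∈ Finset.range n, smallPart B (Hs j ω)‖} ⊆
      ⋃ i, S (π i) ∪ S (-π i) := by
    intro ω hω
    obtain ⟨i, hi⟩ := exists_div_le_abs_apply hd hω
    have hπsum : (∑ j ∈ Finset.range n, smallPart B (Hs j ω)) i =
        ∑ j ∈ Finset.range n, π i (smallPart B (Hs j ω)) := map_sum (π i) _ _
    rw [hπsum, le_abs, ← Finset.sum_neg_distrib] at hi
    exact Set.mem_iUnion.2 ⟨i, hi⟩
  calc _ ≤ P.real (⋃ i, S (π i) ∪ S (-π i)) := measureReal_mono hsub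
    _ ≤ ∑ i, P.real (S (π i) ∪ S (-π i)) := measureReal_iUnion_fintype_le _
    _ ≤ ∑ _i : Fin d, (Real.exp (-t * (x / d) + n * logMgfBound P H B t) +
          Real.exp (-t * (x / d) + n * logMgfBound P H B t)) :=
        Finset.sum_le_sum fun i _ => (measureReal_union_le _ _).trans
          (add_le_add (hbound (hπ i)) (hbound ((norm_neg _).trans_le (hπ i))))
    _ = _ := by
        rw [Finset.sum_const, Finset.card_univ, Fintype.card_fin, nsmul_eq_mul]
        ring

lemma measureReal_lt_norm_smallPart_le_truncMoment (hH : Measurable H) (hB : 0 ≤ B)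
    (ht : 0 < t) : P.real {ω | t⁻¹ < ‖smallPart B (H ω)‖} ≤ t ^ 2 * truncMoment P H 2 B := by
  have hcheb := mul_meas_ge_le_integral_of_nonneg (.of_forall fun ω => by positivity)
    (integrable_norm_smallPart_sq (P := P) hH hB) (t⁻¹ ^ 2)
  rw [integral_norm_smallPart_pow hH two_ne_zero, inv_pow, inv_mul_le_iff₀ (by positivity),
    ← inv_pow] at hcheb
  refine le_trans (measureReal_mono fun ω hω => ?_) hcheb
  exact pow_le_pow_left₀ (inv_pos.2 ht).le (le_of_lt hω) 2

lemma measureReal_lt_norm_smallPart_le_normTail (x : ℝ) :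
    P.real {ω | x < ‖smallPart B (H ω)‖} ≤ normTail P H x :=
  measureReal_mono fun _ hω => lt_of_lt_of_le hω (norm_smallPart_le_self _ _)

end SmallJumps

section MeanSmallPart

variable {Ω : Type*} [MeasurableSpace Ω] {P : Measure Ω} {d : ℕ} {H : Ω → Vec d} {M : ℕ → ℝ}
  {α B ε : ℝ}

lemma integral_smallPart_eq_zero_of_symm (hH : Measurable H)
    (hsymm : P.map (fun ω => -H ω) = P.map H) (B : ℝ) : ∫ ω, smallPart B (H ω) ∂P = 0 := by
  have hmeas := (measurable_smallPart (E := Vec d) B).stronglyMeasurable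
  have : IsAddTorsionFree (Vec d) := IsAddTorsionFree.of_isTorsionFree ℝ _
  refine self_eq_neg.1 ?_
  calc ∫ ω, smallPart B (H ω) ∂P = ∫ x, smallPart B x ∂(P.map H) :=
        (integral_map hH.aemeasurable hmeas.aestronglyMeasurable).symm
    _ = ∫ ω, smallPart B (-H ω) ∂P := by
        rw [← hsymm, integral_map (by fun_prop) hmeas.aestronglyMeasurable]
    _ = -∫ ω, smallPart B (H ω) ∂P := by simp only [smallPart_neg, integral_neg]

lemma norm_integral_smallPart_le_truncMoment (hH : Measurable H) (B : ℝ) :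
    ‖∫ ω, smallPart B (H ω) ∂P‖ ≤ truncMoment P H 1 B := by
  rw [← integral_norm_smallPart_pow hH one_ne_zero]
  simpa only [pow_one] using norm_integral_le_integral_norm _

variable [IsProbabilityMeasure P]

lemma norm_integral_smallPart_le_tailMoment (hH : Measurable H) (hint : Integrable H P)
    (h0 : ∫ ω, H ω ∂P = 0) (hB : 0 ≤ B) :
    ‖∫ ω, smallPart B (H ω) ∂P‖ ≤ tailMoment P H B := by
  have hlarge : ∫ ω, smallPart B (H ω) ∂P = ∫ ω, (smallPart B (H ω) - H ω) ∂P := by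
    rw [integral_sub (integrable_smallPart hH hB) hint, h0, sub_zero]
  rw [hlarge, tailMoment, ← integral_indicator (measurableSet_lt_norm hH B)]
  refine (norm_integral_le_integral_norm _).trans_eq ?_
  congr 1 with ω
  rcases le_or_gt ‖H ω‖ B with h | h
  · rw [smallPart_of_le h, Set.indicator_of_notMem (s := {ω | B < ‖H ω‖}) h.not_gt, sub_self,
      norm_zero]
  · rw [smallPart_of_lt h, Set.indicator_of_mem (s := {ω | B < ‖H ω‖}) h, zero_sub, norm_neg]

lemma tendsto_mean_smallPart_of_lt_one (hH : Measurable H) (hpos : ∀ x, 0 < normTail P H x)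
    (hα : IsTailIndex P H α) (hα1 : α < 1) (hMpos : ∀ n, 0 < M n) (hM : Tendsto M atTop atTop)
    (hsoft : Tendsto (fun n : ℕ => n * normTail P H (M n)) atTop (𝓝 0)) (hε1 : ε ≤ 1) :
    Tendsto (fun n : ℕ => n * (‖∫ ω, smallPart (ε * M n) (H ω) ∂P‖ / M n)) atTop (𝓝 0) := by
  obtain ⟨C, _, hbound⟩ := exists_truncMoment_le (p := 1) hH hpos hα (by simpa using hα1)
  have hlim := hsoft.const_mul C
  rw [mul_zero] at hlim
  refine squeeze_zero' (.of_forall fun n => by have := hMpos n; positivity) ?_ hlim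
  filter_upwards [hM.eventually hbound] with n hn
  have hMn := hMpos n
  have hmean : ‖∫ ω, smallPart (ε * M n) (H ω) ∂P‖ ≤ C * (M n * normTail P H (M n)) := by
    rw [pow_one] at hn
    exact ((norm_integral_smallPart_le_truncMoment hH _).trans
      (truncMoment_mono hH 1 (mul_le_of_le_one_left hMn.le hε1))).trans hn
  calc (n : ℝ) * (‖∫ ω, smallPart (ε * M n) (H ω) ∂P‖ / M n)
      ≤ n * (C * (M n * normTail P H (M n)) / M n) := by gcongr
    _ = C * (n * normTail P H (M n)) := by field_simp

lemma tendsto_mean_smallPart_of_one_lt (hH : Measurable H) (hpos : ∀ x, 0 < normTail P H x)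
    (hα : IsTailIndex P H α) (hα1 : 1 < α) (hint : Integrable H P) (h0 : ∫ ω, H ω ∂P = 0)
    (hMpos : ∀ n, 0 < M n) (hM : Tendsto M atTop atTop)
    (hsoft : Tendsto (fun n : ℕ => n * normTail P H (M n)) atTop (𝓝 0)) (hε : 0 < ε) :
    Tendsto (fun n : ℕ => n * (‖∫ ω, smallPart (ε * M n) (H ω) ∂P‖ / M n)) atTop (𝓝 0) := by
  obtain ⟨C, _, hbound⟩ := exists_tailMoment_le hH hint hpos hα hα1
  have hlim := (hsoft.mul ((hα.2 ε hε).comp hM)).const_mul (C * ε)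
  rw [zero_mul, mul_zero] at hlim
  refine squeeze_zero' (.of_forall fun n => by have := hMpos n; positivity) ?_ hlim
  filter_upwards [(hM.const_mul_atTop hε).eventually hbound] with n hn
  have hMn := hMpos n
  have hFn := hpos (M n)
  have hmean := (norm_integral_smallPart_le_tailMoment hH hint h0 (mul_pos hε hMn).le).trans hn
  calc (n : ℝ) * (‖∫ ω, smallPart (ε * M n) (H ω) ∂P‖ / M n)
      ≤ n * (C * (ε * M n * normTail P H (ε * M n)) / M n) := by gcongr
    _ = C * ε * (n * normTail P H (M n) * (normTail P H (ε * M n) / normTail P H (M n))) := by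
        field_simp

lemma tendsto_mean_smallPart (hH : Measurable H) (hpos : ∀ x, 0 < normTail P H x)
    (hα : IsTailIndex P H α) (hsymm : α = 1 → P.map (fun ω => -H ω) = P.map H)
    (hcent : 1 < α → Integrable H P ∧ ∫ ω, H ω ∂P = 0) (hMpos : ∀ n, 0 < M n)
    (hM : Tendsto M atTop atTop)
    (hsoft : Tendsto (fun n : ℕ => n * normTail P H (M n)) atTop (𝓝 0)) (hε : 0 < ε)
    (hε1 : ε ≤ 1) :
    Tendsto (fun n : ℕ => n * (‖∫ ω, smallPart (ε * M n) (H ω) ∂P‖ / M n)) atTop (𝓝 0) := by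
  rcases lt_trichotomy α 1 with h | h | h
  · exact tendsto_mean_smallPart_of_lt_one hH hpos hα h hMpos hM hsoft hε1
  · simp [integral_smallPart_eq_zero_of_symm hH (hsymm h)]
  · exact tendsto_mean_smallPart_of_one_lt hH hpos hα h (hcent h).1 (hcent h).2 hMpos hM hsoft hε

end MeanSmallPart

section Variance

variable {Ω : Type*} [MeasurableSpace Ω] {P : Measure Ω} [IsProbabilityMeasure P] {d : ℕ}
  {H : Ω → Vec d} {M : ℕ → ℝ} {α : ℝ}

lemma exists_variance_le_of_lt_two (hH : Measurable H) (hpos : ∀ x, 0 < normTail P H x)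
    (hα : IsTailIndex P H α) (hα2 : α < 2) (hMpos : ∀ n, 0 < M n) (hM : Tendsto M atTop atTop) :
    ∃ C : ℝ, 0 ≤ C ∧ ∀ᶠ n : ℕ in atTop,
      n * (truncMoment P H 2 (M n) / M n ^ 2) ≤ C * (n * normTail P H (M n)) := by
  obtain ⟨C, hC, hbound⟩ := exists_truncMoment_le (p := 2) hH hpos hα (by simpa using hα2)
  refine ⟨C, hC, ?_⟩
  filter_upwards [hM.eventually hbound] with n hn
  have hMn := hMpos n
  calc (n : ℝ) * (truncMoment P H 2 (M n) / M n ^ 2)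
      ≤ n * (C * (M n ^ 2 * normTail P H (M n)) / M n ^ 2) := by gcongr
    _ = C * (n * normTail P H (M n)) := by field_simp

lemma le_rpow_of_one_le_div_sqrt {x m γ : ℝ} (hx : 0 < x) (hm : 0 < m) (hγ : 0 < 1 + γ)
    (h : 1 ≤ m / √(x ^ (1 + γ))) : x ≤ m ^ (2 / (1 + γ)) := by
  rw [one_le_div (by positivity), Real.sqrt_le_left hm.le, ← Real.rpow_two] at h
  rw [div_eq_mul_inv, Real.rpow_mul hm.le, Real.le_rpow_inv_iff_of_pos hx.le (by positivity) hγ]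
  exact h

lemma exists_variance_le_of_eq_two (hH : Measurable H) (hpos : ∀ x, 0 < normTail P H x)
    (hα : IsTailIndex P H 2) (hMpos : ∀ n, 0 < M n) (hM : Tendsto M atTop atTop) {γ : ℝ}
    (hγ : 0 < γ) (hMγ : Tendsto (fun n : ℕ => M n / √((n : ℝ) ^ (1 + γ))) atTop atTop) :
    ∃ δ C : ℝ, 0 < δ ∧ 0 ≤ C ∧ ∀ᶠ n : ℕ in atTop,
      n * (truncMoment P H 2 (M n) / M n ^ 2) ≤ C * (n * normTail P H (M n)) ^ δ := by
  set ζ := γ / (1 + γ) with hζ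
  have hζ0 : 0 < ζ := by positivity
  have hζ1 : ζ < 1 := (div_lt_one (by positivity)).2 (by linarith)
  have hγζ : 2 / (1 + γ) = 2 - 2 * ζ := by
    rw [hζ]
    field_simp
    ring
  obtain ⟨C, hC, hbound⟩ := exists_truncMoment_two_le_rpow hH hpos hα hζ0 (by linarith)
  have hlow := eventually_rpow_neg_le antitone_normTail hpos (hα.2 2 two_pos) hα.1
    (β := 3) (by norm_num)
  refine ⟨ζ / 3, C, by positivity, hC, ?_⟩
  filter_upwards [hM.eventually hbound, hM.eventually hlow, hMγ.eventually_ge_atTop 1,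
    eventually_ge_atTop 1] with n hVn hFn hMn hn
  have hM0 := hMpos n
  have hn1 : (1 : ℝ) ≤ n := Nat.one_le_cast.2 hn
  have hnM : (n : ℝ) ≤ M n ^ (2 - 2 * ζ) :=
    hγζ ▸ le_rpow_of_one_le_div_sqrt (by linarith) hM0 (by positivity) hMn
  have hpn : M n ^ (-ζ) ≤ (n * normTail P H (M n)) ^ (ζ / 3) := by
    calc M n ^ (-ζ) = (M n ^ (-(3 : ℝ))) ^ (ζ / 3) := by
          rw [← Real.rpow_mul hM0.le]
          ring_nf
      _ ≤ (n * normTail P H (M n)) ^ (ζ / 3) := by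
          gcongr
          exact hFn.trans (le_mul_of_one_le_left (hpos _).le hn1)
  calc (n : ℝ) * (truncMoment P H 2 (M n) / M n ^ 2)
      ≤ M n ^ (2 - 2 * ζ) * (C * M n ^ ζ / M n ^ (2 : ℝ)) := by
        have := truncMoment_nonneg (P := P) (H := H) 2 (M n)
        rw [Real.rpow_two]
        gcongr
    _ = C * M n ^ (2 - 2 * ζ + ζ - 2) := by
        rw [Real.rpow_sub hM0 (2 - 2 * ζ + ζ), Real.rpow_add hM0]
        ring
    _ = C * M n ^ (-ζ) := by ring_nf
    _ ≤ C * (n * normTail P H (M n)) ^ (ζ / 3) := by gcongr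

lemma exists_variance_le_rpow (hH : Measurable H) (hpos : ∀ x, 0 < normTail P H x)
    (hα : IsTailIndex P H α) (hα2 : α ≤ 2) (hMpos : ∀ n, 0 < M n) (hM : Tendsto M atTop atTop)
    (hM2 : α = 2 → ∃ γ : ℝ, 0 < γ ∧
      Tendsto (fun n : ℕ => M n / √((n : ℝ) ^ (1 + γ))) atTop atTop) :
    ∃ δ C : ℝ, 0 < δ ∧ 0 ≤ C ∧ ∀ᶠ n : ℕ in atTop,
      n * (truncMoment P H 2 (M n) / M n ^ 2) ≤ C * (n * normTail P H (M n)) ^ δ := by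
  rcases hα2.lt_or_eq with h | rfl
  · obtain ⟨C, hC, hbound⟩ := exists_variance_le_of_lt_two hH hpos hα h hMpos hM
    exact ⟨1, C, one_pos, hC, by simpa only [Real.rpow_one] using hbound⟩
  · obtain ⟨γ, hγ, hMγ⟩ := hM2 rfl
    exact exists_variance_le_of_eq_two hH hpos hα hMpos hM hγ hMγ

end Variance

section SmallSum

variable {Ω : Type*} [MeasurableSpace Ω] {P : Measure Ω} {d : ℕ} {H : Ω → Vec d}
  {Hs : ℕ → Ω → Vec d} {M : ℕ → ℝ} {α : ℝ}

/-- The sum of the jumps of size at most `ε M_n` contributes negligibly at the scale `M_n` once `ε`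
is small: the probability that it exceeds `η M_n` is of smaller order than `r n`. -/
def SmallJumpsNegligible (P : Measure Ω) (Hs : ℕ → Ω → Vec d) (M r : ℕ → ℝ) : Prop :=
  ∀ η : ℝ, 0 < η → ∃ ε₀ : ℝ, 0 < ε₀ ∧ ∀ ε, 0 < ε → ε ≤ ε₀ → (fun n : ℕ =>
    P.real {ω | η * M n < ‖∑ j ∈ Finset.range n, smallPart (ε * M n) (Hs j ω)‖}) =o[atTop] r

lemma tendsto_log_pow_mul_rpow_nhdsGT_zero {κ : ℝ} (hκ : 0 < κ) {k : ℕ} (hk : k ≠ 0) :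
    Tendsto (fun x : ℝ => Real.log x ^ k * x ^ κ) (𝓝[>] 0) (𝓝 0) := by
  have hlim := (tendsto_log_mul_rpow_nhdsGT_zero (div_pos hκ (Nat.cast_pos.2 hk.bot_lt))).pow k
  rw [zero_pow hk] at hlim
  refine hlim.congr' ?_
  filter_upwards [self_mem_nhdsWithin] with x hx
  rw [mul_pow, ← Real.rpow_mul_natCast (le_of_lt hx), div_mul_cancel₀ _ (Nat.cast_ne_zero.2 hk)]

lemma eventually_exp_log_mul_le_one {ι : Type*} {l : Filter ι} {p v : ι → ℝ} {A C δ ε : ℝ}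
    (hp : Tendsto p l (𝓝[>] 0)) (hv : ∀ᶠ i in l, v i ≤ C * p i ^ δ) (hδ : A * ε < δ) :
    ∀ᶠ i in l, 2 * (Real.exp (A * -Real.log (p i) * ε) * ((A * -Real.log (p i)) ^ 2 * v i)) ≤
      1 := by
  have hlim := ((tendsto_log_pow_mul_rpow_nhdsGT_zero (sub_pos.2 hδ) two_ne_zero).comp
    hp).const_mul (2 * (A ^ 2 * C))
  rw [mul_zero] at hlim
  filter_upwards [hv, hlim.eventually_le_const one_pos, hp.eventually self_mem_nhdsWithin]
    with i hvi hlimi hpi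
  have hexp : Real.exp (A * -Real.log (p i) * ε) = p i ^ (-(A * ε)) := by
    rw [Real.rpow_def_of_pos hpi]
    ring_nf
  calc 2 * (Real.exp (A * -Real.log (p i) * ε) * ((A * -Real.log (p i)) ^ 2 * v i))
      ≤ 2 * (p i ^ (-(A * ε)) * ((A * -Real.log (p i)) ^ 2 * (C * p i ^ δ))) := by
        have : 0 < p i := hpi
        rw [hexp]
        gcongr
    _ = 2 * (A ^ 2 * C) * (Real.log (p i) ^ 2 * p i ^ (δ - A * ε)) := by
        rw [sub_eq_add_neg, Real.rpow_add hpi]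
        ring
    _ ≤ 1 := hlimi

lemma isLittleO_of_eventually_le_mul {ι : Type*} {l : Filter ι} {f g h : ι → ℝ} {K : ℝ}
    (hK : 0 ≤ K) (hf : ∀ i, 0 ≤ f i) (hg : Tendsto g l (𝓝 0))
    (hle : ∀ᶠ i in l, f i ≤ K * (g i * h i)) : f =o[l] h := by
  have hgh : (fun i => g i * h i) =o[l] h := by
    simpa only [one_mul] using ((isLittleO_one_iff ℝ).2 hg).mul_isBigO (isBigO_refl h l)
  refine (IsBigO.of_bound K ?_).trans_isLittleO hgh
  filter_upwards [hle] with i hi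
  rw [Real.norm_of_nonneg (hf i)]
  exact hi.trans (mul_le_mul_of_nonneg_left (le_abs_self _) hK)

lemma tendsto_nhdsGT_mul_normTail (hpos : ∀ x, 0 < normTail P H x)
    (hsoft : Tendsto (fun n : ℕ => n * normTail P H (M n)) atTop (𝓝 0)) :
    Tendsto (fun n : ℕ => n * normTail P H (M n)) atTop (𝓝[>] 0) :=
  tendsto_nhdsWithin_iff.2 ⟨hsoft, (eventually_gt_atTop 0).mono fun _ hn =>
    mul_pos (Nat.cast_pos.2 hn) (hpos _)⟩

lemma tendsto_div_mul_log_atTop {A : ℝ} (hA : 0 < A) :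
    Tendsto (fun x : ℝ => x / (A * Real.log x)) atTop atTop := by
  have hlog : Tendsto (fun x : ℝ => Real.log x / x) atTop (𝓝[>] 0) := by
    refine tendsto_nhdsWithin_iff.2
      ⟨Real.isLittleO_log_id_atTop.tendsto_div_nhds_zero, ?_⟩
    filter_upwards [eventually_gt_atTop 1] with x hx
    exact div_pos (Real.log_pos hx) (by linarith)
  refine ((tendsto_inv_nhdsGT_zero.comp hlog).const_mul_atTop (inv_pos.2 hA)).congr fun x => ?_
  rw [Function.comp_apply, inv_div, inv_mul_eq_div, div_div, mul_comm]

lemma eventually_rpow_mul_div_log_le_one {F : ℝ → ℝ} {A D s β : ℝ} (hA : 0 < A) (hs : s < β)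
    (hF : ∀ᶠ x in atTop, x ^ β * F x ≤ D) :
    ∀ᶠ x in atTop, x ^ s * F (x / (A * Real.log x)) ≤ 1 := by
  have hlim := (isLittleO_log_rpow_rpow_atTop β (sub_pos.2 hs)).tendsto_div_nhds_zero.const_mul
    (D * A ^ β)
  rw [mul_zero] at hlim
  filter_upwards [(tendsto_div_mul_log_atTop hA).eventually hF, hlim.eventually_le_const one_pos,
    eventually_gt_atTop 1] with x hFx hlimx hx
  have hx0 : 0 < x := by linarith
  have hlog : 0 < Real.log x := Real.log_pos hx
  rw [mul_comm, ← le_div_iff₀ (by positivity)] at hFx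
  calc x ^ s * F (x / (A * Real.log x)) ≤ x ^ s * (D / (x / (A * Real.log x)) ^ β) := by gcongr
    _ = D * A ^ β * (Real.log x ^ β / x ^ (β - s)) := by
        rw [Real.div_rpow hx0.le (by positivity), Real.mul_rpow hA.le hlog.le,
          Real.rpow_sub hx0]
        field_simp
    _ ≤ 1 := hlimx

lemma tendsto_mul_log_div_sq (hM : Tendsto M atTop atTop)
    (hMlog : Tendsto (fun n : ℕ => M n / √(n * Real.log (M n))) atTop atTop) :
    Tendsto (fun n : ℕ => n * Real.log (M n) / M n ^ 2) atTop (𝓝 0) := by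
  have hlim := hMlog.inv_tendsto_atTop.pow 2
  rw [zero_pow two_ne_zero] at hlim
  refine hlim.congr' ?_
  filter_upwards [hM.eventually (Real.tendsto_log_atTop.eventually_ge_atTop 0)] with n hn
  rw [Pi.inv_apply, inv_div, div_pow, Real.sq_sqrt (mul_nonneg n.cast_nonneg hn)]

lemma eventually_le_sq (hM : Tendsto M atTop atTop)
    (hMlog : Tendsto (fun n : ℕ => M n / √(n * Real.log (M n))) atTop atTop) :
    ∀ᶠ n : ℕ in atTop, (n : ℝ) ≤ M n ^ 2 := by
  filter_upwards [(tendsto_mul_log_div_sq hM hMlog).eventually_lt_const one_pos,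
    hM.eventually (Real.tendsto_log_atTop.eventually_ge_atTop 1), hM.eventually_gt_atTop 0]
    with n hn hlog hMn
  rw [div_lt_one (by positivity)] at hn
  exact (le_mul_of_one_le_right n.cast_nonneg hlog).trans hn.le

lemma eventually_mul_exp_mul_le_one (hM : Tendsto M atTop atTop)
    (hMlog : Tendsto (fun n : ℕ => M n / √(n * Real.log (M n))) atTop atTop)
    {F : ℝ → ℝ} (hF0 : ∀ x, 0 ≤ F x) {A D β ε : ℝ} (hA : 0 < A) (hβ : 2 + A * ε < β)
    (hF : ∀ᶠ x in atTop, x ^ β * F x ≤ D) :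
    ∀ᶠ n : ℕ in atTop,
      n * (Real.exp (A * Real.log (M n) * ε) * F (M n / (A * Real.log (M n)))) ≤ 1 := by
  filter_upwards [eventually_le_sq hM hMlog, hM.eventually_gt_atTop 0,
    hM.eventually (eventually_rpow_mul_div_log_le_one hA hβ hF)] with n hn hMn hFn
  have hexp : Real.exp (A * Real.log (M n) * ε) = M n ^ (A * ε) := by
    rw [Real.rpow_def_of_pos hMn]
    ring_nf
  calc n * (Real.exp (A * Real.log (M n) * ε) * F (M n / (A * Real.log (M n))))
      ≤ M n ^ 2 * (M n ^ (A * ε) * F (M n / (A * Real.log (M n)))) := by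
        have := hF0 (M n / (A * Real.log (M n)))
        rw [hexp]
        gcongr
    _ = M n ^ (2 + A * ε) * F (M n / (A * Real.log (M n))) := by
        rw [Real.rpow_add hMn, Real.rpow_two, mul_assoc]
    _ ≤ 1 := hFn

lemma tendsto_log_mul_variance (hM : Tendsto M atTop atTop)
    (hMlog : Tendsto (fun n : ℕ => M n / √(n * Real.log (M n))) atTop atTop) {C : ℝ}
    (hV : ∀ x, truncMoment P H 2 x ≤ C) (A : ℝ) (hA : 0 ≤ A) :
    Tendsto (fun n : ℕ => A * Real.log (M n) * (n * (truncMoment P H 2 (M n) / M n ^ 2))) atTop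
      (𝓝 0) := by
  have hlim := (tendsto_mul_log_div_sq hM hMlog).const_mul (A * C)
  rw [mul_zero] at hlim
  refine squeeze_zero' ?_ ?_ hlim
  all_goals
    filter_upwards [hM.eventually (Real.tendsto_log_atTop.eventually_ge_atTop 0)] with n hn
    have := truncMoment_nonneg (P := P) (H := H) 2 (M n)
  · positivity
  · calc A * Real.log (M n) * (n * (truncMoment P H 2 (M n) / M n ^ 2))
        ≤ A * Real.log (M n) * (n * (C / M n ^ 2)) := by
          gcongr
          exact hV _
      _ = A * C * (n * Real.log (M n) / M n ^ 2) := by ring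

variable [IsProbabilityMeasure P]

lemma measureReal_smallSum_le (hd : 0 < d) (hH : Measurable H)
    (hHs : ∀ j, Measurable (Hs j)) (hHid : ∀ j, IdentDistrib (Hs j) H P P)
    (hHind : iIndepFun Hs P) {m ε η θ : ℝ} (hm : 0 < m) (hε : 0 < ε) (hε1 : ε ≤ 1)
    (hθ : 0 < θ) (n : ℕ)
    (hmean : n * (‖∫ ω, smallPart (ε * m) (H ω) ∂P‖ / m) ≤ η / (4 * d))
    (hvar : θ ^ 2 * (n * (truncMoment P H 2 m / m ^ 2)) + n * (Real.exp (θ * ε) *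
      P.real {ω | m / θ < ‖smallPart (ε * m) (H ω)‖}) ≤ θ * η / (4 * d) + 1) :
    P.real {ω | η * m < ‖∑ j ∈ Finset.range n, smallPart (ε * m) (Hs j ω)‖} ≤
      2 * d * Real.exp (1 - θ * η / (2 * d)) := by
  refine (measureReal_lt_norm_sum_smallPart_le hd hH hHs hHid hHind (mul_pos hε hm).le
    (div_pos hθ hm) n (η * m)).trans ?_
  have : (0 : ℝ) < d := Nat.cast_pos.2 hd
  gcongr 2 * d * Real.exp ?_
  have hmean' : (n : ℝ) * (θ / m * ‖∫ ω, smallPart (ε * m) (H ω) ∂P‖) ≤ θ * (η / (4 * d)) := by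
    calc (n : ℝ) * (θ / m * ‖∫ ω, smallPart (ε * m) (H ω) ∂P‖)
        = θ * (n * (‖∫ ω, smallPart (ε * m) (H ω) ∂P‖ / m)) := by field_simp
      _ ≤ _ := by gcongr
  have hvar' : (n : ℝ) * ((θ / m) ^ 2 * truncMoment P H 2 (ε * m)) ≤
      θ ^ 2 * (n * (truncMoment P H 2 m / m ^ 2)) := by
    calc (n : ℝ) * ((θ / m) ^ 2 * truncMoment P H 2 (ε * m))
        ≤ n * ((θ / m) ^ 2 * truncMoment P H 2 m) := by
          gcongr
          exact truncMoment_mono hH 2 (mul_le_of_le_one_left hm.le hε1)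
      _ = _ := by field_simp
  have hlevel : -(θ / m) * (η * m / d) = -(4 * (θ * η / (4 * d))) := by field_simp
  have hparam : θ / m * (ε * m) = θ * ε := by field_simp
  have hhalf : θ * η / (2 * d) = 2 * (θ * η / (4 * d)) := by field_simp; norm_num
  rw [logMgfBound, hlevel, hparam, hhalf, inv_div, mul_add, mul_add]
  rw [← mul_div_assoc] at hmean'
  linarith

lemma measureReal_smallSum_le_of_variance (hd : 0 < d) (hH : Measurable H)
    (hHs : ∀ j, Measurable (Hs j)) (hHid : ∀ j, IdentDistrib (Hs j) H P P)
    (hHind : iIndepFun Hs P) {m ε η θ : ℝ} (hm : 0 < m) (hε : 0 < ε) (hε1 : ε ≤ 1) (hη : 0 < η)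
    (hθ : 0 < θ) (n : ℕ)
    (hmean : n * (‖∫ ω, smallPart (ε * m) (H ω) ∂P‖ / m) ≤ η / (4 * d))
    (hvar : 2 * (Real.exp (θ * ε) * (θ ^ 2 * (n * (truncMoment P H 2 m / m ^ 2)))) ≤ 1) :
    P.real {ω | η * m < ‖∑ j ∈ Finset.range n, smallPart (ε * m) (Hs j ω)‖} ≤
      2 * d * Real.exp (1 - θ * η / (2 * d)) := by
  have hV := truncMoment_nonneg (P := P) (H := H) 2 m
  have hcheb : P.real {ω | m / θ < ‖smallPart (ε * m) (H ω)‖} ≤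
      (θ / m) ^ 2 * truncMoment P H 2 m := by
    have h := measureReal_lt_norm_smallPart_le_truncMoment (P := P) hH (mul_pos hε hm).le
      (div_pos hθ hm)
    rw [inv_div] at h
    exact h.trans (mul_le_mul_of_nonneg_left
      (truncMoment_mono hH 2 (mul_le_of_le_one_left hm.le hε1)) (sq_nonneg _))
  have hjump : n * (Real.exp (θ * ε) * P.real {ω | m / θ < ‖smallPart (ε * m) (H ω)‖}) ≤
      Real.exp (θ * ε) * (θ ^ 2 * (n * (truncMoment P H 2 m / m ^ 2))) := by
    calc _ ≤ n * (Real.exp (θ * ε) * ((θ / m) ^ 2 * truncMoment P H 2 m)) := by gcongr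
      _ = _ := by field_simp
  have hexp : θ ^ 2 * (n * (truncMoment P H 2 m / m ^ 2)) ≤
      Real.exp (θ * ε) * (θ ^ 2 * (n * (truncMoment P H 2 m / m ^ 2))) :=
    le_mul_of_one_le_left (by positivity) (Real.one_le_exp (mul_pos hθ hε).le)
  have hη' : 0 ≤ θ * η / (4 * d) := by positivity
  exact measureReal_smallSum_le hd hH hHs hHid hHind hm hε hε1 hθ n hmean (by linarith)

lemma smallJumpsNegligible_of_le_two (hd : 0 < d) (hH : Measurable H)
    (hpos : ∀ x, 0 < normTail P H x)
    (hα : IsTailIndex P H α) (hα2 : α ≤ 2) (hsymm : α = 1 → P.map (fun ω => -H ω) = P.map H)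
    (hcent : 1 < α → Integrable H P ∧ ∫ ω, H ω ∂P = 0)
    (hHs : ∀ j, Measurable (Hs j)) (hHid : ∀ j, IdentDistrib (Hs j) H P P)
    (hHind : iIndepFun Hs P) (hMpos : ∀ n, 0 < M n) (hM : Tendsto M atTop atTop)
    (hsoft : Tendsto (fun n : ℕ => n * normTail P H (M n)) atTop (𝓝 0))
    (hM2 : α = 2 → ∃ γ : ℝ, 0 < γ ∧
      Tendsto (fun n : ℕ => M n / √((n : ℝ) ^ (1 + γ))) atTop atTop) (k : ℕ) :
    SmallJumpsNegligible P Hs M fun n => (n * normTail P H (M n)) ^ k := by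
  intro η hη
  obtain ⟨δ, C, hδ, _, hvar⟩ := exists_variance_le_rpow hH hpos hα hα2 hMpos hM hM2
  have : (0 : ℝ) < d := Nat.cast_pos.2 hd
  -- With `θ = -A log p`, the bound `exp (1 - θ η / (2 d))` is `e p ^ (k + 1)`.
  set A : ℝ := 2 * d * (k + 1) / η with hA
  have hA0 : 0 < A := by positivity
  refine ⟨min 1 (δ / (2 * A)), by positivity, fun ε hε hε0 => ?_⟩
  have hε1 : ε ≤ 1 := hε0.trans (min_le_left _ _)
  have hAε : A * ε < δ := by
    have := hε0.trans (min_le_right _ _)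
    rw [le_div_iff₀ (by positivity)] at this
    linarith
  have hp := tendsto_nhdsGT_mul_normTail hpos hsoft
  refine isLittleO_of_eventually_le_mul (K := 2 * d * Real.exp 1) (by positivity)
    (fun _ => measureReal_nonneg) hsoft ?_
  have hmean := tendsto_mean_smallPart hH hpos hα hsymm hcent hMpos hM hsoft hε hε1
  filter_upwards [eventually_exp_log_mul_le_one hp hvar hAε, hp.eventually self_mem_nhdsWithin,
    hsoft.eventually_lt_const one_pos,
    hmean.eventually_le_const (by positivity : 0 < η / (4 * d))] with n hvarn hpn hpn1 hmeann
  have hθ := mul_pos hA0 (neg_pos.2 (Real.log_neg hpn hpn1))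
  refine (measureReal_smallSum_le_of_variance hd hH hHs hHid hHind (hMpos n) hε hε1 hη hθ n hmeann
    hvarn).trans_eq ?_
  set p := (n : ℝ) * normTail P H (M n)
  have hexponent : 1 - A * -Real.log p * η / (2 * d) =
      1 + ((k + 1 : ℕ) : ℝ) * Real.log p := by
    rw [hA]
    push_cast
    field_simp
    ring
  rw [hexponent, Real.exp_add, Real.exp_nat_mul, Real.exp_log hpn, pow_succ']
  ring

lemma measureReal_smallSum_le_of_normTail (hd : 0 < d) (hH : Measurable H)
    (hHs : ∀ j, Measurable (Hs j)) (hHid : ∀ j, IdentDistrib (Hs j) H P P)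
    (hHind : iIndepFun Hs P) {m ε η θ : ℝ} (hm : 0 < m) (hε : 0 < ε) (hε1 : ε ≤ 1)
    (hθ : 0 < θ) (n : ℕ)
    (hmean : n * (‖∫ ω, smallPart (ε * m) (H ω) ∂P‖ / m) ≤ η / (4 * d))
    (hvar : θ * (n * (truncMoment P H 2 m / m ^ 2)) ≤ η / (4 * d))
    (hjump : n * (Real.exp (θ * ε) * normTail P H (m / θ)) ≤ 1) :
    P.real {ω | η * m < ‖∑ j ∈ Finset.range n, smallPart (ε * m) (Hs j ω)‖} ≤
      2 * d * Real.exp (1 - θ * η / (2 * d)) := by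
  refine measureReal_smallSum_le hd hH hHs hHid hHind hm hε hε1 hθ n hmean (add_le_add ?_ ?_)
  · rw [pow_two, mul_assoc, mul_div_assoc]
    gcongr
  · refine le_trans ?_ hjump
    gcongr
    exact measureReal_lt_norm_smallPart_le_normTail _

lemma smallJumpsNegligible_of_two_lt (hd : 0 < d) (hH : Measurable H)
    (hpos : ∀ x, 0 < normTail P H x) (hα : IsTailIndex P H α) (hα2 : 2 < α)
    (hint : Integrable H P) (h0 : ∫ ω, H ω ∂P = 0)
    (hHs : ∀ j, Measurable (Hs j)) (hHid : ∀ j, IdentDistrib (Hs j) H P P)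
    (hHind : iIndepFun Hs P) (hMpos : ∀ n, 0 < M n) (hM : Tendsto M atTop atTop)
    (hsoft : Tendsto (fun n : ℕ => n * normTail P H (M n)) atTop (𝓝 0))
    (hMlog : Tendsto (fun n : ℕ => M n / √(n * Real.log (M n))) atTop atTop) (k : ℕ) :
    SmallJumpsNegligible P Hs M fun n => (n * normTail P H (M n)) ^ k := by
  intro η hη
  have hα0 := hα.1
  obtain ⟨C, _, hV⟩ := exists_truncMoment_two_le hH hpos hα hα2
  obtain ⟨D, _, hFD⟩ := exists_eventually_rpow_mul_le antitone_normTail hpos (hα.2 2 two_pos)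
    (β := (α + 2) / 2) (by linarith) (by linarith)
  have : (0 : ℝ) < d := Nat.cast_pos.2 hd
  -- With `θ = A log M`, the bound `exp (1 - θ η / (2 d))` is `e M⁻¹ (M ^ (-(α + 1))) ^ k`.
  set A : ℝ := 2 * d * ((α + 1) * k + 1) / η with hA
  have hA0 : 0 < A := by positivity
  refine ⟨min 1 ((α - 2) / (4 * A)), by have := sub_pos.2 hα2; positivity, fun ε hε hε0 => ?_⟩
  have hε1 : ε ≤ 1 := hε0.trans (min_le_left _ _)
  have hAε : 2 + A * ε < (α + 2) / 2 := by
    have := hε0.trans (min_le_right _ _)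
    rw [le_div_iff₀ (by positivity)] at this
    linarith
  refine isLittleO_of_eventually_le_mul (K := 2 * d * Real.exp 1) (by positivity)
    (fun _ => measureReal_nonneg) hM.inv_tendsto_atTop ?_
  have hη' : 0 < η / (4 * d) := by positivity
  filter_upwards [
    (tendsto_mean_smallPart_of_one_lt hH hpos hα (by linarith) hint h0 hMpos hM hsoft
      hε).eventually_le_const hη',
    (tendsto_log_mul_variance hM hMlog hV A hA0.le).eventually_le_const hη',
    eventually_mul_exp_mul_le_one hM hMlog (fun x => (hpos x).le) hA0 hAε hFD,
    hM.eventually (Real.tendsto_log_atTop.eventually_gt_atTop 0),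
    hM.eventually (eventually_rpow_neg_le antitone_normTail hpos (hα.2 2 two_pos) hα0
      (lt_add_one α)), eventually_ge_atTop 1] with n hmean hvar hjump hlog hFn hn
  have hMn := hMpos n
  refine (measureReal_smallSum_le_of_normTail hd hH hHs hHid hHind hMn hε hε1
    (mul_pos hA0 hlog) n hmean hvar hjump).trans ?_
  have hexponent : 1 - A * Real.log (M n) * η / (2 * d) =
      1 + Real.log (M n) * (-1 + -(α + 1) * k) := by
    rw [hA]
    field_simp
    ring
  rw [hexponent, Real.exp_add, ← Real.rpow_def_of_pos hMn, Real.rpow_add hMn, Real.rpow_neg_one,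
    Real.rpow_mul hMn.le, Real.rpow_natCast, ← mul_assoc]
  refine mul_le_mul_of_nonneg_left ?_ (by positivity)
  rw [Pi.inv_apply]
  gcongr
  exact hFn.trans (le_mul_of_one_le_left (hpos _).le (Nat.one_le_cast.2 hn))

lemma smallJumpsNegligible (hH : Measurable H) (hpos : ∀ x, 0 < normTail P H x)
    (hα : IsTailIndex P H α) (hsymm : α = 1 → P.map (fun ω => -H ω) = P.map H)
    (hcent : 1 < α → Integrable H P ∧ ∫ ω, H ω ∂P = 0)
    (hHs : ∀ j, Measurable (Hs j)) (hHid : ∀ j, IdentDistrib (Hs j) H P P)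
    (hHind : iIndepFun Hs P) (hMpos : ∀ n, 0 < M n) (hM : Tendsto M atTop atTop)
    (hsoft : Tendsto (fun n : ℕ => n * normTail P H (M n)) atTop (𝓝 0))
    (hM2 : α = 2 → ∃ γ : ℝ, 0 < γ ∧
      Tendsto (fun n : ℕ => M n / √((n : ℝ) ^ (1 + γ))) atTop atTop)
    (hMlog : 2 < α → Tendsto (fun n : ℕ => M n / √(n * Real.log (M n))) atTop atTop) (k : ℕ) :
    SmallJumpsNegligible P Hs M fun n => (n * normTail P H (M n)) ^ k := by
  have hd : 0 < d := Nat.pos_of_ne_zero fun h => by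
    subst h
    simpa only [normTail, Subsingleton.elim (H _) 0, norm_zero, lt_self_iff_false, Set.ofPred_false,
      measureReal_empty] using hpos 0
  rcases le_or_gt α 2 with h | h
  · exact smallJumpsNegligible_of_le_two hd hH hpos hα h hsymm hcent hHs hHid hHind hMpos hM hsoft
      hM2 k
  · obtain ⟨hint, h0⟩ := hcent (by linarith)
    exact smallJumpsNegligible_of_two_lt hd hH hpos hα h hint h0 hHs hHid hHind hMpos hM hsoft
      (hMlog h) k

end SmallSum

/-! ### Approximation of a row sum by its large jumps -/

section Comparison

variable {E : Type*} [NormedAddCommGroup E] {ι : Type*} {m c : ℝ}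

lemma norm_sum_le_card_mul {J : Finset ι} {u : ι → E} (hu : ∀ j ∈ J, ‖u j‖ ≤ c) :
    ‖∑ j ∈ J, u j‖ ≤ J.card * c :=
  (norm_sum_le_of_le J hu).trans_eq (by rw [Finset.sum_const, nsmul_eq_mul])

lemma norm_sum_le_card_sub_one_add {J : Finset ι} {u : ι → E} (hu : ∀ j ∈ J, ‖u j‖ ≤ 1) {i : ι}
    (hi : i ∈ J) (hc : ‖u i‖ ≤ c) : ‖∑ j ∈ J, u j‖ ≤ J.card - 1 + c := by
  classical
  have hrest := norm_sum_le_card_mul (J := J.erase i) (u := u) (c := 1)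
    fun j hj => hu j (Finset.mem_of_mem_erase hj)
  rw [mul_one, Finset.cast_card_erase_of_mem hi] at hrest
  rw [← Finset.add_sum_erase _ _ hi]
  linarith [norm_add_le (u i) (∑ j ∈ J.erase i, u j)]

/-- The indices below `n` of the vectors of norm larger than `c`. -/
def largeIndices (h : ℕ → E) (n : ℕ) (c : ℝ) : Finset ℕ :=
  {j ∈ Finset.range n | c < ‖h j‖}

lemma powersetCard_largeIndices (h : ℕ → E) (n k : ℕ) (c : ℝ) :
    Finset.powersetCard k (largeIndices h n c) =
      {J ∈ Finset.powersetCard k (Finset.range n) | ∀ j ∈ J, c < ‖h j‖} := by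
  ext J
  simp only [largeIndices, Finset.mem_filter, Finset.mem_powersetCard, Finset.subset_iff]
  grind

lemma choose_le_succ_mul_choose {N k : ℕ} (h : k < N) :
    N.choose k ≤ (k + 1) * N.choose (k + 1) := by
  rw [mul_comm, Nat.choose_succ_right_eq]
  exact Nat.le_mul_of_pos_right _ (Nat.sub_pos_of_lt h)

section PowersetCard

variable {A : Finset ι} {g : Finset ι → ℝ} {s C : ℝ} {k : ℕ}

lemma abs_sum_powersetCard_le (hg : ∀ J, |g J| ≤ C) :
    |∑ J ∈ Finset.powersetCard k A, g J| ≤ A.card.choose k * C := by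
  refine (Finset.abs_sum_le_sum_abs _ _).trans ((Finset.sum_le_sum fun J _ => hg J).trans_eq ?_)
  rw [Finset.sum_const, Finset.card_powersetCard, nsmul_eq_mul]

lemma abs_sub_sum_powersetCard_le_of_lt_card (hs : |s| ≤ C) (hg : ∀ J, |g J| ≤ C)
    (hA : k < A.card) :
    |s - ∑ J ∈ Finset.powersetCard k A, g J| ≤ (k + 2) * C * A.card.choose (k + 1) := by
  have hC : 0 ≤ C := (abs_nonneg s).trans hs
  have hchoose : (A.card.choose k : ℝ) ≤ (k + 1) * A.card.choose (k + 1) :=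
    mod_cast choose_le_succ_mul_choose hA
  have hone : (1 : ℝ) ≤ A.card.choose (k + 1) := mod_cast Nat.choose_pos hA
  calc |s - ∑ J ∈ Finset.powersetCard k A, g J|
      ≤ |s| + |∑ J ∈ Finset.powersetCard k A, g J| := abs_sub _ _
    _ ≤ 1 * C + A.card.choose k * C :=
        add_le_add (by rwa [one_mul]) (abs_sum_powersetCard_le hg)
    _ ≤ A.card.choose (k + 1) * C + (k + 1) * A.card.choose (k + 1) * C := by gcongr
    _ = (k + 2) * C * A.card.choose (k + 1) := by ring

lemma abs_sub_sum_powersetCard_le_two_mul_of_card_le (hs : |s| ≤ C) (hg : ∀ J, |g J| ≤ C)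
    (hA : A.card ≤ k) : |s - ∑ J ∈ Finset.powersetCard k A, g J| ≤ 2 * C := by
  have hC : 0 ≤ C := (abs_nonneg s).trans hs
  have hchoose : (A.card.choose k : ℝ) ≤ 1 := by
    exact_mod_cast (Nat.choose_le_choose k hA).trans_eq (Nat.choose_self k)
  calc |s - ∑ J ∈ Finset.powersetCard k A, g J|
      ≤ |s| + |∑ J ∈ Finset.powersetCard k A, g J| := abs_sub _ _
    _ ≤ C + 1 * C :=
        add_le_add hs ((abs_sum_powersetCard_le hg).trans (by gcongr))
    _ = 2 * C := by ring

lemma abs_sub_sum_powersetCard_le_two_mul_add (hs : |s| ≤ C) (hg : ∀ J, |g J| ≤ C) :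
    |s - ∑ J ∈ Finset.powersetCard k A, g J| ≤ 2 * C + (k + 2) * C * A.card.choose (k + 1) := by
  have hC : 0 ≤ C := (abs_nonneg s).trans hs
  rcases le_or_gt A.card k with hA | hA
  · exact (abs_sub_sum_powersetCard_le_two_mul_of_card_le hs hg hA).trans
      (le_add_of_nonneg_right (by positivity))
  · exact (abs_sub_sum_powersetCard_le_of_lt_card hs hg hA).trans
      (le_add_of_nonneg_left (by positivity))

end PowersetCard

section TestFunction

variable {f : E → ℝ} {δ ρ e : ℝ} {k : ℕ}

lemma abs_sub_sum_powersetCard_le_of_norm_sub_le (hf0 : ∀ x, ‖x‖ ≤ (k : ℝ) - 1 + δ → f x = 0)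
    (hδ : 0 ≤ δ) (hρδ : ρ ≤ δ / 2) (he : 0 ≤ e)
    (hf : ∀ x y, ‖x‖ ≤ k → ‖y - x‖ ≤ ρ → |f y - f x| ≤ e) {A G : Finset ι} {T : ι → E}
    (hT : ∀ j, ‖T j‖ ≤ 1) (hG : ∀ j ∈ A, j ∉ G → ‖T j‖ ≤ δ / 2) (hA : A.card ≤ k) {s : E}
    (hs : ‖s - ∑ j ∈ A, T j‖ ≤ ρ) :
    |f s - ∑ J ∈ Finset.powersetCard k A, f (∑ j ∈ J, T j)| ≤ e * G.card.choose k := by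
  have hsum : ‖∑ j ∈ A, T j‖ ≤ A.card := by
    simpa only [mul_one] using norm_sum_le_card_mul fun j _ => hT j
  have hs' : ‖s‖ ≤ ‖∑ j ∈ A, T j‖ + ρ :=
    (norm_le_norm_add_norm_sub' s _).trans (add_le_add_right hs _)
  rcases hA.lt_or_eq with hlt | rfl
  · have hcard : (A.card : ℝ) + 1 ≤ k := mod_cast hlt
    rw [Finset.powersetCard_eq_empty.2 hlt, Finset.sum_empty, sub_zero, hf0 s (by linarith),
      abs_zero]
    positivity
  rw [Finset.powersetCard_self, Finset.sum_singleton]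
  by_cases hAG : A ⊆ G
  · have hone : (1 : ℝ) ≤ G.card.choose A.card :=
      mod_cast Nat.choose_pos (Finset.card_le_card hAG)
    exact (hf _ _ hsum hs).trans (le_mul_of_one_le_right he hone)
  · obtain ⟨j, hj, hjG⟩ := Finset.not_subset.1 hAG
    have hsmall := norm_sum_le_card_sub_one_add (fun j _ => hT j) hj (hG j hj hjG)
    rw [hf0 s (by linarith), hf0 _ (by linarith), sub_self, abs_zero]
    positivity

lemma abs_sub_sum_powersetCard_le_of_norm_sub_le_card {C η : ℝ} (hC : ∀ x, |f x| ≤ C)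
    (hf0 : ∀ x, ‖x‖ ≤ (k : ℝ) - 1 + δ → f x = 0)
    (hδ : 0 ≤ δ) (hη : 0 ≤ η) (hηδ : (k + 1) * η ≤ δ / 2) (he : 0 ≤ e)
    (hf : ∀ x y, ‖x‖ ≤ k → ‖y - x‖ ≤ (k + 1) * η → |f y - f x| ≤ e) {A G : Finset ι} {T : ι → E}
    (hT : ∀ j, ‖T j‖ ≤ 1) (hG : ∀ j ∈ A, j ∉ G → ‖T j‖ ≤ δ / 2) {s : E}
    (hs : ‖s - ∑ j ∈ A, T j‖ ≤ (A.card + 1) * η) :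
    |f s - ∑ J ∈ Finset.powersetCard k A, f (∑ j ∈ J, T j)| ≤
      e * G.card.choose k + (k + 2) * C * A.card.choose (k + 1) := by
  have hC0 : 0 ≤ C := (abs_nonneg _).trans (hC 0)
  rcases le_or_gt A.card k with hA | hA
  · refine (abs_sub_sum_powersetCard_le_of_norm_sub_le hf0 hδ hηδ he hf hT hG hA
      (hs.trans ?_)).trans (le_add_of_nonneg_right (by positivity))
    gcongr
  · exact (abs_sub_sum_powersetCard_le_of_lt_card (hC s) (fun J => hC _) hA).trans
      (le_add_of_nonneg_left (by positivity))

end TestFunction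

variable [NormedSpace ℝ E]

lemma ballRetract_smul_inv_of_le (hm : 0 < m) {h : E} (hh : ‖h‖ ≤ m) :
    ballRetract (m⁻¹ • h) = m⁻¹ • h :=
  ballRetract_of_norm_le_one <| by
    rwa [norm_smul, norm_inv, Real.norm_of_nonneg hm.le, inv_mul_le_iff₀ hm, mul_one]

lemma ballRetract_smul_inv_of_lt (hm : 0 < m) {h : E} (hh : m < ‖h‖) :
    ballRetract (m⁻¹ • h) = ‖h‖⁻¹ • h := by
  have hnorm : ‖m⁻¹ • h‖ = m⁻¹ * ‖h‖ := by rw [norm_smul, norm_inv, Real.norm_of_nonneg hm.le]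
  rw [ballRetract_of_one_le_norm, hnorm, smul_smul, mul_inv, inv_inv, mul_right_comm,
    mul_inv_cancel₀ hm.ne', one_mul]
  rw [hnorm, le_inv_mul_iff₀ hm, mul_one]
  exact hh.le

lemma norm_ballRetract_smul_inv_le (hm : 0 < m) {h : E} (hh : ‖h‖ ≤ c * m) :
    ‖ballRetract (m⁻¹ • h)‖ ≤ c := by
  rw [norm_ballRetract, norm_smul, norm_inv, Real.norm_of_nonneg hm.le]
  exact (min_le_left _ _).trans (by rwa [inv_mul_le_iff₀ hm, mul_comm])

lemma norm_inv_smul_truncate_sub_ballRetract_le {d : ℕ} (hm : 0 < m) {h : Vec d} {l η : ℝ}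
    (hl : 0 ≤ l) (hη : 0 ≤ η) (hlη : m < ‖h‖ → l ≤ η * m) :
    ‖m⁻¹ • truncate m h l - ballRetract (m⁻¹ • h)‖ ≤ η := by
  rcases le_or_gt ‖h‖ m with hh | hh
  · rwa [truncate, if_pos hh, ballRetract_smul_inv_of_le hm hh, sub_self, norm_zero]
  · have hexcess : m⁻¹ * (m + l) = l / m + 1 := by
      field_simp
      ring
    rw [truncate, if_neg hh.not_ge, ballRetract_smul_inv_of_lt hm hh, smul_smul, hexcess, add_smul,
      one_smul, add_sub_cancel_right, norm_smul, norm_smul, norm_inv, norm_norm,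
      inv_mul_cancel₀ (hm.trans hh).ne', mul_one, Real.norm_of_nonneg (by positivity),
      div_le_iff₀ hm]
    exact hlη hh

lemma sum_powersetCard_largeIndices {f : E → ℝ} {ε : ℝ} {k : ℕ}
    (hf0 : ∀ x, ‖x‖ ≤ (k : ℝ) - 1 + ε → f x = 0) (hm : 0 < m) (h : ℕ → E) (n : ℕ) :
    ∑ J ∈ Finset.powersetCard k (largeIndices h n (ε * m)),
      f (∑ j ∈ J, ballRetract (m⁻¹ • h j)) =
    ∑ J ∈ Finset.powersetCard k (Finset.range n), f (∑ j ∈ J, ballRetract (m⁻¹ • h j)) := by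
  rw [powersetCard_largeIndices]
  refine Finset.sum_filter_of_ne fun J hJ hne j hj => not_le.1 fun hle => hne (hf0 _ ?_)
  have hsum := norm_sum_le_card_sub_one_add (u := fun j => ballRetract (m⁻¹ • h j))
    (fun j _ => norm_ballRetract_le_one _) hj (norm_ballRetract_smul_inv_le hm hle)
  rwa [(Finset.mem_powersetCard.1 hJ).2] at hsum

lemma sum_truncate_eq {d : ℕ} (hmc : c ≤ m) (h : ℕ → Vec d) (l : ℕ → ℝ) (n : ℕ) :
    ∑ j ∈ Finset.range n, truncate m (h j) (l j) =
      ∑ j ∈ Finset.range n, smallPart c (h j) +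
        ∑ j ∈ largeIndices h n c, truncate m (h j) (l j) := by
  rw [largeIndices, Finset.sum_filter, ← Finset.sum_add_distrib]
  refine Finset.sum_congr rfl fun j _ => ?_
  split_ifs with hj
  · rw [smallPart_of_lt hj, zero_add]
  · rw [smallPart_of_le (not_lt.1 hj), add_zero, truncate, if_pos ((not_lt.1 hj).trans hmc)]

lemma norm_inv_smul_sum_truncate_sub_le {d : ℕ} (hm : 0 < m) (hcm : c ≤ m) {h : ℕ → Vec d}
    {l : ℕ → ℝ} (hl : ∀ j, 0 ≤ l j) {η : ℝ} (hη : 0 ≤ η) {n : ℕ}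
    (hsmall : ‖∑ j ∈ Finset.range n, smallPart c (h j)‖ ≤ η * m)
    (hexcess : ∀ j < n, m < ‖h j‖ → l j ≤ η * m) :
    ‖m⁻¹ • ∑ j ∈ Finset.range n, truncate m (h j) (l j) -
      ∑ j ∈ largeIndices h n c, ballRetract (m⁻¹ • h j)‖ ≤
      ((largeIndices h n c).card + 1) * η := by
  have hsmall' : ‖m⁻¹ • ∑ j ∈ Finset.range n, smallPart c (h j)‖ ≤ η := by
    rwa [norm_smul, norm_inv, Real.norm_of_nonneg hm.le, inv_mul_le_iff₀ hm, mul_comm m]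
  have hlarge : ‖∑ j ∈ largeIndices h n c,
      (m⁻¹ • truncate m (h j) (l j) - ballRetract (m⁻¹ • h j))‖ ≤
      (largeIndices h n c).card * η :=
    norm_sum_le_card_mul fun j hj =>
      norm_inv_smul_truncate_sub_ballRetract_le hm (hl j) hη
        (hexcess j (Finset.mem_range.1 (Finset.mem_filter.1 hj).1))
  rw [sum_truncate_eq hcm, smul_add, add_sub_assoc, Finset.smul_sum, ← Finset.smul_sum,
    Finset.smul_sum (s := largeIndices h n c), ← Finset.sum_sub_distrib]
  linarith [norm_add_le (m⁻¹ • ∑ j ∈ Finset.range n, smallPart c (h j))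
    (∑ j ∈ largeIndices h n c, (m⁻¹ • truncate m (h j) (l j) - ballRetract (m⁻¹ • h j)))]

end Comparison

section Expectation

variable {Ω : Type*} {d : ℕ} {Hs : ℕ → Ω → Vec d} {Ls : ℕ → Ω → ℝ}

lemma setOf_forall_lt_norm (J : Finset ℕ) (c : ℝ) :
    {ω | ∀ j ∈ J, c < ‖Hs j ω‖} = ⋂ j ∈ J, Hs j ⁻¹' {y | c < ‖y‖} := by
  ext ω
  simp

lemma choose_card_largeIndices_eq_sum_indicator (n k : ℕ) (c : ℝ) (ω : Ω) :
    ((largeIndices (fun j => Hs j ω) n c).card.choose k : ℝ) =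
      ∑ J ∈ Finset.powersetCard k (Finset.range n),
        Set.indicator {ω | ∀ j ∈ J, c < ‖Hs j ω‖} (1 : Ω → ℝ) ω := by
  rw [← Finset.card_powersetCard, powersetCard_largeIndices, Finset.card_filter]
  push_cast
  simp only [Set.indicator_apply, Set.mem_ofPred_eq, Pi.one_apply]

lemma setOf_exists_large_excess (n : ℕ) (m c : ℝ) :
    {ω | ∃ j < n, m < ‖Hs j ω‖ ∧ c < Ls j ω} =
      ⋃ j ∈ Finset.range n, (Hs j ⁻¹' {y | m < ‖y‖} ∩ Ls j ⁻¹' Set.Ioi c) := by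
  ext ω
  simp only [Set.mem_ofPred_eq, Set.mem_iUnion, Finset.mem_range, Set.mem_inter_iff,
    Set.mem_preimage, Set.mem_Ioi, exists_prop]

/-- The event that the jumps of size at most `ε m` add up to more than `η m`, or that the overshoot
of some jump truncated at `m` exceeds `η m`. -/
def exceptionalEvent (Hs : ℕ → Ω → Vec d) (Ls : ℕ → Ω → ℝ) (n : ℕ) (m ε η : ℝ) : Set Ω :=
  {ω | η * m < ‖∑ j ∈ Finset.range n, smallPart (ε * m) (Hs j ω)‖} ∪
    {ω | ∃ j < n, m < ‖Hs j ω‖ ∧ η * m < Ls j ω}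

variable {f : Vec d → ℝ} {C δ η ε e : ℝ} {k : ℕ}

lemma abs_sub_sum_powersetCard_ballRetract_le (hLs0 : ∀ j ω, 0 ≤ Ls j ω) {m : ℝ} (hm : 0 < m)
    (hC : ∀ x, |f x| ≤ C) (hf0 : ∀ x, ‖x‖ ≤ (k : ℝ) - 1 + δ → f x = 0) (hδ : 0 ≤ δ)
    (hη : 0 ≤ η) (hηδ : (k + 1) * η ≤ δ / 2) (hε1 : ε ≤ 1) (hεδ : ε ≤ δ) (he : 0 ≤ e)
    (hf : ∀ x y, ‖x‖ ≤ k → ‖y - x‖ ≤ (k + 1) * η → |f y - f x| ≤ e) (n : ℕ) (ω : Ω) :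
    |f (m⁻¹ • ∑ j ∈ Finset.range n, truncate m (Hs j ω) (Ls j ω)) -
      ∑ J ∈ Finset.powersetCard k (Finset.range n), f (∑ j ∈ J, ballRetract (m⁻¹ • Hs j ω))| ≤
      2 * C * (exceptionalEvent Hs Ls n m ε η).indicator 1 ω +
        e * (largeIndices (fun j => Hs j ω) n (δ / 2 * m)).card.choose k +
        (k + 2) * C * (largeIndices (fun j => Hs j ω) n (ε * m)).card.choose (k + 1) := by
  have hf0' (x : Vec d) (hx : ‖x‖ ≤ (k : ℝ) - 1 + ε) : f x = 0 := hf0 x (by linarith)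
  rw [← sum_powersetCard_largeIndices hf0' hm]
  by_cases hω : ω ∈ exceptionalEvent Hs Ls n m ε η
  · rw [Set.indicator_of_mem hω, Pi.one_apply, mul_one, add_right_comm]
    exact (abs_sub_sum_powersetCard_le_two_mul_add (hC _) fun J => hC _).trans
      (le_add_of_nonneg_right (by positivity))
  · rw [Set.indicator_of_notMem hω, mul_zero, zero_add]
    simp only [exceptionalEvent, Set.mem_union, Set.mem_ofPred_eq, not_or, not_exists, not_and,
      not_lt] at hω
    refine abs_sub_sum_powersetCard_le_of_norm_sub_le_card hC hf0 hδ hη hηδ he hf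
      (fun j => norm_ballRetract_le_one _) (fun j hj hjG => norm_ballRetract_smul_inv_le hm ?_)
      (norm_inv_smul_sum_truncate_sub_le hm (mul_le_of_le_one_left hm.le hε1)
        (fun j => hLs0 j ω) hη hω.1 hω.2)
    exact not_lt.1 fun hlt => hjG
      (Finset.mem_filter.2 ⟨(Finset.mem_filter.1 hj).1, hlt⟩)

variable [MeasurableSpace Ω] {P : Measure Ω} {H : Ω → Vec d} {L : Ω → ℝ} {M : ℕ → ℝ}

lemma measurableSet_forall_lt_norm (hHs : ∀ j, Measurable (Hs j)) (J : Finset ℕ) (c : ℝ) :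
    MeasurableSet {ω | ∀ j ∈ J, c < ‖Hs j ω‖} := by
  rw [setOf_forall_lt_norm]
  exact J.measurableSet_biInter fun j _ => measurableSet_lt_norm (hHs j) c

lemma measureReal_forall_lt_norm (hHid : ∀ j, IdentDistrib (Hs j) H P P)
    (hHind : iIndepFun Hs P) (J : Finset ℕ) (c : ℝ) :
    P.real {ω | ∀ j ∈ J, c < ‖Hs j ω‖} = normTail P H c ^ J.card := by
  have hset : MeasurableSet {y : Vec d | c < ‖y‖} := measurableSet_lt_norm measurable_id c
  rw [setOf_forall_lt_norm, Measure.real,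
    hHind.measure_inter_preimage_eq_mul J (sets := fun _ => {y | c < ‖y‖}) fun _ _ => hset,
    ENNReal.toReal_prod]
  exact Finset.prod_eq_pow_card fun j _ => congrArg ENNReal.toReal ((hHid j).measure_mem_eq hset)

lemma measurable_truncate {X : Ω → Vec d} (hX : Measurable X) {Y : Ω → ℝ} (hY : Measurable Y)
    (m : ℝ) : Measurable fun ω => truncate m (X ω) (Y ω) :=
  Measurable.ite (measurableSet_le hX.norm measurable_const) hX (by fun_prop)

lemma measurable_rowSum (hHs : ∀ j, Measurable (Hs j)) (hLs : ∀ j, Measurable (Ls j)) (n : ℕ) :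
    Measurable (rowSum M Hs Ls n) :=
  Finset.measurable_fun_sum _ fun j _ => measurable_truncate (hHs j) (hLs j) _

lemma measurableSet_lt_norm_smallSum (hHs : ∀ j, Measurable (Hs j)) (n : ℕ) (B c : ℝ) :
    MeasurableSet {ω | c < ‖∑ j ∈ Finset.range n, smallPart B (Hs j ω)‖} :=
  measurableSet_lt_norm
    (Finset.measurable_fun_sum _ fun j _ => (measurable_smallPart _).comp (hHs j)) c

lemma measurableSet_exists_large_excess (hHs : ∀ j, Measurable (Hs j))
    (hLs : ∀ j, Measurable (Ls j)) (n : ℕ) (m c : ℝ) :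
    MeasurableSet {ω | ∃ j < n, m < ‖Hs j ω‖ ∧ c < Ls j ω} := by
  rw [setOf_exists_large_excess]
  exact Finset.measurableSet_biUnion _ fun j _ =>
    (measurableSet_lt_norm (hHs j) m).inter (hLs j measurableSet_Ioi)

lemma measureReal_exists_large_excess_le (hHid : ∀ j, IdentDistrib (Hs j) H P P)
    (hLid : ∀ j, IdentDistrib (Ls j) L P P)
    (hHL : IndepFun (fun ω j => Hs j ω) (fun ω j => Ls j ω) P) (n : ℕ) (m c : ℝ) :
    P.real {ω | ∃ j < n, m < ‖Hs j ω‖ ∧ c < Ls j ω} ≤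
      n * normTail P H m * P.real {ω | c < L ω} := by
  have hset : MeasurableSet {y : Vec d | m < ‖y‖} := measurableSet_lt_norm measurable_id m
  have hterm (j : ℕ) : P.real (Hs j ⁻¹' {y | m < ‖y‖} ∩ Ls j ⁻¹' Set.Ioi c) =
      normTail P H m * P.real {ω | c < L ω} := by
    have hind : IndepFun (Hs j) (Ls j) P :=
      hHL.comp (measurable_pi_apply j) (measurable_pi_apply j)
    rw [Measure.real, hind.measure_inter_preimage_eq_mul _ _ hset measurableSet_Ioi,
      ENNReal.toReal_mul, (hHid j).measure_mem_eq hset, (hLid j).measure_mem_eq measurableSet_Ioi]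
    rfl
  rw [setOf_exists_large_excess]
  refine (measureReal_biUnion_finset_le _ _).trans_eq ?_
  simp only [hterm, Finset.sum_const, Finset.card_range, nsmul_eq_mul, mul_assoc]

/-- The law of `H / m`, retracted radially to the unit ball. -/
def retractedLaw (P : Measure Ω) (H : Ω → Vec d) (m : ℝ) : Measure (Vec d) :=
  P.map fun ω => ballRetract (m⁻¹ • H ω)

lemma measurable_ballRetract_smul (m : ℝ) : Measurable fun h : Vec d => ballRetract (m • h) :=
  continuous_ballRetract.measurable.comp (measurable_const_smul m)

lemma integral_comp_sum_ballRetract (hHs : ∀ j, Measurable (Hs j))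
    (hHid : ∀ j, IdentDistrib (Hs j) H P P) (hHind : iIndepFun Hs P) {f : Vec d → ℝ}
    (hf : Continuous f) (m : ℝ) {k : ℕ} {J : Finset ℕ} (hJ : J.card = k) :
    ∫ ω, f (∑ j ∈ J, ballRetract (m⁻¹ • Hs j ω)) ∂P =
      ∫ x, f (∑ i, x i) ∂(Measure.pi fun _ : Fin k => retractedLaw P H m) := by
  have hP : IsProbabilityMeasure P := hHind.isProbabilityMeasure
  have hretract : Measurable fun h : Vec d => ballRetract (m⁻¹ • h) :=
    measurable_ballRetract_smul m⁻¹
  let e : Fin k ≃ J := (J.orderIsoOfFin hJ).toEquiv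
  let X : Fin k → Ω → Vec d := fun i ω => ballRetract (m⁻¹ • Hs (e i) ω)
  have hX (i : Fin k) : Measurable (X i) := hretract.comp (hHs _)
  have hind : iIndepFun X P :=
    (hHind.precomp (g := fun i => (e i : ℕ))
      (Subtype.val_injective.comp e.injective)).comp (fun _ h => ballRetract (m⁻¹ • h))
      fun _ => hretract
  have hlaw : P.map (fun ω i => X i ω) = Measure.pi fun _ : Fin k => retractedLaw P H m := by
    rw [(iIndepFun_iff_map_fun_eq_pi_map fun i => (hX i).aemeasurable).1 hind]
    exact congrArg Measure.pi (funext fun i => ((hHid (e i)).comp hretract).map_eq)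
  have hsum (ω : Ω) : ∑ j ∈ J, ballRetract (m⁻¹ • Hs j ω) = ∑ i, X i ω := by
    rw [← Finset.sum_coe_sort J (fun j => ballRetract (m⁻¹ • Hs j ω))]
    exact (Equiv.sum_comp e fun j : J => ballRetract (m⁻¹ • Hs j ω)).symm
  simp_rw [hsum]
  rw [← hlaw, integral_map (measurable_pi_lambda _ hX).aemeasurable]
  exact (hf.comp (continuous_finsetSum _ fun i _ => continuous_apply i)).aestronglyMeasurable

lemma measurableSet_exceptionalEvent (hHs : ∀ j, Measurable (Hs j)) (hLs : ∀ j, Measurable (Ls j))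
    (n : ℕ) (m ε η : ℝ) : MeasurableSet (exceptionalEvent Hs Ls n m ε η) :=
  (measurableSet_lt_norm_smallSum hHs n _ _).union
    (measurableSet_exists_large_excess hHs hLs n _ _)

lemma measureReal_exceptionalEvent_le (hHid : ∀ j, IdentDistrib (Hs j) H P P)
    (hLid : ∀ j, IdentDistrib (Ls j) L P P)
    (hHL : IndepFun (fun ω j => Hs j ω) (fun ω j => Ls j ω) P) (n : ℕ) (m ε η : ℝ) :
    P.real (exceptionalEvent Hs Ls n m ε η) ≤
      P.real {ω | η * m < ‖∑ j ∈ Finset.range n, smallPart (ε * m) (Hs j ω)‖} +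
        n * normTail P H m * P.real {ω | η * m < L ω} :=
  (measureReal_union_le _ _).trans
    (add_le_add_right (measureReal_exists_large_excess_le hHid hLid hHL n _ _) _)

variable [IsProbabilityMeasure P]

lemma isProbabilityMeasure_retractedLaw (hH : Measurable H) (m : ℝ) :
    IsProbabilityMeasure (retractedLaw P H m) :=
  Measure.isProbabilityMeasure_map ((measurable_ballRetract_smul m⁻¹).comp hH).aemeasurable

lemma integrable_indicator_forall_lt_norm (hHs : ∀ j, Measurable (Hs j)) (J : Finset ℕ) (c : ℝ) :
    Integrable (Set.indicator {ω | ∀ j ∈ J, c < ‖Hs j ω‖} (1 : Ω → ℝ)) P :=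
  (integrable_const 1).indicator (measurableSet_forall_lt_norm hHs J c)

lemma integrable_choose_card_largeIndices (hHs : ∀ j, Measurable (Hs j)) (n k : ℕ) (c : ℝ) :
    Integrable (fun ω => ((largeIndices (fun j => Hs j ω) n c).card.choose k : ℝ)) P := by
  simp_rw [choose_card_largeIndices_eq_sum_indicator]
  exact integrable_finsetSum _ fun J _ => integrable_indicator_forall_lt_norm hHs J c

lemma integral_choose_card_largeIndices (hHs : ∀ j, Measurable (Hs j))
    (hHid : ∀ j, IdentDistrib (Hs j) H P P) (hHind : iIndepFun Hs P) (n k : ℕ) (c : ℝ) :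
    ∫ ω, ((largeIndices (fun j => Hs j ω) n c).card.choose k : ℝ) ∂P =
      n.choose k * normTail P H c ^ k := by
  simp_rw [choose_card_largeIndices_eq_sum_indicator]
  rw [integral_finsetSum _ fun J _ => integrable_indicator_forall_lt_norm hHs J c,
    Finset.sum_congr rfl fun J hJ => ?_, Finset.sum_const, Finset.card_powersetCard,
    Finset.card_range, nsmul_eq_mul]
  rw [integral_indicator_one (measurableSet_forall_lt_norm hHs J c),
    measureReal_forall_lt_norm hHid hHind, (Finset.mem_powersetCard.1 hJ).2]

lemma integral_choose_card_largeIndices_le (hHs : ∀ j, Measurable (Hs j))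
    (hHid : ∀ j, IdentDistrib (Hs j) H P P) (hHind : iIndepFun Hs P) (n k : ℕ) (c : ℝ) :
    ∫ ω, ((largeIndices (fun j => Hs j ω) n c).card.choose k : ℝ) ∂P ≤
      (n * normTail P H c) ^ k := by
  rw [integral_choose_card_largeIndices hHs hHid hHind, mul_pow]
  exact mul_le_mul_of_nonneg_right (mod_cast Nat.choose_le_pow n k)
    (pow_nonneg measureReal_nonneg k)

lemma integrable_comp_of_bounded {f : Vec d → ℝ} (hf : Continuous f) {C : ℝ}
    (hC : ∀ x, |f x| ≤ C) {Y : Ω → Vec d} (hY : Measurable Y) :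
    Integrable (fun ω => f (Y ω)) P :=
  .of_bound (hf.measurable.comp hY).aestronglyMeasurable C (.of_forall fun _ => hC _)

lemma integral_sum_powersetCard_ballRetract (hHs : ∀ j, Measurable (Hs j))
    (hHid : ∀ j, IdentDistrib (Hs j) H P P) (hHind : iIndepFun Hs P) {f : Vec d → ℝ}
    (hf : Continuous f) {C : ℝ} (hC : ∀ x, |f x| ≤ C) (m : ℝ) (n k : ℕ) :
    Integrable (fun ω => ∑ J ∈ Finset.powersetCard k (Finset.range n),
      f (∑ j ∈ J, ballRetract (m⁻¹ • Hs j ω))) P ∧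
    ∫ ω, ∑ J ∈ Finset.powersetCard k (Finset.range n),
      f (∑ j ∈ J, ballRetract (m⁻¹ • Hs j ω)) ∂P =
      n.choose k * ∫ x, f (∑ i, x i) ∂(Measure.pi fun _ : Fin k => retractedLaw P H m) := by
  have hint (J : Finset ℕ) : Integrable (fun ω => f (∑ j ∈ J, ballRetract (m⁻¹ • Hs j ω))) P :=
    integrable_comp_of_bounded hf hC
      (Finset.measurable_fun_sum _ fun j _ => (measurable_ballRetract_smul _).comp (hHs j))
  refine ⟨integrable_finsetSum _ fun J _ => hint J, ?_⟩
  rw [integral_finsetSum _ fun J _ => hint J, Finset.sum_congr rfl fun J hJ =>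
    integral_comp_sum_ballRetract hHs hHid hHind hf m (Finset.mem_powersetCard.1 hJ).2,
    Finset.sum_const, Finset.card_powersetCard, Finset.card_range, nsmul_eq_mul]

lemma abs_integral_rowSum_sub_le (hHs : ∀ j, Measurable (Hs j))
    (hHid : ∀ j, IdentDistrib (Hs j) H P P) (hHind : iIndepFun Hs P)
    (hLs : ∀ j, Measurable (Ls j)) (hLs0 : ∀ j ω, 0 ≤ Ls j ω)
    (hLid : ∀ j, IdentDistrib (Ls j) L P P)
    (hHL : IndepFun (fun ω j => Hs j ω) (fun ω j => Ls j ω) P) (hMpos : ∀ n, 0 < M n)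
    (hfc : Continuous f) (hC : ∀ x, |f x| ≤ C)
    (hf0 : ∀ x, ‖x‖ ≤ (k : ℝ) - 1 + δ → f x = 0) (hδ : 0 ≤ δ) (hη : 0 ≤ η)
    (hηδ : (k + 1) * η ≤ δ / 2) (hε1 : ε ≤ 1) (hεδ : ε ≤ δ) (he : 0 ≤ e)
    (hf : ∀ x y, ‖x‖ ≤ k → ‖y - x‖ ≤ (k + 1) * η → |f y - f x| ≤ e) (n : ℕ) :
    |∫ ω, f ((M n)⁻¹ • rowSum M Hs Ls n ω) ∂P - n.choose k *
      ∫ x, f (∑ i, x i) ∂(Measure.pi fun _ : Fin k => retractedLaw P H (M n))| ≤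
      2 * C * (P.real {ω | η * M n < ‖∑ j ∈ Finset.range n, smallPart (ε * M n) (Hs j ω)‖} +
        n * normTail P H (M n) * P.real {ω | η * M n < L ω}) +
      e * (n * normTail P H (δ / 2 * M n)) ^ k +
      (k + 2) * C * (n * normTail P H (ε * M n)) ^ (k + 1) := by
  have hC0 : 0 ≤ C := (abs_nonneg _).trans (hC 0)
  obtain ⟨hsum, hsum_eq⟩ :=
    integral_sum_powersetCard_ballRetract hHs hHid hHind hfc hC (M n) n k
  have hrow : Integrable (fun ω => f ((M n)⁻¹ • rowSum M Hs Ls n ω)) P :=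
    integrable_comp_of_bounded hfc hC ((measurable_rowSum hHs hLs n).const_smul (M n)⁻¹)
  have hexc := measurableSet_exceptionalEvent hHs hLs n (M n) ε η
  have hint₁ : Integrable (fun ω => 2 * C *
      (exceptionalEvent Hs Ls n (M n) ε η).indicator (1 : Ω → ℝ) ω) P :=
    ((integrable_const 1).indicator hexc).const_mul _
  have hint₂ := (integrable_choose_card_largeIndices (P := P) hHs n k (δ / 2 * M n)).const_mul e
  have hint₃ := (integrable_choose_card_largeIndices (P := P) hHs n (k + 1) (ε * M n)).const_mul
    ((k + 2) * C)
  rw [← hsum_eq, ← integral_sub hrow hsum]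
  rw [← Real.norm_eq_abs]
  refine (norm_integral_le_of_norm_le ((hint₁.add hint₂).add hint₃) (.of_forall ?_)).trans ?_
  · exact abs_sub_sum_powersetCard_ballRetract_le hLs0 (hMpos n) hC hf0 hδ hη hηδ hε1 hεδ he hf n
  rw [integral_add' (hint₁.add hint₂) hint₃, integral_add' hint₁ hint₂, integral_const_mul,
    integral_const_mul, integral_const_mul, integral_indicator_one hexc]
  gcongr
  · exact measureReal_exceptionalEvent_le hHid hLid hHL n _ _ _
  · exact integral_choose_card_largeIndices_le hHs hHid hHind n k _
  · exact integral_choose_card_largeIndices_le hHs hHid hHind n (k + 1) _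

end Expectation

/-! ### Products of vaguely convergent measures -/

section Product

variable {ι : Type*} [Fintype ι]

lemma pi_const_smul {X : Type*} [MeasurableSpace X] (m : Measure X) [SigmaFinite m] {c : ℝ≥0∞}
    (hc : c ≠ ∞) :
    Measure.pi (fun _ : ι => c • m) = c ^ Fintype.card ι • Measure.pi fun _ : ι => m := by
  lift c to NNReal using hc
  have : SigmaFinite ((c : ℝ≥0∞) • m) := SMul.sigmaFinite (μ := m) c
  refine Measure.pi_eq fun s _ => ?_
  simp [Measure.pi_pi, Finset.prod_mul_distrib]

section FiniteMeasure

variable {X : Type*} [MeasurableSpace X]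

lemma finiteMeasure_pi_const_eq_mass_smul [Nonempty X] (m : FiniteMeasure X) :
    FiniteMeasure.pi (fun _ : ι => m) = m.mass ^ Fintype.card ι •
      (ProbabilityMeasure.pi fun _ : ι => m.normalize).toFiniteMeasure := by
  have hm : (m : Measure X) = (m.mass : ℝ≥0∞) • (m.normalize : Measure X) :=
    congrArg FiniteMeasure.toMeasure m.self_eq_mass_smul_normalize
  refine Subtype.ext ?_
  rw [FiniteMeasure.val_eq_toMeasure, FiniteMeasure.toMeasure_pi, hm,
    pi_const_smul _ ENNReal.coe_ne_top, ← ENNReal.coe_pow]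
  rfl

variable [TopologicalSpace X] [SecondCountableTopology X]
  [TopologicalSpace.PseudoMetrizableSpace X] [OpensMeasurableSpace X]

lemma continuous_finiteMeasure_pi_const :
    Continuous fun m : FiniteMeasure X => FiniteMeasure.pi fun _ : ι => m := by
  refine continuous_iff_continuousAt.2 fun m => ?_
  rcases isEmpty_or_nonempty ι with hι | hι
  · exact (continuous_of_const fun m₁ m₂ =>
      congrArg FiniteMeasure.pi (Subsingleton.elim _ _)).continuousAt
  rcases eq_or_ne m 0 with rfl | hm
  · have hmass : ∀ m : FiniteMeasure X,
        (FiniteMeasure.pi fun _ : ι => m).mass = m.mass ^ Fintype.card ι := fun m => by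
      rw [FiniteMeasure.mass_pi, Finset.prod_const, Finset.card_univ]
    have hzero : FiniteMeasure.pi (fun _ : ι => (0 : FiniteMeasure X)) = 0 := by
      rw [← FiniteMeasure.mass_zero_iff, hmass, FiniteMeasure.zero_mass,
        zero_pow Fintype.card_ne_zero]
    rw [ContinuousAt, hzero]
    refine FiniteMeasure.tendsto_zero_of_tendsto_zero_mass ?_
    simp only [hmass]
    have hpow : Tendsto (fun m : FiniteMeasure X => m.mass ^ Fintype.card ι) (𝓝 0)
        (𝓝 ((0 : FiniteMeasure X).mass ^ Fintype.card ι)) :=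
      (FiniteMeasure.continuous_mass.tendsto 0).pow _
    rwa [FiniteMeasure.zero_mass, zero_pow Fintype.card_ne_zero] at hpow
  · have : Nonempty X := not_isEmpty_iff.1 fun _ =>
      hm (Subtype.ext (Measure.eq_zero_of_isEmpty _))
    simp only [finiteMeasure_pi_const_eq_mass_smul]
    have hnormalize : Tendsto (fun m : FiniteMeasure X => m.normalize) (𝓝 m) (𝓝 m.normalize) :=
      FiniteMeasure.tendsto_normalize_of_tendsto tendsto_id hm
    exact ((FiniteMeasure.continuous_mass.tendsto m).pow _).smul
      ((ProbabilityMeasure.toFiniteMeasure_continuous.comp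
        ProbabilityMeasure.continuous_pi).continuousAt.tendsto.comp
          (tendsto_pi_nhds.2 fun _ => hnormalize))

end FiniteMeasure

variable {E : Type*} [NormedAddCommGroup E] [MeasurableSpace E] {p q : ℝ}

/-- The measure `m` with its mass cut off continuously near the origin, by the density that is `0`
on the ball of radius `p` and `1` outside the ball of radius `q`. If `m` is finite outside every
neighbourhood of the origin, this turns it into a finite measure, to which the theory of weak
convergence applies. -/
def cutoffMeasure (m : Measure E) (p q : ℝ) : Measure E :=
  m.withDensity fun x => ENNReal.ofReal (ramp p q ‖x‖)

variable [OpensMeasurableSpace E]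

lemma measurable_ramp_norm (p q : ℝ) : Measurable fun x : E => ramp p q ‖x‖ :=
  (continuous_ramp p q).measurable.comp measurable_norm

lemma isFiniteMeasure_cutoffMeasure {m : Measure E} (hpq : p < q) (hm : m {x | p < ‖x‖} ≠ ∞) :
    IsFiniteMeasure (cutoffMeasure m p q) :=
  isFiniteMeasure_withDensity_ofReal (integrable_ramp measurable_norm hpq hm).hasFiniteIntegral

lemma integral_cutoffMeasure (m : Measure E) (p q : ℝ) (g : E → ℝ) :
    ∫ x, g x ∂(cutoffMeasure m p q) = ∫ x, ramp p q ‖x‖ * g x ∂m := by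
  rw [cutoffMeasure, integral_withDensity_eq_integral_toReal_smul
    (measurable_ramp_norm p q).ennreal_ofReal (.of_forall fun _ => ENNReal.ofReal_lt_top)]
  simp only [ENNReal.toReal_ofReal (ramp_nonneg _ _ _), smul_eq_mul]

lemma restrict_cutoffMeasure (m : Measure E) (hpq : p < q) :
    (cutoffMeasure m p q).restrict {x | q < ‖x‖} = m.restrict {x | q < ‖x‖} := by
  have hmeas : MeasurableSet {x : E | q < ‖x‖} := measurableSet_lt measurable_const measurable_norm
  have hone : (fun x : E => ENNReal.ofReal (ramp p q ‖x‖)) =ᵐ[m.restrict {x | q < ‖x‖}] 1 := by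
    filter_upwards [ae_restrict_mem hmeas] with x hx
    rw [ramp_eq_one hpq (le_of_lt hx), ENNReal.ofReal_one, Pi.one_apply]
  rw [cutoffMeasure, restrict_withDensity hmeas, withDensity_congr_ae hone, withDensity_one]

lemma integral_pi_eq_integral_pi_restrict {X : Type*} [MeasurableSpace X] {m : Measure X}
    [SigmaFinite m] {s t : Set X} (hm : ∀ᵐ x ∂m, x ∈ t) {F : (ι → X) → ℝ}
    (hF : ∀ x : ι → X, (∀ i, x i ∈ t) → (∃ i, x i ∉ s) → F x = 0) :
    ∫ x, F x ∂(Measure.pi fun _ => m) = ∫ x, F x ∂(Measure.pi fun _ => m.restrict s) := by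
  rw [← Measure.restrict_pi_pi]
  refine (setIntegral_eq_integral_of_ae_compl_eq_zero ?_).symm
  have hall : ∀ᵐ x ∂(Measure.pi fun _ : ι => m), ∀ i, x i ∈ t := eventually_all.2 fun i =>
    (Measure.tendsto_eval_ae_ae (μ := fun _ : ι => m) (i := i)).eventually hm
  filter_upwards [hall] with x hx hxs
  exact hF x hx (by simpa only [Set.mem_univ_pi, not_forall] using hxs)

lemma integral_pi_cutoffMeasure {m : Measure E} [SigmaFinite m] (hpq : p < q)
    (hfin : m {x | p < ‖x‖} ≠ ∞) {t : Set E} (hm : ∀ᵐ x ∂m, x ∈ t) {F : (ι → E) → ℝ}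
    (hF : ∀ x : ι → E, (∀ i, x i ∈ t) → (∃ i, ‖x i‖ ≤ q) → F x = 0) :
    ∫ x, F x ∂(Measure.pi fun _ => cutoffMeasure m p q) = ∫ x, F x ∂(Measure.pi fun _ => m) := by
  have := isFiniteMeasure_cutoffMeasure hpq hfin
  have hF' : ∀ x : ι → E, (∀ i, x i ∈ t) → (∃ i, x i ∉ {y | q < ‖y‖}) → F x = 0 := by
    simpa only [Set.mem_ofPred_eq, not_lt] using hF
  rw [integral_pi_eq_integral_pi_restrict (m := m) hm hF', integral_pi_eq_integral_pi_restrict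
    (m := cutoffMeasure m p q) ((withDensity_absolutelyContinuous m _).ae_le hm) hF',
    restrict_cutoffMeasure m hpq]

variable [SecondCountableTopology E] {m : ℕ → Measure E} {ν : Measure E} [SigmaFinite ν]
  {t : Set E} {F : (ι → E) → ℝ} {C : ℝ}

lemma tendsto_integral_pi [∀ n, IsFiniteMeasure (m n)] (hpq : p < q)
    (hm : ∀ n, ∀ᵐ x ∂(m n), x ∈ t) (hν : ∀ᵐ x ∂ν, x ∈ t) (hνfin : ν {x | p < ‖x‖} ≠ ∞)
    (hconv : ∀ g : E → ℝ, Continuous g → (∀ x, ‖x‖ ≤ p → g x = 0) →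
      Tendsto (fun n => ∫ x, g x ∂(m n)) atTop (𝓝 (∫ x, g x ∂ν)))
    (hF : Continuous F) (hC : ∀ x, |F x| ≤ C)
    (hF0 : ∀ x : ι → E, (∀ i, x i ∈ t) → (∃ i, ‖x i‖ ≤ q) → F x = 0) :
    Tendsto (fun n => ∫ x, F x ∂(Measure.pi fun _ => m n)) atTop
      (𝓝 (∫ x, F x ∂(Measure.pi fun _ => ν))) := by
  let ρs : ℕ → FiniteMeasure E := fun n =>
    ⟨cutoffMeasure (m n) p q, isFiniteMeasure_cutoffMeasure hpq (measure_ne_top _ _)⟩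
  let ρ : FiniteMeasure E := ⟨cutoffMeasure ν p q, isFiniteMeasure_cutoffMeasure hpq hνfin⟩
  have hρ : Tendsto ρs atTop (𝓝 ρ) := by
    refine FiniteMeasure.tendsto_iff_forall_integral_tendsto.2 fun g => ?_
    simp only [ρs, ρ, FiniteMeasure.toMeasure_mk, integral_cutoffMeasure]
    exact hconv _ (((continuous_ramp _ _).comp continuous_norm).mul g.continuous)
      fun x hx => by rw [ramp_eq_zero hpq hx, zero_mul]
  have hpi : Tendsto (fun n => ∫ x, F x ∂(Measure.pi fun _ => cutoffMeasure (m n) p q)) atTop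
      (𝓝 (∫ x, F x ∂(Measure.pi fun _ => cutoffMeasure ν p q))) :=
    FiniteMeasure.tendsto_iff_forall_integral_tendsto.1
      ((continuous_finiteMeasure_pi_const.tendsto ρ).comp hρ)
      (BoundedContinuousFunction.ofNormedAddCommGroup F hF C hC)
  rw [integral_pi_cutoffMeasure hpq hνfin hν hF0] at hpi
  exact hpi.congr fun n => integral_pi_cutoffMeasure hpq (measure_ne_top _ _) (hm n) hF0

lemma tendsto_integral_pi_div_pow [∀ n, IsFiniteMeasure (m n)] {u : ℕ → ℝ} (hu : ∀ n, 0 ≤ u n)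
    (hpq : p < q) (hm : ∀ n, ∀ᵐ x ∂(m n), x ∈ t) (hν : ∀ᵐ x ∂ν, x ∈ t)
    (hνfin : ν {x | p < ‖x‖} ≠ ∞)
    (hconv : ∀ g : E → ℝ, Continuous g → (∀ x, ‖x‖ ≤ p → g x = 0) →
      Tendsto (fun n => (∫ x, g x ∂(m n)) / u n) atTop (𝓝 (∫ x, g x ∂ν)))
    (hF : Continuous F) (hC : ∀ x, |F x| ≤ C)
    (hF0 : ∀ x : ι → E, (∀ i, x i ∈ t) → (∃ i, ‖x i‖ ≤ q) → F x = 0) :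
    Tendsto (fun n => (∫ x, F x ∂(Measure.pi fun _ => m n)) / u n ^ Fintype.card ι) atTop
      (𝓝 (∫ x, F x ∂(Measure.pi fun _ => ν))) := by
  have : ∀ n, IsFiniteMeasure (ENNReal.ofReal (u n)⁻¹ • m n) := fun n =>
    Measure.smul_finite _ ENNReal.ofReal_ne_top
  have hscaled : ∀ n, (ENNReal.ofReal (u n)⁻¹).toReal = (u n)⁻¹ := fun n =>
    ENNReal.toReal_ofReal (inv_nonneg.2 (hu n))
  refine (tendsto_integral_pi (m := fun n => ENNReal.ofReal (u n)⁻¹ • m n) hpq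
    (fun n => Measure.ae_smul_measure (hm n) _) hν hνfin (fun g hg hg0 => ?_) hF hC hF0).congr
    fun n => ?_
  · simpa only [integral_smul_measure, hscaled, smul_eq_mul, div_eq_inv_mul] using hconv g hg hg0
  · rw [pi_const_smul _ ENNReal.ofReal_ne_top, integral_smul_measure, ENNReal.toReal_pow, hscaled,
      inv_pow, smul_eq_mul, div_eq_inv_mul]

end Product

/-! ### The limit measures -/

section TailContinuity

variable {α : Type*} [MeasurableSpace α] {m : Measure α} {f : α → ℝ} {x₀ x : ℝ}

lemma tendsto_measure_setOf_lt_nhdsLT (hf : Measurable f) (hx₀ : x₀ < x)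
    (h : m {y | x₀ < f y} ≠ ∞) :
    Tendsto (fun z => m {y | z < f y}) (𝓝[<] x) (𝓝 (m {y | x ≤ f y})) := by
  have hlim : Tendsto (fun z => m {y | z < f y}) (𝓝[<] x) (𝓝 (m (⋂ z < x, {y | z < f y}))) :=
    tendsto_measure_biInter_gt (ι := ℝᵒᵈ) (a := OrderDual.toDual x)
      (s := fun z => {y | OrderDual.ofDual z < f y})
      (fun _ _ => (measurableSet_lt measurable_const hf).nullMeasurableSet)
      (fun i j _ (hij : j.ofDual ≤ i.ofDual) _ (hy : i.ofDual < _) => hij.trans_lt hy) ⟨x₀, hx₀, h⟩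
  convert hlim using 3
  ext y
  simp only [Set.mem_iInter, Set.mem_ofPred_eq]
  exact ⟨fun h z hz => hz.trans_le h, fun h => le_of_forall_lt h⟩

lemma exists_measureReal_setOf_lt_lt (hf : Measurable f) (hx₀ : x₀ < x)
    (h : ∀ z, x₀ < z → m {y | z < f y} ≠ ∞) (hnull : m {y | f y = x} = 0) {b : ℝ}
    (hb : m.real {y | x < f y} < b) : ∃ z, x₀ < z ∧ z < x ∧ m.real {y | z < f y} < b := by
  obtain ⟨x₁, hx₁, hx₁x⟩ := exists_between hx₀
  have heq : m {y | x ≤ f y} = m {y | x < f y} := by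
    refine measure_congr ?_
    filter_upwards [measure_eq_zero_iff_ae_notMem.1 hnull] with y hy
    exact propext (Ne.le_iff_lt (Ne.symm hy))
  have hlim := tendsto_measure_setOf_lt_nhdsLT hf hx₁x (h x₁ hx₁)
  rw [heq] at hlim
  have hlt := ((ENNReal.tendsto_toReal (h x hx₀)).comp hlim).eventually_lt_const hb
  obtain ⟨z, hz, hx₀z, hzx⟩ := (hlt.and (Ioo_mem_nhdsLT hx₀)).exists
  exact ⟨z, hx₀z, hzx, hz⟩

lemma measure_setOf_eq_eq_zero_of_continuousAt (hf : Measurable f) (hx₀ : x₀ < x)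
    (h : m {y | x₀ < f y} ≠ ∞) (hcont : ContinuousAt (fun z => m.real {y | z < f y}) x) :
    m {y | f y = x} = 0 := by
  have hle_ne : m {y | x ≤ f y} ≠ ∞ := measure_ne_top_of_subset (fun _ hy => hx₀.trans_le hy) h
  have hsub : {y | x < f y} ⊆ {y | x ≤ f y} := fun _ (hy : x < _) => hy.le
  have heq : m.real {y | x ≤ f y} = m.real {y | x < f y} := tendsto_nhds_unique
    ((ENNReal.tendsto_toReal hle_ne).comp (tendsto_measure_setOf_lt_nhdsLT hf hx₀ h))
    (hcont.tendsto.mono_left nhdsWithin_le_nhds)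
  have hdiff : {y | f y = x} = {y | x ≤ f y} \ {y | x < f y} := by
    ext y
    simp only [Set.mem_ofPred_eq, Set.mem_sdiff, not_lt]
    exact ⟨fun h => ⟨h.ge, h.le⟩, fun h => h.2.antisymm h.1⟩
  have hreal : m.real {y | f y = x} = 0 := by
    rw [hdiff, measureReal_sdiff hsub (measurableSet_lt measurable_const hf) hle_ne, heq, sub_self]
  exact (measureReal_eq_zero_iff
    (measure_ne_top_of_subset (fun _ hy => ge_of_eq hy) hle_ne)).1 hreal

end TailContinuity

section ConvolutionPower

variable {ι E : Type*} [Fintype ι] [NormedAddCommGroup E]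

lemma card_mul_norm_sub_le_norm_sum [NormedSpace ℝ E] {x : E} {ρ : ℝ} {y : ι → E}
    (hy : ∀ i, ‖y i - x‖ ≤ ρ) :
    Fintype.card ι * (‖x‖ - ρ) ≤ ‖∑ i, y i‖ := by
  have hsum : ‖∑ i, (y i - x)‖ ≤ Fintype.card ι * ρ := norm_sum_le_card_mul fun i _ => hy i
  rw [Finset.sum_sub_distrib, Finset.sum_const, Finset.card_univ, norm_sub_rev] at hsum
  have hnorm := norm_sub_norm_le (Fintype.card ι • x) (∑ i, y i)
  rw [RCLike.norm_nsmul ℝ, nsmul_eq_mul] at hnorm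
  linarith

variable [MeasurableSpace E] {m : Measure E}

lemma sigmaFinite_of_measure_setOf_lt_norm_ne_top (h0 : m {0} ≠ ∞)
    (h : ∀ x : ℝ, 0 < x → m {y | x < ‖y‖} ≠ ∞) : SigmaFinite m := by
  refine Measure.sigmaFinite_of_countable
    (S := insert {0} (Set.range fun n : ℕ => {y : E | 0 + 1 / ((n : ℝ) + 1) < ‖y‖}))
    ((Set.countable_range _).insert _) ?_ ?_
  · rintro s (rfl | ⟨n, rfl⟩)
    · exact h0.lt_top
    · exact (h _ (by positivity)).lt_top
  · rw [Set.sUnion_insert, Set.sUnion_range, iUnion_setOf_add_one_div_lt, Set.eq_univ_iff_forall]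
    exact fun y => (eq_or_ne y 0).imp id norm_pos_iff.2

lemma measure_pi_setOf_lt_norm_sum_ne_top [SigmaFinite m] (hm : ∀ᵐ x ∂m, ‖x‖ ≤ 1) {δ : ℝ}
    (hδ : m {x | δ < ‖x‖} ≠ ∞) :
    Measure.pi (fun _ : ι => m) {x | Fintype.card ι - 1 + δ < ‖∑ i, x i‖} ≠ ∞ := by
  have hbox : Measure.pi (fun _ : ι => m) (Set.univ.pi fun _ => {x | δ < ‖x‖}) ≠ ∞ := by
    rw [Measure.pi_pi]
    exact ENNReal.prod_ne_top fun _ _ => hδ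
  have hball : ∀ᵐ x ∂(Measure.pi fun _ : ι => m), ∀ i, ‖x i‖ ≤ 1 := eventually_all.2 fun i =>
    (Measure.tendsto_eval_ae_ae (μ := fun _ : ι => m) (i := i)).eventually hm
  refine ne_top_of_le_ne_top hbox (measure_mono_ae ?_)
  filter_upwards [hball] with x hx hlt i _
  by_contra hi
  exact (not_le.2 hlt) (norm_sum_le_card_sub_one_add (fun j _ => hx j) (Finset.mem_univ i)
    (not_lt.1 hi))

variable [NormedSpace ℝ E] [SecondCountableTopology E]

lemma measure_pi_setOf_lt_norm_sum_ne_zero [Nonempty ι] [SigmaFinite m] {s : ℝ}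
    (hs : m {x | s < ‖x‖} ≠ 0) :
    Measure.pi (fun _ : ι => m) {x | Fintype.card ι * s < ‖∑ i, x i‖} ≠ 0 := by
  obtain ⟨x, hsx : s < ‖x‖, hx⟩ := exists_mem_forall_mem_nhdsWithin_pos_measure hs
  have hball : 0 < m (Metric.ball x ((‖x‖ - s) / 2)) :=
    hx _ (mem_nhdsWithin_of_mem_nhds (Metric.ball_mem_nhds x (half_pos (sub_pos.2 hsx))))
  have hbox : Measure.pi (fun _ : ι => m)
      (Set.univ.pi fun _ => Metric.ball x ((‖x‖ - s) / 2)) ≠ 0 := by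
    rw [Measure.pi_pi]
    exact Finset.prod_ne_zero_iff.2 fun _ _ => hball.ne'
  refine fun h0 => hbox (measure_mono_null (fun y hy => ?_) h0)
  refine lt_of_lt_of_le ?_ (card_mul_norm_sub_le_norm_sum fun i =>
    (mem_ball_iff_norm.1 (hy i trivial)).le)
  exact mul_lt_mul_of_pos_left (by linarith) (Nat.cast_pos.2 Fintype.card_pos)

end ConvolutionPower

section LimitMeasures

variable {d k : ℕ} {μ : Measure (Vec d)} {κ α : ℝ}

lemma map_ballRetract_restrict_closedBall (μ : Measure (Vec d)) :
    (μ.restrict (Metric.closedBall 0 1)).map ballRetract =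
      μ.restrict (Metric.closedBall 0 1) := by
  rw [Measure.map_congr (g := id), Measure.map_id]
  filter_upwards [ae_restrict_mem Metric.isClosed_closedBall.measurableSet] with x hx
  exact ballRetract_of_norm_le_one (mem_closedBall_zero_iff.1 hx)

lemma restrict_spectralMeasure_sphere (μ : Measure (Vec d)) :
    (spectralMeasure μ).restrict (Metric.sphere 0 1) = spectralMeasure μ := by
  rw [spectralMeasure, Measure.restrict_smul]
  congr 1
  refine Measure.restrict_eq_self_of_ae_mem ?_
  refine (ae_map_iff (p := fun x => x ∈ Metric.sphere (0 : Vec d) 1)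
    (Measurable.aemeasurable (by fun_prop)) Metric.isClosed_sphere.measurableSet).2 ?_
  filter_upwards [ae_restrict_mem (measurableSet_le measurable_const measurable_norm)] with x hx
  have hnorm : ‖x‖ ≠ 0 := (one_pos.trans_le hx).ne'
  rw [mem_sphere_zero_iff_norm, norm_smul, norm_inv, norm_norm, inv_mul_cancel₀ hnorm]

lemma spectralMeasure_eq_smul_map_ballRetract (hsphere : μ {x | ‖x‖ = 1} = 0) :
    spectralMeasure μ = (μ (Metric.closedBall 0 1)ᶜ)⁻¹ •
      (μ.restrict (Metric.closedBall 0 1)ᶜ).map ballRetract := by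
  have hset : {x : Vec d | 1 ≤ ‖x‖} =ᵐ[μ] ((Metric.closedBall 0 1)ᶜ : Set (Vec d)) := by
    filter_upwards [measure_eq_zero_iff_ae_notMem.1 hsphere] with x hx
    refine propext (Iff.trans ?_ (not_congr mem_closedBall_zero_iff).symm)
    exact ⟨fun h : 1 ≤ ‖x‖ => not_le.2 (lt_of_le_of_ne h (Ne.symm hx)), fun h => (not_le.1 h).le⟩
  rw [spectralMeasure, ← Measure.restrict_congr_set hset]
  congr 1
  refine Measure.map_congr ?_
  filter_upwards [ae_restrict_mem (measurableSet_le measurable_const measurable_norm)] with x hx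
  exact (ballRetract_of_one_le_norm hx).symm

lemma nu_eq_smul_map_ballRetract (hsphere : μ {x | ‖x‖ = 1} = 0) :
    nu μ = (μ (Metric.closedBall 0 1)ᶜ)⁻¹ • μ.map ballRetract := by
  rw [nu, restrict_spectralMeasure_sphere, spectralMeasure_eq_smul_map_ballRetract hsphere,
    ← map_ballRetract_restrict_closedBall, ← smul_add,
    ← Measure.map_add _ _ continuous_ballRetract.measurable,
    Measure.restrict_add_restrict_compl Metric.isClosed_closedBall.measurableSet]

section PowerTail

variable (hκ : 0 < κ) (hG : ∀ x, 0 < x → μ.real {y | x < ‖y‖} = κ * x ^ (-α))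

include hκ hG

lemma measure_setOf_lt_norm_eq_ofReal {x : ℝ} (hx : 0 < x) :
    μ {y | x < ‖y‖} = ENNReal.ofReal (κ * x ^ (-α)) := by
  have hpos : 0 < κ * x ^ (-α) := by positivity
  have htop : μ {y | x < ‖y‖} ≠ ∞ := fun htop => by
    rw [← hG x hx, measureReal_def, htop] at hpos
    exact hpos.false
  rw [← hG x hx, ofReal_measureReal htop]

lemma nu_eq_ofReal_smul_map_ballRetract : nu μ = ENNReal.ofReal κ⁻¹ • μ.map ballRetract := by
  have hcont : ContinuousAt (fun z : ℝ => μ.real {y | z < ‖y‖}) 1 := by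
    refine ContinuousAt.congr (f := fun z => κ * z ^ (-α))
      ((Real.continuousAt_rpow_const _ _ (.inl one_ne_zero)).const_mul κ) ?_
    filter_upwards [lt_mem_nhds one_pos] with z hz using (hG z hz).symm
  have hsphere : μ {x | ‖x‖ = 1} = 0 := measure_setOf_eq_eq_zero_of_continuousAt measurable_norm
    (x₀ := 1 / 2) (by norm_num)
    (by simp [measure_setOf_lt_norm_eq_ofReal hκ hG]) hcont
  have hset : (Metric.closedBall (0 : Vec d) 1)ᶜ = {y | 1 < ‖y‖} := by
    ext y
    rw [Set.mem_compl_iff, mem_closedBall_zero_iff, not_le, Set.mem_ofPred_eq]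
  rw [nu_eq_smul_map_ballRetract hsphere, hset, measure_setOf_lt_norm_eq_ofReal hκ hG one_pos,
    Real.one_rpow, mul_one, ENNReal.ofReal_inv_of_pos hκ]

lemma integral_nu {g : Vec d → ℝ} (hg : Continuous g) :
    ∫ x, g x ∂(nu μ) = κ⁻¹ * ∫ x, g (ballRetract x) ∂μ := by
  rw [nu_eq_ofReal_smul_map_ballRetract hκ hG, integral_smul_measure,
    integral_map continuous_ballRetract.aemeasurable hg.aestronglyMeasurable,
    ENNReal.toReal_ofReal (inv_pos.2 hκ).le, smul_eq_mul]

lemma ae_nu_norm_le_one : ∀ᵐ x ∂(nu μ), ‖x‖ ≤ 1 := by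
  rw [nu_eq_ofReal_smul_map_ballRetract hκ hG]
  refine Measure.ae_smul_measure ?_ _
  exact (ae_map_iff continuous_ballRetract.aemeasurable (measurableSet_norm_le measurable_id 1)).2
    (.of_forall norm_ballRetract_le_one)

lemma nu_setOf_lt_norm {s : ℝ} (hs : 0 < s) (hs1 : s < 1) :
    nu μ {x | s < ‖x‖} = ENNReal.ofReal (s ^ (-α)) := by
  have hpre : ballRetract ⁻¹' {x : Vec d | s < ‖x‖} = {x | s < ‖x‖} := by
    ext x
    simp only [Set.mem_preimage, Set.mem_ofPred_eq, norm_ballRetract, lt_min_iff, hs1, and_true]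
  rw [nu_eq_ofReal_smul_map_ballRetract hκ hG, Measure.smul_apply,
    Measure.map_apply continuous_ballRetract.measurable
      (measurableSet_lt measurable_const measurable_norm),
    hpre, measure_setOf_lt_norm_eq_ofReal hκ hG hs, smul_eq_mul,
    ← ENNReal.ofReal_mul (inv_pos.2 hκ).le, inv_mul_cancel_left₀ hκ.ne']

lemma nu_setOf_lt_norm_ne_top {s : ℝ} (hs : 0 < s) : nu μ {x | s < ‖x‖} ≠ ∞ := by
  have hmin : nu μ {x | min s (1 / 2) < ‖x‖} ≠ ∞ := by
    rw [nu_setOf_lt_norm hκ hG (lt_min hs one_half_pos)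
      ((min_le_right _ _).trans_lt one_half_lt_one)]
    exact ENNReal.ofReal_ne_top
  exact measure_ne_top_of_subset (fun x hx => (min_le_left s (1 / 2)).trans_lt hx) hmin

lemma sigmaFinite_nu (hμ0 : μ {0} = 0) : SigmaFinite (nu μ) := by
  refine sigmaFinite_of_measure_setOf_lt_norm_ne_top ?_
    fun x hx => nu_setOf_lt_norm_ne_top hκ hG hx
  have hpre : ballRetract ⁻¹' {(0 : Vec d)} = {0} := by
    ext x
    rw [Set.mem_preimage, Set.mem_singleton_iff, Set.mem_singleton_iff, ballRetract, smul_eq_zero,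
      or_iff_right (by positivity)]
  rw [nu_eq_ofReal_smul_map_ballRetract hκ hG, Measure.smul_apply,
    Measure.map_apply continuous_ballRetract.measurable (measurableSet_singleton 0), hpre, hμ0,
    smul_zero]
  exact ENNReal.zero_ne_top

lemma nuConv_setOf_lt_norm_ne_top (hμ0 : μ {0} = 0) {r : ℝ} (hr : k - 1 < r) :
    nuConv μ k {x | r < ‖x‖} ≠ ∞ := by
  have := sigmaFinite_nu hκ hG hμ0
  have hpi := measure_pi_setOf_lt_norm_sum_ne_top (ι := Fin k) (ae_nu_norm_le_one hκ hG)
    (nu_setOf_lt_norm_ne_top hκ hG (sub_pos.2 hr))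
  rw [Fintype.card_fin, add_sub_cancel] at hpi
  rwa [nuConv, Measure.map_apply (by fun_prop) (measurableSet_lt measurable_const measurable_norm)]

lemma nuConv_setOf_lt_norm_ne_zero (hμ0 : μ {0} = 0) (hk : 1 ≤ k) {r : ℝ} (hr : r < k) :
    nuConv μ k {x | r < ‖x‖} ≠ 0 := by
  have := sigmaFinite_nu hκ hG hμ0
  have : Nonempty (Fin k) := ⟨⟨0, hk⟩⟩
  have hk0 : (0 : ℝ) < k := mod_cast hk
  obtain ⟨s, hs, hs1⟩ := exists_between (max_lt one_pos ((div_lt_one hk0).2 hr))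
  have hnu : nu μ {x | s < ‖x‖} ≠ 0 := by
    rw [nu_setOf_lt_norm hκ hG ((le_max_left _ _).trans_lt hs) hs1]
    exact (ENNReal.ofReal_pos.2 (Real.rpow_pos_of_pos ((le_max_left _ _).trans_lt hs) _)).ne'
  have hpi := measure_pi_setOf_lt_norm_sum_ne_zero (ι := Fin k) hnu
  rw [Fintype.card_fin] at hpi
  rw [nuConv, Measure.map_apply (by fun_prop) (measurableSet_lt measurable_const measurable_norm)]
  refine fun h0 => hpi (measure_mono_null (fun x (hx : k * s < _) => lt_trans ?_ hx) h0)
  exact (div_lt_iff₀' hk0).1 ((le_max_right _ _).trans_lt hs)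

lemma countable_nuConv_sphere_ne_zero (hμ0 : μ {0} = 0) :
    {r : ℝ | nuConv μ k {x | ‖x‖ = r} ≠ 0}.Countable := by
  have := sigmaFinite_nu hκ hG hμ0
  have : SFinite (nuConv μ k) := by
    rw [nuConv]
    infer_instance
  exact (Measure.countable_meas_level_set_pos (μ := nuConv μ k) measurable_norm).mono
    fun r hr => pos_iff_ne_zero.2 hr

end PowerTail

lemma integral_nuConv {f : Vec d → ℝ} (hf : Continuous f) :
    ∫ x, f x ∂(nuConv μ k) = ∫ x, f (∑ i, x i) ∂(Measure.pi fun _ : Fin k => nu μ) := by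
  rw [nuConv, integral_map (Measurable.aemeasurable (by fun_prop)) hf.aestronglyMeasurable]

end LimitMeasures

/-! ### The row sums as sums of `k` large jumps -/

section RowSumLimit

variable {Ω : Type*} [MeasurableSpace Ω] {P : Measure Ω} {d : ℕ} {H : Ω → Vec d} {L : Ω → ℝ}
  {M : ℕ → ℝ} {α c : ℝ} {k : ℕ}

lemma exists_pos_forall_abs_sub_le {E : Type*} [SeminormedAddCommGroup E] [ProperSpace E]
    {f : E → ℝ} (hf : Continuous f) (r : ℝ) {e : ℝ} (he : 0 < e) :
    ∃ ρ, 0 < ρ ∧ ∀ x y, ‖x‖ ≤ r → ‖y - x‖ ≤ ρ → |f y - f x| ≤ e := by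
  have hunif := (isCompact_closedBall (0 : E) r).uniformContinuousAt_of_continuousAt f
    (fun _ _ => hf.continuousAt) (Metric.dist_mem_uniformity he)
  obtain ⟨ρ, hρ, hρf⟩ := Metric.mem_uniformity_dist.1 hunif
  refine ⟨ρ / 2, half_pos hρ, fun x y hx hy => ?_⟩
  have hdist : dist x y < ρ := (dist_eq_norm_sub' x y).trans_lt (hy.trans_lt (half_lt_self hρ))
  rw [← Real.dist_eq, dist_comm]
  exact (hρf hdist (mem_closedBall_zero_iff.2 hx)).le

section Normalization

variable (hα : IsTailIndex P H α) (hpos : ∀ x, 0 < normTail P H x) (hM : Tendsto M atTop atTop)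

include hα hpos hM

lemma eventually_mul_normTail_pow_le (hc : 0 < c) {D : ℝ}
    (hD : (c ^ (-α)) ^ k < D) :
    ∀ᶠ n : ℕ in atTop, (n * normTail P H (c * M n)) ^ k ≤ D * (n * normTail P H (M n)) ^ k := by
  filter_upwards [(((hα.2 c hc).comp hM).pow k).eventually_le_const hD] with n hn
  rw [Function.comp_apply, div_pow, div_le_iff₀ (pow_pos (hpos _) k)] at hn
  rw [mul_pow, mul_pow, mul_left_comm]
  gcongr

lemma isBigO_normTail_mul (hc : 0 < c) :
    (fun n => normTail P H (c * M n)) =O[atTop] fun n => normTail P H (M n) :=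
  isBigO_of_div_tendsto_nhds (.of_forall fun _ h0 => absurd h0 (hpos _).ne') _
    ((hα.2 c hc).comp hM)

lemma isLittleO_mul_measureReal_lt (hk : 1 ≤ k)
    (hLtail : (fun x => P.real {ω | x < L ω}) =o[atTop] fun x => normTail P H x ^ (k - 1))
    (hc : 0 < c) :
    (fun n : ℕ => n * normTail P H (M n) * P.real {ω | c * M n < L ω}) =o[atTop]
      fun n : ℕ => (n * normTail P H (M n)) ^ k := by
  have hle : (fun n : ℕ => normTail P H (M n)) =O[atTop] fun n : ℕ => n * normTail P H (M n) := by
    refine IsBigO.of_bound 1 ?_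
    filter_upwards [eventually_ge_atTop 1] with n hn
    rw [one_mul, norm_mul, RCLike.norm_natCast]
    exact le_mul_of_one_le_left (norm_nonneg _) (Nat.one_le_cast.2 hn)
  have hexcess : (fun n => P.real {ω | c * M n < L ω}) =o[atTop]
      fun n : ℕ => (n * normTail P H (M n)) ^ (k - 1) :=
    (hLtail.comp_tendsto (hM.const_mul_atTop hc)).trans_isBigO
      (((isBigO_normTail_mul hα hpos hM hc).trans hle).pow (k - 1))
  refine ((isBigO_refl (fun n : ℕ => n * normTail P H (M n)) atTop).mul_isLittleO
    hexcess).congr_right fun n => ?_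
  rw [← pow_succ', Nat.sub_add_cancel hk]

lemma isLittleO_mul_normTail_pow_succ
    (hsoft : Tendsto (fun n : ℕ => n * normTail P H (M n)) atTop (𝓝 0)) (k : ℕ) (hc : 0 < c) :
    (fun n : ℕ => (n * normTail P H (c * M n)) ^ (k + 1)) =o[atTop]
      fun n : ℕ => (n * normTail P H (M n)) ^ k := by
  refine (((isBigO_refl (fun n : ℕ => (n : ℝ)) atTop).mul
    (isBigO_normTail_mul hα hpos hM hc)).pow (k + 1)).trans_isLittleO ?_
  simpa only [pow_succ, mul_one] using
    (isBigO_refl (fun n : ℕ => (n * normTail P H (M n)) ^ k) atTop).mul_isLittleO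
      ((isLittleO_one_iff ℝ).2 hsoft)

end Normalization

variable {Hs : ℕ → Ω → Vec d} {Ls : ℕ → Ω → ℝ} {f : Vec d → ℝ} {C δ : ℝ}

lemma isLittleO_integral_rowSum_sub (hα : IsTailIndex P H α) (hpos : ∀ x, 0 < normTail P H x)
    (hHs : ∀ j, Measurable (Hs j)) (hHid : ∀ j, IdentDistrib (Hs j) H P P)
    (hHind : iIndepFun Hs P) (hLs : ∀ j, Measurable (Ls j)) (hLs0 : ∀ j ω, 0 ≤ Ls j ω)
    (hLid : ∀ j, IdentDistrib (Ls j) L P P)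
    (hHL : IndepFun (fun ω j => Hs j ω) (fun ω j => Ls j ω) P)
    (hMpos : ∀ n, 0 < M n) (hM : Tendsto M atTop atTop)
    (hsoft : Tendsto (fun n : ℕ => n * normTail P H (M n)) atTop (𝓝 0)) (hk : 1 ≤ k)
    (hLtail : (fun x => P.real {ω | x < L ω}) =o[atTop] fun x => normTail P H x ^ (k - 1))
    (hsmall : SmallJumpsNegligible P Hs M fun n => (n * normTail P H (M n)) ^ k)
    (hf : Continuous f) (hC : ∀ x, |f x| ≤ C) (hf0 : ∀ x, ‖x‖ ≤ (k : ℝ) - 1 + δ → f x = 0)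
    (hδ : 0 < δ) :
    (fun n : ℕ => ∫ ω, f ((M n)⁻¹ • rowSum M Hs Ls n ω) ∂P - n.choose k *
      ∫ x, f (∑ i, x i) ∂(Measure.pi fun _ : Fin k => retractedLaw P H (M n))) =o[atTop]
      fun n : ℕ => (n * normTail P H (M n)) ^ k := by
  have := hHind.isProbabilityMeasure
  refine isLittleO_iff.2 fun c hc => ?_
  set D : ℝ := ((δ / 2) ^ (-α)) ^ k + 1
  have hD : 0 < D := by positivity
  obtain ⟨ρ, hρ, hfρ⟩ := exists_pos_forall_abs_sub_le hf k (e := c / 2 / D) (by positivity)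
  have hk1 : (0 : ℝ) < k + 1 := by positivity
  set η : ℝ := min (δ / 2) ρ / (k + 1)
  have hη : 0 < η := by positivity
  have hkη : (k + 1) * η = min (δ / 2) ρ := mul_div_cancel₀ _ hk1.ne'
  obtain ⟨ε₀, hε₀, hs⟩ := hsmall η hη
  set ε : ℝ := min ε₀ (min 1 δ)
  have hε : 0 < ε := by positivity
  have hrem := (((hs ε hε (min_le_left _ _)).add
    (isLittleO_mul_measureReal_lt hα hpos hM hk hLtail hη)).const_mul_left (2 * C)).add
    ((isLittleO_mul_normTail_pow_succ hα hpos hM hsoft k hε).const_mul_left ((k + 2) * C))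
  filter_upwards [isLittleO_iff.1 hrem (half_pos hc),
    eventually_mul_normTail_pow_le hα hpos hM (half_pos hδ) (lt_add_one _)] with n hrem_le hpow_le
  have hbound := abs_integral_rowSum_sub_le hHs hHid hHind hLs hLs0 hLid hHL hMpos hf hC hf0 hδ.le
    hη.le (hkη.trans_le (min_le_left _ _)) ((min_le_right ε₀ _).trans (min_le_left _ _))
    ((min_le_right ε₀ _).trans (min_le_right _ _)) (e := c / 2 / D) (by positivity)
    (fun x y hx hy => hfρ x y hx (hy.trans (hkη.trans_le (min_le_right _ _)))) n
  have hosc : c / 2 / D * (n * normTail P H (δ / 2 * M n)) ^ k ≤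
      c / 2 * (n * normTail P H (M n)) ^ k := by
    calc _ ≤ c / 2 / D * (D * (n * normTail P H (M n)) ^ k) := by gcongr
      _ = _ := by rw [← mul_assoc, div_mul_cancel₀ _ hD.ne']
  rw [Real.norm_of_nonneg (pow_nonneg (mul_nonneg n.cast_nonneg (hpos _).le) k)] at hrem_le ⊢
  rw [Real.norm_eq_abs]
  linarith [(le_abs_self _).trans hrem_le]

lemma tendsto_choose_div_pow (k : ℕ) :
    Tendsto (fun n : ℕ => (n.choose k : ℝ) / (n : ℝ) ^ k) atTop (𝓝 ((k.factorial : ℝ)⁻¹)) := by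
  have hone : Tendsto (fun n : ℕ => (n : ℝ) * (n : ℝ)⁻¹) atTop (𝓝 1) := by
    refine tendsto_const_nhds.congr' ?_
    filter_upwards [eventually_ne_atTop 0] with n hn
    rw [mul_inv_cancel₀ (Nat.cast_ne_zero.2 hn)]
  simpa only [one_pow, one_div, inv_pow, ← div_eq_mul_inv] using
    tendsto_choose_mul_pow_atTop k hone

variable {μ : Measure (Vec d)} {a : ℕ → ℝ} {κ : ℝ}

lemma tendsto_integral_pi_retractedLaw_div [IsProbabilityMeasure P] (hH : Measurable H)
    (hμ0 : μ {0} = 0)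
    (hHμ : VagueTendstoOutside 0 (fun n => (n : ℝ≥0∞) • P.map fun ω => (a n)⁻¹ • H ω) μ)
    (hS : ScaledTailLimit atTop (normTail P H) (fun n : ℕ => (n : ℝ)) a
      fun x => μ.real {y | x < ‖y‖})
    (hα : 0 < α) (hκ : 0 < κ) (hG : ∀ x, 0 < x → μ.real {y | x < ‖y‖} = κ * x ^ (-α))
    (hM : Tendsto M atTop atTop) (hf : Continuous f) (hC : ∀ x, |f x| ≤ C)
    (hf0 : ∀ x, ‖x‖ ≤ (k : ℝ) - 1 + δ → f x = 0) (hδ : 0 < δ) :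
    Tendsto (fun n : ℕ => (∫ x, f (∑ i, x i) ∂(Measure.pi fun _ : Fin k =>
      retractedLaw P H (M n))) / normTail P H (M n) ^ k) atTop (𝓝 (∫ x, f x ∂(nuConv μ k))) := by
  have := sigmaFinite_nu hκ hG hμ0
  have := fun n => isProbabilityMeasure_retractedLaw (P := P) hH (M n)
  have hmeas (n : ℕ) : AEMeasurable (fun ω => ballRetract ((M n)⁻¹ • H ω)) P :=
    ((measurable_ballRetract_smul _).comp hH).aemeasurable
  have hlim := tendsto_integral_pi_div_pow (ι := Fin k) (m := fun n => retractedLaw P H (M n))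
    (t := {x | ‖x‖ ≤ 1}) (F := fun x => f (∑ i, x i)) (fun n => (hS.pos (M n)).le)
    (half_lt_self hδ)
    (fun n => (ae_map_iff (hmeas n) (measurableSet_le measurable_norm measurable_const)).2
      (.of_forall fun ω => norm_ballRetract_le_one _))
    (ae_nu_norm_le_one hκ hG) (nu_setOf_lt_norm_ne_top hκ hG (half_pos hδ))
    (fun g hg hg0 => by
      rw [integral_nu hκ hG hg]
      refine (tendsto_integral_ballRetract_div_normTail hH hHμ hS hα hκ hG hM hg (half_pos hδ)
        hg0).congr fun n => ?_
      rw [retractedLaw, integral_map (hmeas n) hg.aestronglyMeasurable])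
    (by fun_prop) (fun x => hC _) fun x hx ⟨i, hi⟩ => hf0 _ ?_
  · simpa only [Fintype.card_fin, ← integral_nuConv hf] using hlim
  · simpa only [Finset.card_univ, Fintype.card_fin] using
      norm_sum_le_card_sub_one_add (fun j _ => hx j) (Finset.mem_univ i) hi

lemma tendsto_integral_rowSum_div [IsProbabilityMeasure P] (hH : Measurable H) (hμ0 : μ {0} = 0)
    (hHμ : VagueTendstoOutside 0 (fun n => (n : ℝ≥0∞) • P.map fun ω => (a n)⁻¹ • H ω) μ)
    (hS : ScaledTailLimit atTop (normTail P H) (fun n : ℕ => (n : ℝ)) a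
      fun x => μ.real {y | x < ‖y‖})
    (hα : 0 < α) (hκ : 0 < κ) (hG : ∀ x, 0 < x → μ.real {y | x < ‖y‖} = κ * x ^ (-α))
    (hHs : ∀ j, Measurable (Hs j)) (hHid : ∀ j, IdentDistrib (Hs j) H P P)
    (hHind : iIndepFun Hs P) (hLs : ∀ j, Measurable (Ls j)) (hLs0 : ∀ j ω, 0 ≤ Ls j ω)
    (hLid : ∀ j, IdentDistrib (Ls j) L P P)
    (hHL : IndepFun (fun ω j => Hs j ω) (fun ω j => Ls j ω) P)
    (hMpos : ∀ n, 0 < M n) (hM : Tendsto M atTop atTop)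
    (hsoft : Tendsto (fun n : ℕ => n * normTail P H (M n)) atTop (𝓝 0)) (hk : 1 ≤ k)
    (hLtail : (fun x => P.real {ω | x < L ω}) =o[atTop] fun x => normTail P H x ^ (k - 1))
    (hsmall : SmallJumpsNegligible P Hs M fun n => (n * normTail P H (M n)) ^ k)
    (hf : Continuous f) (hC : ∀ x, |f x| ≤ C) (hf0 : ∀ x, ‖x‖ ≤ (k : ℝ) - 1 + δ → f x = 0)
    (hδ : 0 < δ) :
    Tendsto (fun n : ℕ => (∫ ω, f ((M n)⁻¹ • rowSum M Hs Ls n ω) ∂P) /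
      (n * normTail P H (M n)) ^ k) atTop (𝓝 ((k.factorial : ℝ)⁻¹ * ∫ x, f x ∂(nuConv μ k))) := by
  have hα' := isTailIndex_of_scaledTailLimit hH hS hα hκ hG
  have hpi := tendsto_integral_pi_retractedLaw_div hH hμ0 hHμ hS hα hκ hG hM hf hC hf0 hδ
  have hrem := (isLittleO_integral_rowSum_sub hα' hS.pos hHs hHid hHind hLs hLs0 hLid hHL hMpos hM
    hsoft hk hLtail hsmall hf hC hf0 hδ).tendsto_div_nhds_zero
  have hlim := ((tendsto_choose_div_pow k).mul hpi).add hrem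
  rw [add_zero] at hlim
  refine hlim.congr fun n => ?_
  rw [mul_pow, div_mul_div_comm, ← add_div, add_sub_cancel]

end RowSumLimit

section NormTails

variable {d : ℕ} {r x : ℝ} {m : ℕ → Measure (Vec d)} {m' : Measure (Vec d)}

lemma tendsto_measureReal_setOf_lt_norm (hr : 0 ≤ r) (h : VagueTendstoOutside r m m')
    (hm : ∀ᶠ n in atTop, IsFiniteMeasure (m n)) (hx : r < x) (hnull : m' {y | ‖y‖ = x} = 0) :
    Tendsto (fun n => (m n).real {y | x < ‖y‖}) atTop (𝓝 (m'.real {y | x < ‖y‖})) := by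
  have hfin (p : ℝ) (hp : r < p) : m' {y | p < ‖y‖} ≠ ∞ := measure_setOf_lt_norm_ne_top h.1 hp
  refine tendsto_order.2 ⟨fun b hb => ?_, fun b hb => ?_⟩
  · obtain ⟨z, hxz, hz⟩ := exists_lt_measureReal_setOf_lt (hfin x hx) hb
    filter_upwards [hm, (tendsto_integral_ramp_norm h hr hx hxz).eventually_const_lt
      (hz.trans_le (le_integral_ramp measurable_norm hxz (hfin x hx)))] with n hmn hn
    exact hn.trans_le (integral_ramp_le measurable_norm hxz (measure_ne_top _ _))
  · obtain ⟨p, hrp, hpx, hp⟩ := exists_measureReal_setOf_lt_lt measurable_norm hx hfin hnull hb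
    filter_upwards [hm, (tendsto_integral_ramp_norm h hr hrp hpx).eventually_lt_const
      ((integral_ramp_le measurable_norm hpx (hfin p hrp)).trans_lt hp)] with n hmn hn
    exact (le_integral_ramp measurable_norm hpx (measure_ne_top _ _)).trans_lt hn

variable {Ω : Type*} [MeasurableSpace Ω] {P : Measure Ω} {Y : ℕ → Ω → Vec d} {q : ℕ → ℝ}

lemma vagueTendstoOutside_of_tendsto_integral (hY : ∀ n, Measurable (Y n)) (hq : ∀ n, 0 ≤ q n)
    (hr : 0 ≤ r) (hfin : ∀ δ : ℝ, 0 < δ → m' {y | r + δ < ‖y‖} ≠ ∞)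
    (hlim : ∀ f : Vec d → ℝ, Continuous f → (∃ C, ∀ x, |f x| ≤ C) →
      (∃ δ : ℝ, 0 < δ ∧ ∀ x, ‖x‖ ≤ r + δ → f x = 0) →
      Tendsto (fun n => (∫ ω, f (Y n ω) ∂P) / q n) atTop (𝓝 (∫ x, f x ∂m'))) :
    VagueTendstoOutside r (fun n => (ENNReal.ofReal (q n))⁻¹ • P.map (Y n)) m' := by
  refine ⟨isFiniteMeasureOnCompacts_extendOutside hr fun δ hδ => (hfin δ hδ).lt_top, fun f => ?_⟩
  obtain ⟨g, hg, hgC, hgδ, hfg⟩ := exists_continuous_integral_extendOutside_eq hr f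
  simp only [hfg, integral_smul_measure]
  refine (hlim g hg hgC hgδ).congr fun n => ?_
  rw [integral_map (hY n).aemeasurable hg.aestronglyMeasurable, ENNReal.toReal_inv,
    ENNReal.toReal_ofReal (hq n), smul_eq_mul, div_eq_inv_mul]

lemma isEquivalent_measureReal_lt_norm [IsFiniteMeasure P] (hY : ∀ n, Measurable (Y n))
    (hq : ∀ᶠ n in atTop, 0 < q n) (hr : 0 ≤ r)
    (h : VagueTendstoOutside r (fun n => (ENNReal.ofReal (q n))⁻¹ • P.map (Y n)) m') (hx : r < x)
    (hnull : m' {y | ‖y‖ = x} = 0) (hpos : m' {y | x < ‖y‖} ≠ 0) :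
    (fun n => P.real {ω | x < ‖Y n ω‖}) ~[atTop] fun n => m'.real {y | x < ‖y‖} * q n := by
  have hC : m'.real {y | x < ‖y‖} ≠ 0 :=
    (ENNReal.toReal_pos hpos (measure_setOf_lt_norm_ne_top h.1 hx)).ne'
  have hfin : ∀ᶠ n in atTop, IsFiniteMeasure ((ENNReal.ofReal (q n))⁻¹ • P.map (Y n)) := by
    filter_upwards [hq] with n hn
    exact Measure.smul_finite _ (ENNReal.inv_ne_top.2 (ENNReal.ofReal_pos.2 hn).ne')
  rw [isEquivalent_iff_tendsto_one (hq.mono fun n hn => mul_ne_zero hC hn.ne')]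
  have hlim := (tendsto_measureReal_setOf_lt_norm hr h hfin hx hnull).div_const
    (m'.real {y | x < ‖y‖})
  rw [div_self hC] at hlim
  refine hlim.congr' ?_
  filter_upwards [hq] with n hn
  rw [measureReal_ennreal_smul_apply, map_measureReal_apply (hY n)
    (measurableSet_lt measurable_const measurable_norm), ENNReal.toReal_inv,
    ENNReal.toReal_ofReal hn.le, Pi.div_apply, mul_comm (m'.real _), ← div_div, inv_mul_eq_div]
  rfl

end NormTails

section RowSumVague

variable {Ω : Type*} [MeasurableSpace Ω] {P : Measure Ω} {d : ℕ} {H : Ω → Vec d}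
  {Hs : ℕ → Ω → Vec d} {L : Ω → ℝ} {Ls : ℕ → Ω → ℝ} {M a : ℕ → ℝ} {k : ℕ} {α κ : ℝ}
  {μ : Measure (Vec d)}

lemma vagueTendstoOutside_rowSum [IsProbabilityMeasure P] (hH : Measurable H) (hμ0 : μ {0} = 0)
    (hHμ : VagueTendstoOutside 0 (fun n => (n : ℝ≥0∞) • P.map fun ω => (a n)⁻¹ • H ω) μ)
    (hS : ScaledTailLimit atTop (normTail P H) (fun n : ℕ => (n : ℝ)) a
      fun x => μ.real {y | x < ‖y‖})
    (hα : 0 < α) (hκ : 0 < κ) (hG : ∀ x, 0 < x → μ.real {y | x < ‖y‖} = κ * x ^ (-α))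
    (hHs : ∀ j, Measurable (Hs j)) (hHid : ∀ j, IdentDistrib (Hs j) H P P)
    (hHind : iIndepFun Hs P) (hLs : ∀ j, Measurable (Ls j)) (hLs0 : ∀ j ω, 0 ≤ Ls j ω)
    (hLid : ∀ j, IdentDistrib (Ls j) L P P)
    (hHL : IndepFun (fun ω j => Hs j ω) (fun ω j => Ls j ω) P)
    (hMpos : ∀ n, 0 < M n) (hM : Tendsto M atTop atTop)
    (hsoft : Tendsto (fun n : ℕ => n * normTail P H (M n)) atTop (𝓝 0)) (hk : 1 ≤ k)
    (hLtail : (fun x => P.real {ω | x < L ω}) =o[atTop] fun x => normTail P H x ^ (k - 1))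
    (hsmall : SmallJumpsNegligible P Hs M fun n => (n * normTail P H (M n)) ^ k) :
    VagueTendstoOutside ((k : ℝ) - 1)
      (fun n => (ENNReal.ofReal ((n * normTail P H (M n)) ^ k))⁻¹ •
        P.map (fun ω => (M n)⁻¹ • rowSum M Hs Ls n ω))
      ((k.factorial : ℝ≥0∞)⁻¹ • nuConv μ k) := by
  have hfact : (k.factorial : ℝ≥0∞)⁻¹ ≠ ∞ :=
    ENNReal.inv_ne_top.2 (Nat.cast_ne_zero.2 k.factorial_ne_zero)
  refine vagueTendstoOutside_of_tendsto_integral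
    (fun n => (measurable_rowSum hHs hLs n).const_smul (M n)⁻¹)
    (fun n => pow_nonneg (mul_nonneg n.cast_nonneg (hS.pos _).le) k)
    (sub_nonneg.2 (mod_cast hk)) (fun δ hδ => ?_) fun f hf ⟨C, hC⟩ ⟨δ, hδ, hf0⟩ => ?_
  · exact ENNReal.mul_ne_top hfact
      (nuConv_setOf_lt_norm_ne_top hκ hG hμ0 (lt_add_of_pos_right _ hδ))
  · rw [integral_smul_measure, ENNReal.toReal_inv, ENNReal.toReal_natCast, smul_eq_mul]
    exact tendsto_integral_rowSum_div hH hμ0 hHμ hS hα hκ hG hHs hHid hHind hLs hLs0 hLid hHL hMpos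
      hM hsoft hk hLtail hsmall hf hC hf0 hδ

end RowSumVague

end TruncatedTails

end

open TruncatedTails in
theorem theorem2p2_general
    {Ω : Type*} [MeasurableSpace Ω] (P : Measure Ω) [IsProbabilityMeasure P] {d : ℕ}
    (H : Ω → Vec d) (hH : Measurable H)
    (μ : Measure (Vec d)) (hμ0 : μ {0} = 0) (hμ : μ ≠ 0)
    (a : ℕ → ℝ) (ha : Tendsto a atTop atTop)
    (hHμ : VagueTendstoOutside 0 (fun n => (n : ℝ≥0∞) • P.map (fun ω => (a n)⁻¹ • H ω)) μ)
    (hsymm : ∀ α, IsTailIndex P H α → α = 1 → P.map (fun ω => -H ω) = P.map H)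
    (hcent : ∀ α, IsTailIndex P H α → 1 < α → Integrable H P ∧ ∫ ω, H ω ∂P = 0)
    (L : Ω → ℝ) (Hs : ℕ → Ω → Vec d) (hHs : ∀ j, Measurable (Hs j))
    (Ls : ℕ → Ω → ℝ) (hLs : ∀ j, Measurable (Ls j)) (hLs0 : ∀ j ω, 0 ≤ Ls j ω)
    (hHid : ∀ j, IdentDistrib (Hs j) H P P) (hLid : ∀ j, IdentDistrib (Ls j) L P P)
    (hHind : iIndepFun Hs P) (hHL : IndepFun (fun ω j => Hs j ω) (fun ω j => Ls j ω) P)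
    (M : ℕ → ℝ) (hMpos : ∀ n, 0 < M n) (hM : Tendsto M atTop atTop)
    (hsoft : Tendsto (fun n : ℕ => n * normTail P H (M n)) atTop (𝓝 0))
    (hM2 : ∀ α, IsTailIndex P H α → α = 2 →
      ∃ γ : ℝ, 0 < γ ∧ Tendsto (fun n : ℕ => M n / √((n : ℝ) ^ (1 + γ))) atTop atTop)
    (hMgt2 : ∀ α, IsTailIndex P H α → 2 < α →
      Tendsto (fun n : ℕ => M n / √(n * Real.log (M n))) atTop atTop)
    (k : ℕ) (hk : 1 ≤ k)
    (hLtail : (fun x : ℝ => P.real {ω | x < L ω}) =o[atTop]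
      (fun x : ℝ => normTail P H x ^ (k - 1))) :
    VagueTendstoOutside ((k : ℝ) - 1)
      (fun n => (ENNReal.ofReal ((n * normTail P H (M n)) ^ k))⁻¹ •
        P.map (fun ω => (M n)⁻¹ • rowSum M Hs Ls n ω))
      ((k.factorial : ℝ≥0∞)⁻¹ • nuConv μ k) ∧
    (∀ r : ℝ, r ∈ Set.Ioo ((k : ℝ) - 1) k → nuConv μ k {x | ‖x‖ = r} = 0 →
      ∃ C : ℝ, 0 < C ∧
        (fun n : ℕ => P.real {ω | r * M n < ‖rowSum M Hs Ls n ω‖}) ~[atTop]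
          (fun n : ℕ => C * (n * normTail P H (M n)) ^ k)) ∧
    {r : ℝ | r ∈ Set.Ioo ((k : ℝ) - 1) k ∧ nuConv μ k {x | ‖x‖ = r} ≠ 0}.Countable := by
  have hS := scaledTailLimit hH hμ0 hμ ha hHμ
  obtain ⟨α, κ, hα, hκ, hG⟩ := hS.exists_rpow
  have hidx := isTailIndex_of_scaledTailLimit hH hS hα hκ hG
  have hr0 : (0 : ℝ) ≤ k - 1 := sub_nonneg.2 (mod_cast hk)
  have hsmall := smallJumpsNegligible hH hS.pos hidx (hsymm α hidx) (hcent α hidx) hHs hHid hHind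
    hMpos hM hsoft (hM2 α hidx) (hMgt2 α hidx) k
  have hY (n : ℕ) : Measurable fun ω => (M n)⁻¹ • rowSum M Hs Ls n ω :=
    (measurable_rowSum hHs hLs n).const_smul (M n)⁻¹
  have hvague := vagueTendstoOutside_rowSum hH hμ0 hHμ hS hα hκ hG hHs hHid hHind hLs hLs0 hLid hHL
    hMpos hM hsoft hk hLtail hsmall
  refine ⟨hvague, fun r hr hnull => ?_,
    (countable_nuConv_sphere_ne_zero hκ hG hμ0).mono fun r hr => hr.2⟩
  have hq : ∀ᶠ n : ℕ in atTop, 0 < (n * normTail P H (M n)) ^ k := by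
    filter_upwards [eventually_gt_atTop 0] with n hn
    exact pow_pos (mul_pos (Nat.cast_pos.2 hn) (hS.pos _)) k
  have hpos : ((k.factorial : ℝ≥0∞)⁻¹ • nuConv μ k) {x | r < ‖x‖} ≠ 0 :=
    mul_ne_zero (ENNReal.inv_ne_zero.2 (ENNReal.natCast_ne_top _))
      (nuConv_setOf_lt_norm_ne_zero hκ hG hμ0 hk hr.2)
  have hequiv := isEquivalent_measureReal_lt_norm hY hq hr0 hvague hr.1
    (by rw [Measure.smul_apply, hnull, smul_zero]) hpos
  simp only [measureReal_lt_norm_smul_inv (hMpos _), mul_comm _ r] at hequiv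
  exact ⟨_, ENNReal.toReal_pos hpos (measure_setOf_lt_norm_ne_top hvague.1 hr.1), hequiv⟩

theorem theorem2p2
    {Ω : Type*} [MeasurableSpace Ω] (P : Measure Ω) [IsProbabilityMeasure P] {d : ℕ}
    -- the heavy-tailed vector `H`, with limit measure `μ` and norming sequence `a`
    (H : Ω → TruncatedTails.Vec d) (hH : Measurable H)
    (μ : Measure (TruncatedTails.Vec d)) (hμ0 : μ {0} = 0) (hμ : μ ≠ 0)
    (a : ℕ → ℝ) (ha : Tendsto a atTop atTop)
    (hHμ : TruncatedTails.VagueTendstoOutside 0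
      (fun n => (n : ℝ≥0∞) • P.map (fun ω => (a n)⁻¹ • H ω)) μ)
    -- symmetry or centering of `H`, according to its tail index `α`: the index is unique and its
    -- existence follows from the previous hypothesis, hence it is not assumed
    (hsymm : ∀ α, TruncatedTails.IsTailIndex P H α → α = 1 →
      P.map (fun ω => -H ω) = P.map H)
    (hcent : ∀ α, TruncatedTails.IsTailIndex P H α → 1 < α →
      Integrable H P ∧ ∫ ω, H ω ∂P = 0)
    -- the nonnegative random variable `L`, and the i.i.d. copies of `H` and `L`
    (L : Ω → ℝ) (hL : Measurable L) (hL0 : ∀ ω, 0 ≤ L ω)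
    (Hs : ℕ → Ω → TruncatedTails.Vec d) (hHs : ∀ j, Measurable (Hs j))
    (Ls : ℕ → Ω → ℝ) (hLs : ∀ j, Measurable (Ls j)) (hLs0 : ∀ j ω, 0 ≤ Ls j ω)
    (hHid : ∀ j, IdentDistrib (Hs j) H P P) (hLid : ∀ j, IdentDistrib (Ls j) L P P)
    (hHind : iIndepFun Hs P) (hLind : iIndepFun Ls P)
    (hHL : IndepFun (fun ω j => Hs j ω) (fun ω j => Ls j ω) P)
    -- the truncation levels: soft truncation, and growth according to the tail index
    (M : ℕ → ℝ) (hMpos : ∀ n, 0 < M n) (hM : Tendsto M atTop atTop)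
    (hsoft : Tendsto (fun n : ℕ => n * TruncatedTails.normTail P H (M n)) atTop (𝓝 0))
    (hM2 : ∀ α, TruncatedTails.IsTailIndex P H α → α = 2 →
      ∃ γ : ℝ, 0 < γ ∧ Tendsto (fun n : ℕ => M n / √((n : ℝ) ^ (1 + γ))) atTop atTop)
    (hMgt2 : ∀ α, TruncatedTails.IsTailIndex P H α → 2 < α →
      Tendsto (fun n : ℕ => M n / √(n * Real.log (M n))) atTop atTop)
    (k : ℕ) (hk : 1 ≤ k)
    (hLtail : (fun x : ℝ => P.real {ω | x < L ω}) =o[atTop]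
      (fun x : ℝ => TruncatedTails.normTail P H x ^ (k - 1))) :
    -- vague convergence
    TruncatedTails.VagueTendstoOutside ((k : ℝ) - 1)
      (fun n => (ENNReal.ofReal ((n * TruncatedTails.normTail P H (M n)) ^ k))⁻¹ •
        P.map (fun ω => (M n)⁻¹ • TruncatedTails.rowSum M Hs Ls n ω))
      ((k.factorial : ℝ≥0∞)⁻¹ • TruncatedTails.nuConv μ k) ∧
    -- decay rate of the tail probabilities of the norm, for all but countably many `r`
    (∀ r : ℝ, r ∈ Set.Ioo ((k : ℝ) - 1) k →
      TruncatedTails.nuConv μ k {x | ‖x‖ = r} = 0 →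
      ∃ C : ℝ, 0 < C ∧
        (fun n : ℕ => P.real {ω | r * M n < ‖TruncatedTails.rowSum M Hs Ls n ω‖}) ~[atTop]
          (fun n : ℕ => C * (n * TruncatedTails.normTail P H (M n)) ^ k)) ∧
    {r : ℝ | r ∈ Set.Ioo ((k : ℝ) - 1) k ∧
      TruncatedTails.nuConv μ k {x | ‖x‖ = r} ≠ 0}.Countable := by
  exact theorem2p2_general P H hH μ hμ0 hμ a ha hHμ hsymm hcent L Hs hHs Ls hLs hLs0
    hHid hLid hHind hHL M hMpos hM hsoft hM2 hMgt2 k hk hLtail
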